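/- Let $d\ge 2$, $n\ge 1$, let $\Omega\subset\mathbb{R}^d$ be a bounded domain, and let $0<\alpha\le\beta<\infty$, $\gamma\in(0,1]$. Let $\mathcal{M}(\alpha,\beta;\Omega)$ be the set of $A\in L^\infty(\Omega;\mathbb{R}^{d\times d})$ such that, for a.e. $x\in\Omega$ and all $\xi\in\mathbb{R}^d$, $A(x)\xi\cdot\xi\ge\alpha|\xi|^2$ and $A(x)^{-1}\xi\cdot\xi\ge\beta^{-1}|\xi|^2$. A family $(A_k)\subset\mathcal{M}(\alpha,\beta;\Omega)$ *$H$-converges* to $\bar A$, where $\bar A\in\mathcal{M}(\alpha',\beta';\Omega)$ for some $0<\alpha'\le\beta'<\infty$, if for every $f\in H^{-1}(\Omega)$ the solutions $u_k\in H^1_0(\Omega)$ of $-\operatorname{div}(A_k\nabla u_k)=f$ converge weakly in $H^1_0(\Omega)$ to the solution $\bar u\in H^1_0(\Omega)$ of $-\operatorname{div}(\bar A\nabla\bar u)=f$, and $A_k\nabla u_k$ converges to $\bar A\nabla\bar u$ weakly in $L^2(\Omega;\mathbb{R}^d)$. Let $A=A(x,y_1,\dots,y_n)$, $x\in\Omega$,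 $y_i\in\mathbb{R}^d$, be a $d\times d$ real matrix function such that: 1. $A(\cdot,y_1,\dots,y_n)\in\mathcal{M}(\alpha,\beta;\Omega)$ for all $y_1,\dots,y_n\in\mathbb{R}^d$; 2. $A$ is $C^\gamma$-Hölder continuous in all variables: there is $L>0$ with $|A(x,y_1,\dots,y_n)-A(x',y_1',\dots,y_n')|\le L\big(|x-x'|+\sum_{i=1}^n|y_i-y_i'|\big)^\gamma$ for all $x,x'\in\Omega$ and $y_i,y_i'\in\mathbb{R}^d$; 3. $A$ is quasi-periodic in every $y_i$: there are integers $m_i\ge d$, real $m_i\times d$ matrices $M_i$ with $M_i^Tz\ne0$ for all $z\in\mathbb{Z}^{m_i}\setminus\{0\}$, and a continuous matrix function $B(x,w_1,\dots,w_n)$, $x\in\Omega$, $w_i\in\mathbb{R}^{m_i}$, that is $\mathbb{Z}^{m_i}$-periodic in each $w_i$, such that $A(x,y_1,\dots,y_n)=B(x,M_1y_1,\dots,M_ny_n)$. Let $\varepsilon_1,\dots,\varepsilon_n>0$ depend on a parameter $\varepsilon$ (or on the index of a sequence) in such a way that, as $\varepsilon\to0$ (or as the index tends to infinity), $\varepsilon_1\to0$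 and $\varepsilon_{i+1}/\varepsilon_i\to0$ for $1\le i\le n-1$. Then $A_\varepsilon(x)=A(x,x/\varepsilon_1,\dots,x/\varepsilon_n)$ $H$-converges in $\Omega$ to some $\bar A\in\mathcal{M}(\alpha,\beta;\Omega)$ that is $C^\gamma$-Hölder continuous on $\Omega$. -/

import Mathlib

open MeasureTheory Filter Topology
open scoped ENNReal

namespace Homogenization

noncomputable section

/-- `ℝ^d` with its Euclidean norm. -/
abbrev Space (d : ℕ) : Type := EuclideanSpace ℝ (Fin d)

/-- The class `M(α, β; Ω)`: matrix fields `A ∈ L^∞(Ω; ℝ^{d×d})` with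
`A(x)⁻¹ ξ · ξ ≥ β⁻¹ |ξ|²` and `A(x) ξ · ξ ≥ α |ξ|²` for all `ξ`, for a.e. `x ∈ Ω`. -/
structure MemM {d : ℕ} (α β : ℝ) (Ω : Set (Space d))
    (A : Space d → Matrix (Fin d) (Fin d) ℝ) : Prop where
  memLp : ∀ i j, MemLp (fun x => A x i j) ∞ (volume.restrict Ω)
  inv_coercive : ∀ᵐ x ∂(volume.restrict Ω), ∀ ξ : Space d,
    β⁻¹ * ‖ξ‖ ^ 2 ≤ inner ℝ (Matrix.toEuclideanLin (A x)⁻¹ ξ) ξ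
  coercive : ∀ᵐ x ∂(volume.restrict Ω), ∀ ξ : Space d,
    α * ‖ξ‖ ^ 2 ≤ inner ℝ (Matrix.toEuclideanLin (A x) ξ) ξ

/-- The Hilbert space `L²(Ω) × L²(Ω; ℝ^d)` of pairs `(u, G)`, with the norm
`(‖u‖² + ‖G‖²)^{1/2}`. A Sobolev function `u` is represented by the pair `(u, ∇u)`,
so that this norm is the `H¹(Ω)` norm. -/
abbrev L2Pair {d : ℕ} (Ω : Set (Space d)) : Type :=
  WithLp 2 (Lp ℝ 2 (volume.restrict Ω) × Lp (Space d) 2 (volume.restrict Ω))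

/-- The pairs `(φ, ∇φ)` with `φ ∈ C_c^∞(Ω)`. -/
def testPairs {d : ℕ} (Ω : Set (Space d)) : Set (L2Pair Ω) :=
  {p | ∃ φ : Space d → ℝ, ContDiff ℝ ((⊤ : ℕ∞) : WithTop ℕ∞) φ ∧ HasCompactSupport φ ∧
    tsupport φ ⊆ Ω ∧ (p.fst =ᵐ[volume.restrict Ω] φ) ∧
    (p.snd =ᵐ[volume.restrict Ω] gradient φ)}

/-- `H¹₀(Ω)`: the closure of `C_c^∞(Ω)` in the `H¹(Ω)` norm (the set `testPairs Ω` is already a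
linear subspace). The gradient being closable, `u` determines the second component, which is its
weak gradient. -/
def H10 {d : ℕ} (Ω : Set (Space d)) : Submodule ℝ (L2Pair Ω) :=
  (Submodule.span ℝ (testPairs Ω)).topologicalClosure

/-- The weak gradient of `u ∈ H¹₀(Ω)`. -/
def grad {d : ℕ} {Ω : Set (Space d)} (u : H10 Ω) : Lp (Space d) 2 (volume.restrict Ω) :=
  (u : L2Pair Ω).snd

/-- `H⁻¹(Ω)`, the dual of `H¹₀(Ω)`. -/
abbrev HNegOne {d : ℕ} (Ω : Set (Space d)) : Type := StrongDual ℝ (H10 Ω)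

/-- `u ∈ H¹₀(Ω)` is a weak solution of `-div(A ∇u) = f` in `Ω`. -/
def IsWeakSolution {d : ℕ} {Ω : Set (Space d)} (A : Space d → Matrix (Fin d) (Fin d) ℝ)
    (f : HNegOne Ω) (u : H10 Ω) : Prop :=
  ∀ v : H10 Ω, ∫ x in Ω, inner ℝ (Matrix.toEuclideanLin (A x) (grad u x)) (grad v x) = f v

/-- `H`-convergence in `Ω`, along the filter `l`, of a family `(A k) ⊂ M(α, β; Ω)` to `Abar`
(for a sequence, `l = atTop` on `ℕ`): for every `f ∈ H⁻¹(Ω)`, the solutions `u k ∈ H¹₀(Ω)` of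
`-div(A k ∇(u k)) = f` converge weakly in `H¹₀(Ω)` to the solution `ubar` of
`-div(Abar ∇ubar) = f`, and the fluxes `A k ∇(u k)` converge to `Abar ∇ubar` weakly in
`L²(Ω; ℝ^d)`. -/
structure HConverges {d : ℕ} {ι : Type*} (α β : ℝ) (Ω : Set (Space d)) (l : Filter ι)
    (A : ι → Space d → Matrix (Fin d) (Fin d) ℝ)
    (Abar : Space d → Matrix (Fin d) (Fin d) ℝ) : Prop where
  mem : ∀ k, MemM α β Ω (A k)
  mem_limit : ∃ α' β' : ℝ, 0 < α' ∧ α' ≤ β' ∧ MemM α' β' Ω Abar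
  tendsto : ∀ f : HNegOne Ω, ∃ (u : ι → H10 Ω) (ubar : H10 Ω),
    (∀ k v, IsWeakSolution (A k) f v ↔ v = u k) ∧
    (∀ v, IsWeakSolution Abar f v ↔ v = ubar) ∧
    (∀ g : HNegOne Ω, Tendsto (fun k => g (u k)) l (𝓝 (g ubar))) ∧
    (∀ g : Lp (Space d) 2 (volume.restrict Ω),
      Tendsto (fun k => ∫ x in Ω, inner ℝ (Matrix.toEuclideanLin (A k x) (grad (u k) x)) (g x)) l
        (𝓝 (∫ x in Ω, inner ℝ (Matrix.toEuclideanLin (Abar x) (grad ubar x)) (g x))))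

/-- `A(x, y₁, …, y_n)` is `C^γ` in all variables, for `x ∈ Ω` and `y_i ∈ ℝ^d`. (Bounding each
entry is the same as bounding a matrix norm, up to the constant `L`.) -/
def IsHolder {d n : ℕ} (γ : ℝ) (Ω : Set (Space d))
    (A : Space d → (Fin n → Space d) → Matrix (Fin d) (Fin d) ℝ) : Prop :=
  ∃ L : ℝ, 0 < L ∧ ∀ x ∈ Ω, ∀ x' ∈ Ω, ∀ y y' : Fin n → Space d, ∀ i j,
    |A x y i j - A x' y' i j| ≤ L * (‖x - x'‖ + ∑ k, ‖y k - y' k‖) ^ γ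

/-- `A(x, y₁, …, y_n)` is quasi-periodic in every `y_i`: it is
`B(x, M₁ y₁, …, M_n y_n)` with `B(x, w₁, …, w_n)` continuous and `1`-periodic in
`w_i ∈ ℝ^{m_i}`, `m_i ≥ d`, and `M_i` real `m_i × d` matrices with `M_iᵀ z ≠ 0` for all
`z ∈ ℤ^{m_i} \ {0}`. -/
def IsQuasiPeriodic {d n : ℕ} (Ω : Set (Space d))
    (A : Space d → (Fin n → Space d) → Matrix (Fin d) (Fin d) ℝ) : Prop :=
  ∃ (m : Fin n → ℕ) (M : ∀ i, Matrix (Fin (m i)) (Fin d) ℝ)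
    (B : Space d → (∀ i, Fin (m i) → ℝ) → Matrix (Fin d) (Fin d) ℝ),
    (∀ i, d ≤ m i) ∧
    (∀ i, ∀ z : Fin (m i) → ℤ, z ≠ 0 → (M i).transpose.mulVec (fun j => (z j : ℝ)) ≠ 0) ∧
    ContinuousOn (fun p : Space d × (∀ i, Fin (m i) → ℝ) => B p.1 p.2) (Ω ×ˢ Set.univ) ∧
    (∀ x ∈ Ω, ∀ (w : ∀ i, Fin (m i) → ℝ) (z : ∀ i, Fin (m i) → ℤ),
      B x (fun i j => w i j + (z i j : ℝ)) = B x w) ∧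
    (∀ x ∈ Ω, ∀ y : Fin n → Space d, A x y = B x (fun i => (M i).mulVec (y i).ofLp))

/-- The scale-separation condition along `l`: `ε₁ → 0` and `ε_{i+1} / ε_i → 0` for `1 ≤ i < n`
(the scales are indexed by `Fin n`, so `ε₁` is the one of index `0`). -/
def ScalesSeparate {n : ℕ} {ι : Type*} (l : Filter ι) (ε : ι → Fin n → ℝ) : Prop :=
  (∀ i : Fin n, (i : ℕ) = 0 → Tendsto (fun k => ε k i) l (𝓝 0)) ∧
  (∀ i j : Fin n, (j : ℕ) = i + 1 → Tendsto (fun k => ε k j / ε k i) l (𝓝 0))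

end

end Homogenization

open MeasureTheory Filter Topology
open scoped ENNReal

namespace Homogenization

noncomputable section

/-! ### Elliptic operators on a Hilbert space -/

section Elliptic

variable {H : Type*} [NormedAddCommGroup H] [InnerProductSpace ℝ H]

/-- `T` satisfies `⟪T x, x⟫ ≥ α ‖x‖²` and `⟪T x, x⟫ ≥ β⁻¹ ‖T x‖²`, the latter in
division-free form. -/
structure Elliptic (α β : ℝ) (T : H →L[ℝ] H) : Prop where
  coercive : ∀ x, α * ‖x‖ ^ 2 ≤ inner ℝ (T x) x
  sq_le : ∀ x, ‖T x‖ ^ 2 ≤ β * inner ℝ (T x) x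

namespace Elliptic

variable {α β : ℝ} {T : H →L[ℝ] H}

theorem norm_apply_le (hT : Elliptic α β T) (hβ : 0 < β) (x : H) : ‖T x‖ ≤ β * ‖x‖ := by
  by_cases h : ‖T x‖ = 0
  · rw [h]; positivity
  · have hpos : 0 < ‖T x‖ := lt_of_le_of_ne (norm_nonneg _) (Ne.symm h)
    have h1 := hT.sq_le x
    have h2 := mul_le_mul_of_nonneg_left (real_inner_le_norm (T x) x) hβ.le
    nlinarith

theorem norm_le (hT : Elliptic α β T) (hβ : 0 < β) : ‖T‖ ≤ β :=
  T.opNorm_le_bound hβ.le (hT.norm_apply_le hβ)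

/-- The second ellipticity inequality says that `(2 / β) T - 1` is a contraction. -/
theorem sq_le_iff_norm_le (hβ : 0 < β) :
    (∀ x, ‖T x‖ ^ 2 ≤ β * inner ℝ (T x) x) ↔ ‖(2 / β) • T - 1‖ ≤ 1 := by
  have key : ∀ x, ‖((2 / β) • T - 1) x‖ ^ 2 =
      ‖x‖ ^ 2 + 4 / β ^ 2 * (‖T x‖ ^ 2 - β * inner ℝ (T x) x) := by
    intro x
    simp only [sub_apply, smul_apply,
      one_apply_eq_self]
    rw [norm_sub_sq_real, norm_smul, real_inner_smul_left, Real.norm_eq_abs, mul_pow, sq_abs]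
    field_simp
    ring
  constructor
  · intro h
    refine ContinuousLinearMap.opNorm_le_bound _ zero_le_one fun x => ?_
    rw [one_mul]
    refine le_of_sq_le_sq ?_ (norm_nonneg _)
    rw [key]
    have : 4 / β ^ 2 * (‖T x‖ ^ 2 - β * inner ℝ (T x) x) ≤ 0 :=
      mul_nonpos_of_nonneg_of_nonpos (by positivity) (by linarith [h x])
    linarith
  · intro h x
    have h1 : ‖((2 / β) • T - 1) x‖ ≤ ‖x‖ := by
      simpa using ContinuousLinearMap.le_of_opNorm_le _ h x
    have h2 := pow_le_pow_left₀ (norm_nonneg _) h1 2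
    rw [key] at h2
    have h3 : 4 / β ^ 2 * (‖T x‖ ^ 2 - β * inner ℝ (T x) x) ≤ 0 := by linarith
    by_contra hc
    have : 0 < 4 / β ^ 2 * (‖T x‖ ^ 2 - β * inner ℝ (T x) x) :=
      mul_pos (by positivity) (by linarith)
    linarith

theorem adjoint [CompleteSpace H] (hT : Elliptic α β T) (hβ : 0 < β) :
    Elliptic α β (ContinuousLinearMap.adjoint T) := by
  refine ⟨fun x => ?_, (sq_le_iff_norm_le hβ).2 ?_⟩
  · rw [ContinuousLinearMap.adjoint_inner_left, real_inner_comm]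
    exact hT.coercive x
  · have h := (sq_le_iff_norm_le hβ).1 hT.sq_le
    have : (2 / β) • ContinuousLinearMap.adjoint T - 1 =
        ContinuousLinearMap.adjoint ((2 / β) • T - 1) := by
      have h1 : ContinuousLinearMap.adjoint (1 : H →L[ℝ] H) = 1 := ContinuousLinearMap.adjoint_id
      rw [map_sub, map_smulₛₗ, h1]
      simp
    rw [this, LinearIsometryEquiv.norm_map]
    exact h

variable (V : Submodule ℝ H)

/-- The bilinear form `(v, w) ↦ ⟪T v, w⟫` on a subspace. -/
def form (T : H →L[ℝ] H) : V →L[ℝ] V →L[ℝ] ℝ :=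
  ((innerSL ℝ).comp (T.comp V.subtypeL)).flip.comp V.subtypeL |>.flip

theorem form_apply (T : H →L[ℝ] H) (v w : V) : form V T v w = inner ℝ (T v) (w : H) := by
  rfl

theorem isCoercive_form (hT : Elliptic α β T) (hα : 0 < α) : IsCoercive (form V T) :=
  ⟨α, hα, fun v => by
    rw [form_apply, mul_assoc, ← sq]
    exact hT.coercive v⟩

variable {V} [CompleteSpace V]

/-- The corrector of `h` in the closed subspace `V`: the `v ∈ V` with `T (h + v) ⟂ V`. -/
def corrector (hT : Elliptic α β T) (hα : 0 < α) (V : Submodule ℝ H) [CompleteSpace V] :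
    H →L[ℝ] H :=
  -(V.subtypeL.comp (
    (hT.isCoercive_form V hα).continuousLinearEquivOfBilin.symm.toContinuousLinearMap.comp
      (V.orthogonalProjectionOnto.comp T)))

theorem corrector_mem (hT : Elliptic α β T) (hα : 0 < α) (h : H) : hT.corrector hα V h ∈ V := by
  simp [corrector]

theorem inner_corrector (hT : Elliptic α β T) (hα : 0 < α) (h : H) {w : H} (hw : w ∈ V) :
    inner ℝ (T (h + hT.corrector hα V h)) w = 0 := by
  set e := (hT.isCoercive_form V hα).continuousLinearEquivOfBilin with he
  set z : V := e.symm (V.orthogonalProjectionOnto (T h)) with hz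
  have h1 : hT.corrector hα V h = -(z : H) := rfl
  have h2 : inner ℝ (e z) (⟨w, hw⟩ : V) = inner ℝ (T z) w := by
    rw [he, IsCoercive.continuousLinearEquivOfBilin_apply]; rfl
  rw [hz, ContinuousLinearEquiv.apply_symm_apply, ← hz] at h2
  rw [h1, map_add, map_neg, inner_add_left, inner_neg_left, ← h2, Submodule.coe_inner]
  have h3 := V.inner_starProjection_left_eq_right (T h) w
  rw [V.starProjection_eq_self_iff.2 hw] at h3
  rw [← h3]
  exact sub_self _

theorem norm_corrector_le (hT : Elliptic α β T) (hα : 0 < α) (hβ : 0 < β) (h : H) :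
    ‖hT.corrector hα V h‖ ≤ β / α * ‖h‖ := by
  set v := hT.corrector hα V h with hv
  have h1 : inner ℝ (T (h + v)) v = 0 := hT.inner_corrector hα h (hT.corrector_mem hα h)
  have h2 := hT.coercive v
  rw [map_add, inner_add_left] at h1
  have h3 := abs_real_inner_le_norm (T h) v
  have h4 := hT.norm_apply_le hβ h
  have h5 := neg_abs_le (inner ℝ (T h) v)
  by_cases hz : ‖v‖ = 0
  · rw [hz]; positivity
  have hpos : 0 < ‖v‖ := lt_of_le_of_ne (norm_nonneg _) (Ne.symm hz)
  have h6 : α * ‖v‖ ≤ β * ‖h‖ := by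
    by_contra hc
    have : β * ‖h‖ * ‖v‖ < α * ‖v‖ * ‖v‖ := mul_lt_mul_of_pos_right (not_le.1 hc) hpos
    nlinarith [mul_le_mul_of_nonneg_right h4 hpos.le]
  rw [div_mul_eq_mul_div, le_div_iff₀ hα]
  linarith

theorem norm_corrector_sub_le {T' : H →L[ℝ] H} (hT : Elliptic α β T) (hT' : Elliptic α β T')
    (hα : 0 < α) (hβ : 0 < β) (h : H) :
    ‖hT.corrector hα V h - hT'.corrector hα V h‖ ≤
      (1 + β / α) / α * ‖T - T'‖ * ‖h‖ := by
  set v := hT.corrector hα V h with hv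
  set v' := hT'.corrector hα V h with hv'
  have hm : v - v' ∈ V := V.sub_mem (hT.corrector_mem hα h) (hT'.corrector_mem hα h)
  have h1 : inner ℝ (T (h + v)) (v - v') = 0 := hT.inner_corrector hα h hm
  have h1' : inner ℝ (T' (h + v')) (v - v') = 0 := hT'.inner_corrector hα h hm
  have h2 := hT.coercive (v - v')
  have h3 : T (v - v') = T (h + v) - T' (h + v') - (T - T') (h + v') := by
    simp only [map_add, map_sub, sub_apply]; abel
  rw [h3, inner_sub_left, inner_sub_left, h1, h1'] at h2
  have h4 := abs_real_inner_le_norm ((T - T') (h + v')) (v - v')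
  have h5 := (T - T').le_opNorm (h + v')
  have h6 : ‖h + v'‖ ≤ (1 + β / α) * ‖h‖ := by
    have := norm_add_le h v'
    have := hT'.norm_corrector_le (V := V) hα hβ h
    linarith
  have h7 := neg_abs_le (inner ℝ ((T - T') (h + v')) (v - v'))
  have h8 : ‖(T - T') (h + v')‖ ≤ ‖T - T'‖ * ((1 + β / α) * ‖h‖) :=
    h5.trans (mul_le_mul_of_nonneg_left h6 (norm_nonneg _))
  by_cases hz : ‖v - v'‖ = 0
  · rw [hz]; positivity
  have hpos : 0 < ‖v - v'‖ := lt_of_le_of_ne (norm_nonneg _) (Ne.symm hz)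
  have h9 : α * ‖v - v'‖ ≤ ‖T - T'‖ * ((1 + β / α) * ‖h‖) := by
    by_contra hc
    have := mul_lt_mul_of_pos_right (not_le.1 hc) hpos
    nlinarith [mul_le_mul_of_nonneg_right h8 hpos.le]
  have : (1 + β / α) / α * ‖T - T'‖ * ‖h‖ = (‖T - T'‖ * ((1 + β / α) * ‖h‖)) / α := by ring
  rw [this, le_div_iff₀ hα]
  linarith

variable [CompleteSpace H] {F : Type*} [NormedAddCommGroup F] [InnerProductSpace ℝ F] [CompleteSpace F]

/-- The effective operator `ξ ↦ J* T (J ξ + v)`, `v ∈ V` the corrector of `J ξ`. -/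
def effective (hT : Elliptic α β T) (hα : 0 < α) (V : Submodule ℝ H) [CompleteSpace V]
    (J : F →L[ℝ] H) : F →L[ℝ] F :=
  (ContinuousLinearMap.adjoint J).comp (T.comp (J + (hT.corrector hα V).comp J))

theorem inner_effective (hT : Elliptic α β T) (hα : 0 < α) (J : F →L[ℝ] H) (ξ η : F) :
    inner ℝ (hT.effective hα V J ξ) η = inner ℝ (T (J ξ + hT.corrector hα V (J ξ))) (J η) := by
  exact ContinuousLinearMap.adjoint_inner_left J η _

theorem elliptic_effective (hT : Elliptic α β T) (hα : 0 < α) (J : F →L[ℝ] H)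
    (hJ : ∀ ξ, ‖J ξ‖ = ‖ξ‖) (hJV : ∀ ξ, ∀ v ∈ V, inner ℝ (J ξ) v = 0) :
    Elliptic α β (hT.effective hα V J) := by
  have key : ∀ ξ, inner ℝ (hT.effective hα V J ξ) ξ =
      inner ℝ (T (J ξ + hT.corrector hα V (J ξ))) (J ξ + hT.corrector hα V (J ξ)) := by
    intro ξ
    rw [inner_effective, inner_add_right (T _), hT.inner_corrector hα _ (hT.corrector_mem hα _),
      add_zero]
  refine ⟨fun ξ => ?_, fun ξ => ?_⟩
  · rw [key]
    refine le_trans ?_ (hT.coercive _)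
    refine mul_le_mul_of_nonneg_left ?_ hα.le
    rw [norm_add_sq_real, hJV _ _ (hT.corrector_mem hα _), hJ]
    nlinarith [sq_nonneg ‖hT.corrector hα V (J ξ)‖]
  · rw [key]
    refine le_trans ?_ (hT.sq_le _)
    refine pow_le_pow_left₀ (norm_nonneg _) ?_ 2
    have hn : ‖ContinuousLinearMap.adjoint J‖ ≤ 1 := by
      rw [LinearIsometryEquiv.norm_map]
      exact J.opNorm_le_bound zero_le_one fun x => by rw [hJ, one_mul]
    simpa [effective] using
      ContinuousLinearMap.le_of_opNorm_le _ hn (T (J ξ + hT.corrector hα V (J ξ)))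

theorem norm_effective_sub_le {T' : H →L[ℝ] H} (hT : Elliptic α β T) (hT' : Elliptic α β T')
    (hα : 0 < α) (hβ : 0 < β) (J : F →L[ℝ] H) (hJ : ∀ ξ, ‖J ξ‖ = ‖ξ‖) :
    ‖hT.effective hα V J - hT'.effective hα V J‖ ≤
      (1 + β / α) * (1 + β / α) * ‖T - T'‖ := by
  refine ContinuousLinearMap.opNorm_le_bound _ (by positivity) fun ξ => ?_
  have hn : ‖ContinuousLinearMap.adjoint J‖ ≤ 1 := by
    rw [LinearIsometryEquiv.norm_map]
    exact J.opNorm_le_bound zero_le_one fun x => by rw [hJ, one_mul]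
  set v := hT.corrector hα V (J ξ) with hv
  set v' := hT'.corrector hα V (J ξ) with hv'
  have h1 : (hT.effective hα V J - hT'.effective hα V J) ξ =
      ContinuousLinearMap.adjoint J (T (v - v') + (T - T') (J ξ + v')) := by
    simp only [effective, sub_apply, ContinuousLinearMap.comp_apply,
      add_apply, ← hv, ← hv', ← map_sub]
    congr 1
    simp only [map_add, map_sub]
    abel
  rw [h1]
  refine (ContinuousLinearMap.le_of_opNorm_le _ hn _).trans ?_
  rw [one_mul]
  refine (norm_add_le _ _).trans ?_
  have h2 : ‖T (v - v')‖ ≤ β * ((1 + β / α) / α * ‖T - T'‖ * ‖ξ‖) := by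
    refine (hT.norm_apply_le hβ _).trans (mul_le_mul_of_nonneg_left ?_ hβ.le)
    rw [← hJ ξ]
    exact norm_corrector_sub_le hT hT' hα hβ _
  have h3 : ‖(T - T') (J ξ + v')‖ ≤ ‖T - T'‖ * ((1 + β / α) * ‖ξ‖) := by
    refine ((T - T').le_opNorm _).trans (mul_le_mul_of_nonneg_left ?_ (norm_nonneg _))
    have := norm_add_le (J ξ) v'
    have := hT'.norm_corrector_le (V := V) hα hβ (J ξ)
    rw [hJ] at *
    linarith
  refine (add_le_add h2 h3).trans (le_of_eq ?_)
  field_simp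
  ring

end Elliptic

end Elliptic

/-! ### Waves on the torus -/

section Torus

open UnitAddTorus

variable {I : Type*} [Fintype I] {d : ℕ}

/-- The Haar probability measure of the torus. -/
def torusMeasure (I : Type*) [Fintype I] : Measure (UnitAddTorus I) :=
  Measure.pi fun _ => AddCircle.haarAddCircle

instance : IsProbabilityMeasure (torusMeasure I) := by
  unfold torusMeasure; infer_instance

instance : (torusMeasure I).IsOpenPosMeasure := by
  unfold torusMeasure; infer_instance

theorem integral_fourier_haar {n : ℤ} (hn : n ≠ 0) :
    ∫ t : UnitAddCircle, fourier n t ∂AddCircle.haarAddCircle = 0 :=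
  integral_eq_zero_of_add_right_eq_neg (μ := AddCircle.haarAddCircle)
    (fourier_add_half_inv_index hn one_pos)

theorem integral_mFourier {k : I → ℤ} (hk : k ≠ 0) :
    ∫ t, mFourier k t ∂torusMeasure I = 0 := by
  obtain ⟨i, hi⟩ : ∃ i, k i ≠ 0 := Function.ne_iff.1 hk
  have : ∀ t, mFourier k t = ∏ i, (fourier (k i) (t i) : ℂ) := fun t => rfl
  simp_rw [this]
  rw [torusMeasure, integral_fintype_prod_eq_prod (fun i t => (fourier (k i) t : ℂ))]
  exact Finset.prod_eq_zero (Finset.mem_univ i) (integral_fourier_haar hi)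

/-- The real oscillation `w ↦ Re (b e^{2πi k·w}) c`. -/
def wave (k : I → ℤ) (b : ℂ) (c : Space d) : C(UnitAddTorus I, Space d) where
  toFun w := (b * mFourier k w).re • c
  continuous_toFun := by fun_prop

theorem wave_apply (k : I → ℤ) (b : ℂ) (c : Space d) (w : UnitAddTorus I) :
    wave k b c w = (b * mFourier k w).re • c := rfl

theorem integrable_continuousMap {F : Type*} [NormedAddCommGroup F] (f : C(UnitAddTorus I, F)) :
    Integrable f (torusMeasure I) :=
  f.continuous.integrable_of_hasCompactSupport (HasCompactSupport.of_compactSpace _)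

theorem integral_re_mul_mFourier {k : I → ℤ} (hk : k ≠ 0) (b : ℂ) :
    ∫ t, (b * mFourier k t).re ∂torusMeasure I = 0 := by
  have hint : Integrable (fun t => b * mFourier k t) (torusMeasure I) :=
    (integrable_continuousMap (mFourier k)).const_mul b
  have := integral_re hint
  simp only [RCLike.re_to_complex] at this
  rw [this, integral_const_mul, integral_mFourier hk]
  simp

theorem integral_re_mul_re {k j : I → ℤ} (h₁ : k + j ≠ 0) (h₂ : k - j ≠ 0) (a b : ℂ) :
    ∫ t, (a * mFourier k t).re * (b * mFourier j t).re ∂torusMeasure I = 0 := by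
  have key : ∀ t, (a * mFourier k t).re * (b * mFourier j t).re =
      2⁻¹ * (a * b * mFourier (k + j) t).re +
        2⁻¹ * (a * starRingEnd ℂ b * mFourier (k - j) t).re := by
    intro t
    rw [sub_eq_add_neg, mFourier_add, mFourier_add, mFourier_neg]
    simp only [Complex.mul_re, Complex.mul_im, Complex.conj_re, Complex.conj_im]
    ring
  simp_rw [key]
  rw [integral_add, integral_const_mul, integral_const_mul, integral_re_mul_mFourier h₁,
    integral_re_mul_mFourier h₂]
  · simp
  · exact (((integrable_continuousMap (mFourier (k + j))).const_mul _).re).const_mul _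
  · exact (((integrable_continuousMap (mFourier (k - j))).const_mul _).re).const_mul _

/-- `L²` of the torus with values in `ℝ^d`. -/
abbrev TorusL2 (I : Type*) [Fintype I] (d : ℕ) : Type _ := Lp (Space d) 2 (torusMeasure I)

/-- The inclusion of continuous functions in `L²` of the torus. -/
def toTorusL2 (I : Type*) [Fintype I] (d : ℕ) : C(UnitAddTorus I, Space d) →L[ℝ] TorusL2 I d :=
  ContinuousMap.toLp (E := Space d) 2 (torusMeasure I) ℝ

theorem coeFn_toTorusL2 (f : C(UnitAddTorus I, Space d)) :
    toTorusL2 I d f =ᵐ[torusMeasure I] f :=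
  ContinuousMap.coeFn_toLp (E := Space d) (p := 2) (torusMeasure I) (𝕜 := ℝ) f

theorem inner_toTorusL2 (f g : C(UnitAddTorus I, Space d)) :
    inner ℝ (toTorusL2 I d f) (toTorusL2 I d g) = ∫ t, inner ℝ (f t) (g t) ∂torusMeasure I := by
  rw [L2.inner_def]
  refine integral_congr_ae ?_
  filter_upwards [coeFn_toTorusL2 f, coeFn_toTorusL2 g] with t h1 h2
  rw [h1, h2]

theorem norm_toTorusL2_sq (f : C(UnitAddTorus I, Space d)) :
    ‖toTorusL2 I d f‖ ^ 2 = ∫ t, ‖f t‖ ^ 2 ∂torusMeasure I := by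
  rw [← real_inner_self_eq_norm_sq, inner_toTorusL2]
  simp_rw [real_inner_self_eq_norm_sq]

/-- The constants in `L²` of the torus. -/
def constTorusL2 (I : Type*) [Fintype I] (d : ℕ) : Space d →L[ℝ] TorusL2 I d :=
  (toTorusL2 I d).comp (ContinuousLinearMap.const ℝ (UnitAddTorus I))

theorem constTorusL2_eq (c : Space d) :
    constTorusL2 I d c = toTorusL2 I d (ContinuousMap.const _ c) := rfl

theorem norm_constTorusL2 (c : Space d) : ‖constTorusL2 I d c‖ = ‖c‖ := by
  have h : ‖constTorusL2 I d c‖ ^ 2 = ‖c‖ ^ 2 := by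
    rw [constTorusL2_eq, norm_toTorusL2_sq]; simp
  exact (sq_eq_sq₀ (norm_nonneg _) (norm_nonneg _)).1 h

theorem adjoint_constTorusL2 (f : C(UnitAddTorus I, Space d)) :
    ContinuousLinearMap.adjoint (constTorusL2 I d) (toTorusL2 I d f) =
      ∫ t, f t ∂torusMeasure I := by
  refine ext_inner_right ℝ fun c => ?_
  rw [ContinuousLinearMap.adjoint_inner_left, constTorusL2_eq, inner_toTorusL2,
    real_inner_comm, ← integral_inner (integrable_continuousMap f)]
  simp_rw [ContinuousMap.const_apply, real_inner_comm c]

variable (ζ : (I → ℤ) → Space d)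

/-- Trigonometric polynomials that are gradients along the direction field `ζ`. -/
def potentialWaves : Submodule ℝ C(UnitAddTorus I, Space d) :=
  Submodule.span ℝ {f | ∃ k b, f = wave k b (ζ k)}

/-- Trigonometric polynomials that are divergence free along the direction field `ζ`. -/
def solenoidalWaves : Submodule ℝ C(UnitAddTorus I, Space d) :=
  Submodule.span ℝ {f | ∃ k b c, inner ℝ c (ζ k) = 0 ∧ f = wave k b c}

/-- The closure in `L²` of the potential trigonometric polynomials. -/
def potentialL2 : Submodule ℝ (TorusL2 I d) :=
  ((potentialWaves ζ).map (toTorusL2 I d).toLinearMap).topologicalClosure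

/-- The closure in `L²` of the solenoidal trigonometric polynomials. -/
def solenoidalL2 : Submodule ℝ (TorusL2 I d) :=
  ((solenoidalWaves ζ).map (toTorusL2 I d).toLinearMap).topologicalClosure

instance : CompleteSpace (potentialL2 ζ) :=
  (Submodule.isClosed_topologicalClosure _).completeSpace_coe

theorem wave_mem_sup (k : I → ℤ) (b : ℂ) (c : Space d) :
    wave k b c ∈ potentialWaves ζ ⊔ solenoidalWaves ζ := by
  set t : ℝ := inner ℝ c (ζ k) / ‖ζ k‖ ^ 2 with ht
  have h : wave k b c = t • wave k b (ζ k) + wave k b (c - t • ζ k) := by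
    ext1 w
    simp only [ContinuousMap.add_apply, ContinuousMap.smul_apply, wave_apply, smul_sub]
    rw [smul_comm t]
    abel
  rw [h]
  refine add_mem (Submodule.mem_sup_left (Submodule.smul_mem _ _
    (Submodule.subset_span ⟨k, b, rfl⟩))) (Submodule.mem_sup_right
    (Submodule.subset_span ⟨k, b, _, ?_, rfl⟩))
  rw [inner_sub_left, real_inner_smul_left, real_inner_self_eq_norm_sq, ht]
  by_cases hz : ζ k = 0
  · simp [hz]
  · have : ‖ζ k‖ ≠ 0 := norm_ne_zero_iff.2 hz
    field_simp
    ring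

/-- Multiplication of the real part by a vector. -/
def reSMul (c : Space d) : C(UnitAddTorus I, ℂ) →L[ℝ] C(UnitAddTorus I, Space d) :=
  ContinuousLinearMap.compLeftContinuous ℝ _ (Complex.reCLM.smulRight c)


theorem reSMul_apply {I : Type*} (c : Space d) (f : C(UnitAddTorus I, ℂ)) (w : UnitAddTorus I) :
    reSMul c f w = (f w).re • c := rfl

theorem dense_sup_waves :
    (potentialWaves ζ ⊔ solenoidalWaves ζ).topologicalClosure = ⊤ := by
  set W := (potentialWaves ζ ⊔ solenoidalWaves ζ).topologicalClosure with hW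
  have h1 : ∀ (c : Space d) (f : C(UnitAddTorus I, ℂ)), reSMul c f ∈ W := by
    intro c f
    have hf : f ∈ (Submodule.span ℂ (Set.range (mFourier (d := I)))).topologicalClosure := by
      rw [span_mFourier_closure_eq_top]; trivial
    have hcl : IsClosed {g : C(UnitAddTorus I, ℂ) | reSMul c g ∈ W} :=
      (Submodule.isClosed_topologicalClosure _).preimage (reSMul c).continuous
    refine closure_minimal (fun g hg => ?_) hcl hf
    refine Submodule.le_topologicalClosure _ ?_
    have : ∀ b : ℂ, reSMul c (b • g) ∈ potentialWaves ζ ⊔ solenoidalWaves ζ := by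
      refine Submodule.span_induction ?_ ?_ ?_ ?_ hg
      · rintro _ ⟨k, rfl⟩ b
        exact wave_mem_sup ζ k b c
      · intro b; simp
      · intro x y _ _ hx hy b
        have : b • (x + y) = b • x + b • y := smul_add b x y
        rw [this, map_add]
        exact add_mem (hx b) (hy b)
      · intro a x _ hx b
        rw [smul_smul]
        exact hx _
    simpa using this 1
  rw [eq_top_iff]
  intro F _
  let G : Fin d → C(UnitAddTorus I, ℂ) := fun i => ⟨fun w => ((F w i : ℝ) : ℂ), by fun_prop⟩
  have hF : F = ∑ i, reSMul (EuclideanSpace.single i (1 : ℝ)) (G i) := by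
    ext w j
    simp [reSMul_apply, ContinuousMap.sum_apply, G, Finset.sum_apply, Pi.single_apply]
  rw [hF]
  exact sum_mem fun i _ => h1 _ _

theorem inner_potential_solenoidal (hζ : ∀ k, ζ (-k) = -ζ k) {f g : C(UnitAddTorus I, Space d)}
    (hf : f ∈ potentialWaves ζ) (hg : g ∈ solenoidalWaves ζ) :
    inner ℝ (toTorusL2 I d f) (toTorusL2 I d g) = 0 := by
  refine Submodule.span_induction ?_ ?_ ?_ ?_ hf
  · rintro _ ⟨k, b, rfl⟩
    refine Submodule.span_induction ?_ ?_ ?_ ?_ hg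
    · rintro _ ⟨j, a, c, hc, rfl⟩
      rw [inner_toTorusL2]
      simp_rw [wave_apply, real_inner_smul_left, real_inner_smul_right, ← mul_assoc]
      rw [integral_mul_const]
      by_cases h1 : k + j = 0
      · have : k = -j := eq_neg_of_add_eq_zero_left h1
        rw [this, hζ, inner_neg_left, real_inner_comm, hc]; simp
      by_cases h2 : k - j = 0
      · have : k = j := sub_eq_zero.1 h2
        rw [this, real_inner_comm, hc, mul_zero]
      · rw [integral_re_mul_re h1 h2, zero_mul]
    · simp
    · intro x y _ _ hx hy; rw [map_add, inner_add_right, hx, hy, add_zero]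
    · intro a x _ hx; rw [map_smul, real_inner_smul_right, hx, mul_zero]
  · simp
  · intro x y _ _ hx hy; rw [map_add, inner_add_left, hx, hy, add_zero]
  · intro a x _ hx; rw [map_smul, real_inner_smul_left, hx, mul_zero]

theorem inner_potentialL2_solenoidal (hζ : ∀ k, ζ (-k) = -ζ k) {v : TorusL2 I d}
    {g : C(UnitAddTorus I, Space d)} (hv : v ∈ potentialL2 ζ) (hg : g ∈ solenoidalWaves ζ) :
    inner ℝ (toTorusL2 I d g) v = 0 := by
  have hcl : IsClosed {v : TorusL2 I d | inner ℝ (toTorusL2 I d g) v = 0} :=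
    isClosed_eq (by fun_prop) continuous_const
  refine closure_minimal ?_ hcl hv
  rintro _ ⟨f, hf, rfl⟩
  simp only [Set.mem_ofPred_eq, ContinuousLinearMap.coe_coe]
  rw [real_inner_comm]
  exact inner_potential_solenoidal ζ hζ hf hg

theorem inner_constTorusL2_potential (hζ : ∀ k, ζ (-k) = -ζ k) (c : Space d) (v : TorusL2 I d)
    (hv : v ∈ potentialL2 ζ) : inner ℝ (constTorusL2 I d c) v = 0 := by
  have h0 : ζ 0 = 0 := by
    have := hζ 0
    rw [neg_zero] at this
    have h2 : (2 : ℝ) • ζ 0 = 0 := by rw [two_smul]; nth_rewrite 1 [this]; exact neg_add_cancel _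
    simpa using h2
  refine inner_potentialL2_solenoidal ζ hζ hv (Submodule.subset_span ⟨0, 1, c, ?_, ?_⟩)
  · simp [h0]
  · ext1 w
    simp [wave_apply, mFourier_zero]

/-- An `L²` field orthogonal to all potential fields is a limit of solenoidal trigonometric
polynomials. -/
theorem mem_solenoidalL2 (hζ : ∀ k, ζ (-k) = -ζ k) {u : TorusL2 I d}
    (hu : ∀ v ∈ potentialL2 ζ, inner ℝ u v = 0) : u ∈ solenoidalL2 ζ := by
  have hd : u ∈ closure ((toTorusL2 I d) '' (potentialWaves ζ ⊔ solenoidalWaves ζ :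
      Submodule ℝ C(UnitAddTorus I, Space d))) := by
    have h1 : DenseRange (toTorusL2 I d) :=
      ContinuousMap.toLp_denseRange (Space d) (torusMeasure I) ℝ ENNReal.ofNat_ne_top
    have h2 : Dense ((potentialWaves ζ ⊔ solenoidalWaves ζ :
        Submodule ℝ C(UnitAddTorus I, Space d)) : Set C(UnitAddTorus I, Space d)) :=
      Submodule.dense_iff_topologicalClosure_eq_top.2 (dense_sup_waves ζ)
    exact h1.dense_image (toTorusL2 I d).continuous h2 u
  rw [Metric.mem_closure_iff] at hd
  refine Metric.mem_closure_iff.2 fun ε hε => ?_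
  obtain ⟨_, ⟨f, hf, rfl⟩, hfε⟩ := hd ε hε
  obtain ⟨p, hp, s, hs, rfl⟩ := Submodule.mem_sup.1 hf
  refine ⟨_, ⟨s, hs, rfl⟩, lt_of_le_of_lt ?_ hfε⟩
  rw [ContinuousLinearMap.coe_coe, dist_eq_norm, dist_eq_norm, map_add]
  set P := toTorusL2 I d p
  set S := toTorusL2 I d s
  have hPm : P ∈ potentialL2 ζ := Submodule.le_topologicalClosure _ ⟨p, hp, rfl⟩
  have horth : inner ℝ (u - S) P = 0 := by
    rw [inner_sub_left, hu P hPm, inner_potentialL2_solenoidal ζ hζ hPm hs, sub_zero]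
  refine le_of_sq_le_sq ?_ (norm_nonneg _)
  have : u - (P + S) = (u - S) - P := by abel
  rw [this, norm_sub_sq_real (u - S), horth]
  nlinarith [sq_nonneg ‖P‖]

end Torus

/-! ### Multiplication operators on `L²` -/

section Multiplication

variable {X : Type*} [MeasurableSpace X] {μ : Measure X} {d : ℕ}

/-- Multiplication by a bounded matrix field, as an operator on `L²`. -/
def mulOp (a : X → Space d →L[ℝ] Space d) (ha : MemLp a ∞ μ) :
    Lp (Space d) 2 μ →L[ℝ] Lp (Space d) 2 μ :=
  (ContinuousLinearMap.id ℝ (Space d →L[ℝ] Space d)).holderL μ ∞ 2 2 ha.toLp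

theorem coeFn_mulOp {a : X → Space d →L[ℝ] Space d} (ha : MemLp a ∞ μ) (g : Lp (Space d) 2 μ) :
    mulOp a ha g =ᵐ[μ] fun x => a x (g x) := by
  have h := (ContinuousLinearMap.id ℝ (Space d →L[ℝ] Space d)).coeFn_holder (r := 2) ha.toLp g
  filter_upwards [h, ha.coeFn_toLp] with x h1 h2
  have h3 : mulOp a ha g x = _ := h1
  rw [h3, h2]
  rfl

theorem inner_mulOp {a : X → Space d →L[ℝ] Space d} (ha : MemLp a ∞ μ) (g h : Lp (Space d) 2 μ) :
    inner ℝ (mulOp a ha g) h = ∫ x, inner ℝ (a x (g x)) (h x) ∂μ := by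
  rw [L2.inner_def]
  refine integral_congr_ae ?_
  filter_upwards [coeFn_mulOp ha g] with x hx
  rw [hx]

theorem norm_sq_eq_integral (g : Lp (Space d) 2 μ) : ‖g‖ ^ 2 = ∫ x, ‖g x‖ ^ 2 ∂μ := by
  rw [← real_inner_self_eq_norm_sq, L2.inner_def]
  simp_rw [real_inner_self_eq_norm_sq]

theorem integrable_norm_sq (g : Lp (Space d) 2 μ) : Integrable (fun x => ‖g x‖ ^ 2) μ := by
  simpa only [real_inner_self_eq_norm_sq] using L2.integrable_inner (𝕜 := ℝ) g g

theorem elliptic_mulOp {α β : ℝ} {a : X → Space d →L[ℝ] Space d} (ha : MemLp a ∞ μ)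
    (h : ∀ᵐ x ∂μ, Elliptic α β (a x)) : Elliptic α β (mulOp a ha) := by
  have hint : ∀ g : Lp (Space d) 2 μ, Integrable (fun x => inner ℝ (a x (g x)) (g x)) μ := by
    intro g
    refine (L2.integrable_inner (𝕜 := ℝ) (mulOp a ha g) g).congr ?_
    filter_upwards [coeFn_mulOp ha g] with x hx
    rw [hx]
  refine ⟨fun g => ?_, fun g => ?_⟩
  · rw [inner_mulOp, norm_sq_eq_integral, ← integral_const_mul]
    refine integral_mono_ae ((integrable_norm_sq g).const_mul α) (hint g) ?_
    filter_upwards [h] with x hx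
    exact hx.coercive _
  · rw [inner_mulOp, norm_sq_eq_integral, ← integral_const_mul]
    refine integral_mono_ae (integrable_norm_sq _) ((hint g).const_mul β) ?_
    filter_upwards [h, coeFn_mulOp ha g] with x hx h1
    simp only [h1]
    exact hx.sq_le _

theorem norm_mulOp_sub_le {a a' : X → Space d →L[ℝ] Space d} (ha : MemLp a ∞ μ)
    (ha' : MemLp a' ∞ μ) {C : ℝ} (hC : 0 ≤ C) (h : ∀ᵐ x ∂μ, ‖a x - a' x‖ ≤ C) :
    ‖mulOp a ha - mulOp a' ha'‖ ≤ C := by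
  refine ContinuousLinearMap.opNorm_le_bound _ hC fun g => ?_
  rw [sub_apply]
  refine Lp.norm_le_mul_norm_of_ae_le_mul ?_
  filter_upwards [h, coeFn_mulOp ha g, coeFn_mulOp ha' g,
    Lp.coeFn_sub (mulOp a ha g) (mulOp a' ha' g)] with x h0 h1 h2 h3
  rw [h3, Pi.sub_apply, h1, h2, ← sub_apply]
  exact ContinuousLinearMap.le_of_opNorm_le _ h0 _

end Multiplication

/-! ### The space `H¹₀` and the Dirichlet problem -/

section Sobolev

variable {d : ℕ} {Ω : Set (Space d)}

/-- `φ ∈ C_c^∞(Ω)`. -/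
structure IsTest (Ω : Set (Space d)) (φ : Space d → ℝ) : Prop where
  smooth : ContDiff ℝ ((⊤ : ℕ∞) : WithTop ℕ∞) φ
  compact : HasCompactSupport φ
  subset : tsupport φ ⊆ Ω

namespace IsTest

variable {φ ψ : Space d → ℝ}

theorem add (hφ : IsTest Ω φ) (hψ : IsTest Ω ψ) : IsTest Ω (φ + ψ) :=
  ⟨hφ.smooth.add hψ.smooth, hφ.compact.add hψ.compact,
    (tsupport_add φ ψ).trans (Set.union_subset hφ.subset hψ.subset)⟩

theorem mul_smooth (hφ : IsTest Ω φ) (hψ : ContDiff ℝ ((⊤ : ℕ∞) : WithTop ℕ∞) ψ) :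
    IsTest Ω (φ * ψ) :=
  ⟨hφ.smooth.mul hψ, hφ.compact.mul_right, (tsupport_mul_subset_left).trans hφ.subset⟩

theorem const_smul (hφ : IsTest Ω φ) (c : ℝ) : IsTest Ω (c • φ) := by
  have h := hφ.mul_smooth (ψ := fun _ => c) contDiff_const
  have : c • φ = φ * fun _ => c := by
    ext x; simp [mul_comm]
  rwa [this]

theorem zero : IsTest Ω (0 : Space d → ℝ) :=
  ⟨contDiff_const, HasCompactSupport.zero, by simp [tsupport]⟩

theorem differentiable (hφ : IsTest Ω φ) : Differentiable ℝ φ :=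
  hφ.smooth.differentiable (by simp)

theorem continuous (hφ : IsTest Ω φ) : Continuous φ := hφ.smooth.continuous

theorem continuous_fderiv (hφ : IsTest Ω φ) : Continuous (fderiv ℝ φ) :=
  hφ.smooth.continuous_fderiv (by simp)

theorem continuous_gradient (hφ : IsTest Ω φ) : Continuous (gradient φ) :=
  (InnerProductSpace.toDual ℝ (Space d)).symm.continuous.comp hφ.continuous_fderiv

theorem inner_gradient (φ : Space d → ℝ) (x v : Space d) :
    inner ℝ (gradient φ x) v = fderiv ℝ φ x v := by
  simp [gradient]

theorem hasCompactSupport_gradient (hφ : IsTest Ω φ) : HasCompactSupport (gradient φ) :=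
  (hφ.compact.fderiv ℝ).comp_left (map_zero _)

theorem memLp (hφ : IsTest Ω φ) : MemLp φ 2 (volume.restrict Ω) :=
  hφ.continuous.memLp_of_hasCompactSupport hφ.compact

theorem memLp_gradient (hφ : IsTest Ω φ) : MemLp (gradient φ) 2 (volume.restrict Ω) :=
  hφ.continuous_gradient.memLp_of_hasCompactSupport hφ.hasCompactSupport_gradient

theorem eq_zero_of_notMem (hφ : IsTest Ω φ) {x : Space d} (hx : x ∉ Ω) : φ x = 0 :=
  image_eq_zero_of_notMem_tsupport fun h => hx (hφ.subset h)

/-- A test function as an element of `H¹₀`. -/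
def toH10 (hφ : IsTest Ω φ) : H10 Ω :=
  ⟨WithLp.toLp 2 (hφ.memLp.toLp, hφ.memLp_gradient.toLp),
    Submodule.le_topologicalClosure _ (Submodule.subset_span
      ⟨φ, hφ.smooth, hφ.compact, hφ.subset, hφ.memLp.coeFn_toLp, hφ.memLp_gradient.coeFn_toLp⟩)⟩

theorem grad_toH10 (hφ : IsTest Ω φ) : grad hφ.toH10 = hφ.memLp_gradient.toLp := rfl

theorem fst_toH10 (hφ : IsTest Ω φ) : (hφ.toH10 : L2Pair Ω).fst = hφ.memLp.toLp := rfl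

end IsTest

/-- A closed property of elements of `H¹₀` can be checked on test functions. -/
theorem H10_induction {P : L2Pair Ω → Prop} (hP : IsClosed {u | P u})
    (h : ∀ φ (hφ : IsTest Ω φ), P hφ.toH10) (u : H10 Ω) : P u := by
  refine closure_minimal (fun p hp => ?_) hP u.2
  have key : ∃ φ, ∃ hφ : IsTest Ω φ, p = hφ.toH10 := by
    refine Submodule.span_induction ?_ ?_ ?_ ?_ hp
    · rintro p ⟨φ, h1, h2, h3, h4, h5⟩
      refine ⟨φ, ⟨h1, h2, h3⟩, ?_⟩
      have hφ : IsTest Ω φ := ⟨h1, h2, h3⟩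
      have e1 : p.fst = hφ.memLp.toLp := Lp.ext (h4.trans hφ.memLp.coeFn_toLp.symm)
      have e2 : p.snd = hφ.memLp_gradient.toLp := Lp.ext (h5.trans hφ.memLp_gradient.coeFn_toLp.symm)
      exact WithLp.ofLp_injective 2 (Prod.ext e1 e2)
    · refine ⟨0, IsTest.zero, ?_⟩
      have e1 : (IsTest.zero (Ω := Ω)).memLp.toLp = 0 := Lp.ext
        ((IsTest.zero (Ω := Ω)).memLp.coeFn_toLp.trans (Lp.coeFn_zero _ _ _).symm)
      have e2 : (IsTest.zero (Ω := Ω)).memLp_gradient.toLp = 0 := by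
        refine Lp.ext ((IsTest.zero (Ω := Ω)).memLp_gradient.coeFn_toLp.trans
          (EventuallyEq.trans (Eventually.of_forall fun x => ?_) (Lp.coeFn_zero _ _ _).symm))
        simp [gradient]
      exact WithLp.ofLp_injective 2 (Prod.ext e1.symm e2.symm)
    · rintro x y _ _ ⟨φ, hφ, rfl⟩ ⟨ψ, hψ, rfl⟩
      refine ⟨φ + ψ, hφ.add hψ, ?_⟩
      have e2 : hφ.memLp_gradient.toLp + hψ.memLp_gradient.toLp =
          (hφ.add hψ).memLp_gradient.toLp := by
        rw [← MemLp.toLp_add]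
        congr 1
        ext1 x
        simp [gradient, fderiv_add (hφ.differentiable x) (hψ.differentiable x)]
      exact WithLp.ofLp_injective 2 (Prod.ext rfl e2)
    · rintro c x _ ⟨φ, hφ, rfl⟩
      refine ⟨c • φ, hφ.const_smul c, ?_⟩
      have e2 : c • hφ.memLp_gradient.toLp = (hφ.const_smul c).memLp_gradient.toLp := by
        rw [← MemLp.toLp_const_smul]
        congr 1
        ext1 x
        simp [gradient, fderiv_const_smul (hφ.differentiable x) c]
      exact WithLp.ofLp_injective 2 (Prod.ext rfl e2)
  obtain ⟨φ, hφ, rfl⟩ := key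
  exact h φ hφ

/-- The weak gradient as a continuous linear map. -/
def gradL (Ω : Set (Space d)) : H10 Ω →L[ℝ] Lp (Space d) 2 (volume.restrict Ω) :=
  (WithLp.sndL 2 ℝ _ _).comp (H10 Ω).subtypeL

theorem norm_grad_le (u : H10 Ω) : ‖grad u‖ ≤ ‖u‖ := by
  refine le_of_sq_le_sq ?_ (norm_nonneg _)
  rw [Submodule.coe_norm, WithLp.prod_norm_sq_eq_of_L2]
  exact le_add_of_nonneg_left (sq_nonneg _)

theorem IsTest.integral_sq_eq {φ : Space d → ℝ} (hφ : IsTest Ω φ) (g : Space d →L[ℝ] ℝ)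
    (v : Space d) (hgv : g v = 1) :
    ∫ x, φ x ^ 2 = ∫ x, -(2 * φ x * fderiv ℝ φ x v * g x) := by
  have hder : ∀ x, fderiv ℝ (fun x => φ x ^ 2) x v = 2 * φ x * fderiv ℝ φ x v := by
    intro x
    rw [fderiv_fun_pow 2 (hφ.differentiable x)]
    simp
  have hc2 : HasCompactSupport (fun x => φ x ^ 2) :=
    hφ.compact.comp_left (g := fun t => t ^ 2) (by simp)
  have hcont : Continuous (fun x => fderiv ℝ φ x v) :=
    hφ.continuous_fderiv.clm_apply continuous_const
  have i1 : Integrable (fun x => φ x ^ 2) :=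
    (hφ.continuous.pow 2).integrable_of_hasCompactSupport hc2
  have i2 : Integrable (fun x => 2 * φ x * fderiv ℝ φ x v * g x) :=
    Continuous.integrable_of_hasCompactSupport
      (((continuous_const.mul hφ.continuous).mul hcont).mul g.continuous)
      ((hφ.compact.mul_left.mul_right).mul_right)
  have hg : ∀ x, fderiv ℝ g x v = 1 := fun x => by rw [g.fderiv, hgv]
  have hibp := integral_mul_fderiv_eq_neg_fderiv_mul_of_integrable
    (μ := (volume : Measure (Space d))) (f := fun x => φ x ^ 2) (g := g) (v := v)
    (by simpa only [hder] using i2) (by simpa only [hg, mul_one] using i1)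
    (((hφ.continuous.pow 2).mul g.continuous).integrable_of_hasCompactSupport hc2.mul_right)
    (fun x _ => (hφ.differentiable x).pow 2) (fun x _ => g.differentiableAt)
  simp only [hg, mul_one, hder] at hibp
  rw [hibp, integral_neg]

theorem IsTest.neg_mul_le {φ : Space d → ℝ} (hφ : IsTest Ω φ) {R : ℝ} (hR : ∀ x ∈ Ω, ‖x‖ ≤ R)
    (g : Space d →L[ℝ] ℝ) (hg : ∀ x, |g x| ≤ ‖x‖) {v : Space d} (hv : ‖v‖ = 1) (x : Space d) :
    -(2 * φ x * fderiv ℝ φ x v * g x) ≤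
      2⁻¹ * φ x ^ 2 + 2 * R ^ 2 * ‖gradient φ x‖ ^ 2 := by
  by_cases hx : x ∈ tsupport φ
  swap
  · rw [image_eq_zero_of_notMem_tsupport hx]
    have : 0 ≤ 2 * R ^ 2 * ‖gradient φ x‖ ^ 2 := by positivity
    simpa using this
  have h1 : |g x| ≤ R := (hg x).trans (hR x (hφ.subset hx))
  have h2 : |fderiv ℝ φ x v| ≤ ‖gradient φ x‖ := by
    rw [← IsTest.inner_gradient]
    refine (abs_real_inner_le_norm _ _).trans ?_
    rw [hv, mul_one]
  have h3 : |fderiv ℝ φ x v * g x| ≤ ‖gradient φ x‖ * R := by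
    rw [abs_mul]
    exact mul_le_mul h2 h1 (abs_nonneg _) (norm_nonneg _)
  have h4 : (fderiv ℝ φ x v * g x) ^ 2 ≤ (‖gradient φ x‖ * R) ^ 2 := sq_le_sq' (by
    linarith [neg_abs_le (fderiv ℝ φ x v * g x)]) ((le_abs_self _).trans h3)
  nlinarith [sq_nonneg (φ x + 2 * (fderiv ℝ φ x v * g x))]

theorem IsTest.integrable_sq {φ : Space d → ℝ} (hφ : IsTest Ω φ) :
    Integrable (fun x => φ x ^ 2) := by
  have hc : HasCompactSupport (fun x => φ x ^ 2) :=
    hφ.compact.comp_left (g := fun t => t ^ 2) (by simp)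
  exact (hφ.continuous.pow 2).integrable_of_hasCompactSupport hc

theorem IsTest.integrable_gradient_sq {φ : Space d → ℝ} (hφ : IsTest Ω φ) :
    Integrable (fun x => ‖gradient φ x‖ ^ 2) := by
  have hc : HasCompactSupport (fun x => ‖gradient φ x‖ ^ 2) :=
    hφ.hasCompactSupport_gradient.comp_left (g := fun t : Space d => ‖t‖ ^ 2) (by simp)
  exact (hφ.continuous_gradient.norm.pow 2).integrable_of_hasCompactSupport hc

theorem exists_unit_functional (hd : 0 < d) : ∃ (g : Space d →L[ℝ] ℝ) (v : Space d), g v = 1 ∧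
    (∀ x, |g x| ≤ ‖x‖) ∧ ‖v‖ = 1 := by
  obtain ⟨i⟩ : Nonempty (Fin d) := ⟨⟨0, hd⟩⟩
  refine ⟨EuclideanSpace.proj i, EuclideanSpace.single i 1, by simp, fun x => ?_, by simp⟩
  simpa using PiLp.norm_apply_le x i

theorem IsTest.integral_sq_le {φ : Space d → ℝ} (hφ : IsTest Ω φ) (hd : 0 < d) {R : ℝ}
    (hR : ∀ x ∈ Ω, ‖x‖ ≤ R) :
    ∫ x in Ω, ‖φ x‖ ^ 2 ≤ 4 * R ^ 2 * ∫ x in Ω, ‖gradient φ x‖ ^ 2 := by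
  obtain ⟨g, v, hgv, hg, hv⟩ := exists_unit_functional hd
  have i1 : Integrable (fun x => φ x ^ 2) :=
    hφ.integrable_sq
  have i2 : Integrable (fun x => ‖gradient φ x‖ ^ 2) :=
    hφ.integrable_gradient_sq
  have e1 : ∫ x in Ω, ‖φ x‖ ^ 2 = ∫ x, φ x ^ 2 := by
    have h0 : ∀ x, x ∉ Ω → φ x ^ 2 = 0 := fun x hx => by simp [hφ.eq_zero_of_notMem hx]
    simp only [Real.norm_eq_abs, sq_abs]
    exact setIntegral_eq_integral_of_forall_compl_eq_zero h0
  have e2 : ∫ x in Ω, ‖gradient φ x‖ ^ 2 = ∫ x, ‖gradient φ x‖ ^ 2 := by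
    refine setIntegral_eq_integral_of_forall_compl_eq_zero fun x hx => ?_
    have : fderiv ℝ φ x = 0 := image_eq_zero_of_notMem_tsupport fun h =>
      hx (hφ.subset (tsupport_fderiv_subset ℝ h))
    simp [gradient, this]
  have hle : ∫ x, -(2 * φ x * fderiv ℝ φ x v * g x) ≤
      ∫ x, (2⁻¹ * φ x ^ 2 + 2 * R ^ 2 * ‖gradient φ x‖ ^ 2) := by
    refine integral_mono ?_ ((i1.const_mul _).add (i2.const_mul _))
      (hφ.neg_mul_le hR g hg hv)
    exact (Continuous.integrable_of_hasCompactSupport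
      (((continuous_const.mul hφ.continuous).mul
        (hφ.continuous_fderiv.clm_apply continuous_const)).mul g.continuous)
      ((hφ.compact.mul_left.mul_right).mul_right)).neg
  rw [integral_add (i1.const_mul _) (i2.const_mul _), integral_const_mul, integral_const_mul,
    ← hφ.integral_sq_eq g v hgv] at hle
  rw [e1, e2]
  generalize ∫ x, φ x ^ 2 = a at hle ⊢
  generalize ∫ x, ‖gradient φ x‖ ^ 2 = b at hle ⊢
  linarith

/-- The Poincaré inequality. -/
theorem exists_norm_le_grad (hd : 0 < d) (hΩ : Bornology.IsBounded Ω) :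
    ∃ C : ℝ, 0 < C ∧ ∀ u : H10 Ω, ‖u‖ ^ 2 ≤ C * ‖grad u‖ ^ 2 := by
  obtain ⟨R, hR⟩ := hΩ.exists_norm_le
  refine ⟨4 * R ^ 2 + 1, by positivity, fun u => ?_⟩
  refine H10_induction (P := fun u : L2Pair Ω => ‖u‖ ^ 2 ≤ (4 * R ^ 2 + 1) * ‖u.snd‖ ^ 2)
    (isClosed_le (by fun_prop) (continuous_const.mul (((WithLp.sndL 2 ℝ _ _).continuous).norm.pow 2)))
    (fun φ hφ => ?_) u
  rw [WithLp.prod_norm_sq_eq_of_L2, add_mul, one_mul]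
  refine add_le_add ?_ le_rfl
  have e1 : ‖(hφ.toH10 : L2Pair Ω).fst‖ ^ 2 = ∫ x in Ω, ‖φ x‖ ^ 2 := by
    rw [hφ.fst_toH10, ← real_inner_self_eq_norm_sq, L2.inner_def]
    refine integral_congr_ae ?_
    filter_upwards [hφ.memLp.coeFn_toLp] with x hx
    rw [hx, real_inner_self_eq_norm_sq]
  have e2 : ‖(hφ.toH10 : L2Pair Ω).snd‖ ^ 2 = ∫ x in Ω, ‖gradient φ x‖ ^ 2 := by
    change ‖hφ.memLp_gradient.toLp‖ ^ 2 = _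
    rw [norm_sq_eq_integral]
    refine integral_congr_ae ?_
    filter_upwards [hφ.memLp_gradient.coeFn_toLp] with x hx
    rw [hx]
  rw [e1, e2]
  exact hφ.integral_sq_le hd hR

/-- The Dirichlet form of an operator on `L²(Ω; ℝ^d)`. -/
def dirichletForm (Ω : Set (Space d))
    (T : Lp (Space d) 2 (volume.restrict Ω) →L[ℝ] Lp (Space d) 2 (volume.restrict Ω)) :
    H10 Ω →L[ℝ] H10 Ω →L[ℝ] ℝ :=
  (((innerSL ℝ).comp (T.comp (gradL Ω))).flip.comp (gradL Ω)).flip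

theorem dirichletForm_apply
    (T : Lp (Space d) 2 (volume.restrict Ω) →L[ℝ] Lp (Space d) 2 (volume.restrict Ω))
    (u v : H10 Ω) : dirichletForm Ω T u v = inner ℝ (T (grad u)) (grad v) := rfl

instance : CompleteSpace (H10 Ω) := (Submodule.isClosed_topologicalClosure _).completeSpace_coe

/-- Well-posedness of the Dirichlet problem, with an a priori bound. -/
theorem exists_solution {α β C : ℝ} (hα : 0 < α) (hC : 0 < C)
    (hP : ∀ u : H10 Ω, ‖u‖ ^ 2 ≤ C * ‖grad u‖ ^ 2)
    {T : Lp (Space d) 2 (volume.restrict Ω) →L[ℝ] Lp (Space d) 2 (volume.restrict Ω)}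
    (hT : Elliptic α β T) (f : HNegOne Ω) :
    ∃ u : H10 Ω, (∀ w : H10 Ω, (∀ v, inner ℝ (T (grad w)) (grad v) = f v) ↔ w = u) ∧
      ‖u‖ ≤ C / α * ‖f‖ := by
  have hco : ∀ u : H10 Ω, α / C * ‖u‖ * ‖u‖ ≤ dirichletForm Ω T u u := by
    intro u
    rw [dirichletForm_apply]
    refine le_trans ?_ (hT.coercive _)
    have := mul_le_mul_of_nonneg_left (hP u) (div_pos hα hC).le
    rw [mul_assoc, ← sq]
    refine this.trans (le_of_eq ?_)
    field_simp
  have hcoer : IsCoercive (dirichletForm Ω T) := ⟨α / C, div_pos hα hC, hco⟩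
  obtain ⟨p, hpf⟩ : ∃ p : H10 Ω, ∀ v, inner ℝ p v = f v :=
    ⟨(InnerProductSpace.toDual ℝ (H10 Ω)).symm f,
      fun v => InnerProductSpace.toDual_symm_apply⟩
  obtain ⟨u, hu⟩ := hcoer.continuousLinearEquivOfBilin.surjective p
  have hiff : ∀ w : H10 Ω, (∀ v, inner ℝ (T (grad w)) (grad v) = f v) ↔
      hcoer.continuousLinearEquivOfBilin w = p := by
    intro w
    constructor
    · intro hw
      refine ext_inner_right ℝ fun v => ?_
      rw [hcoer.continuousLinearEquivOfBilin_apply, dirichletForm_apply, hw, hpf]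
    · intro hw v
      rw [← dirichletForm_apply, ← hcoer.continuousLinearEquivOfBilin_apply, hw, hpf]
  refine ⟨u, fun w => (hiff w).trans ⟨fun hw => ?_, fun hw => ?_⟩, ?_⟩
  · exact hcoer.continuousLinearEquivOfBilin.injective (hw.trans hu.symm)
  · rw [hw, hu]
  · have h1 := hco u
    rw [dirichletForm_apply, (hiff u).2 hu] at h1
    have h2 := (le_abs_self _).trans (f.le_opNorm u)
    by_cases hz : ‖u‖ = 0
    · rw [hz]; positivity
    have hpos : 0 < ‖u‖ := lt_of_le_of_ne (norm_nonneg _) (Ne.symm hz)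
    have h3 : α / C * ‖u‖ ≤ ‖f‖ := le_of_mul_le_mul_right (h1.trans h2) hpos
    calc ‖u‖ = C / α * (α / C * ‖u‖) := by field_simp
      _ ≤ C / α * ‖f‖ := mul_le_mul_of_nonneg_left h3 (by positivity)

end Sobolev

/-! ### Oscillating evaluation on the torus -/

section Oscillation

open UnitAddTorus

/-- A family of windings `x ↦ point e x` of `ℝ^d` in the torus whose frequencies tend to infinity:
`freq e k` is the frequency of the `k`-th character along the winding, and `dir k` its limiting
direction, after rescaling by `scale e k → 0`. -/
structure Oscillation (I : Type*) [Fintype I] (d : ℕ) {ι : Type*} (l : Filter ι) where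
  point : ι → Space d → UnitAddTorus I
  continuous_point : ∀ e, Continuous (point e)
  freq : ι → (I → ℤ) → Space d
  mFourier_point : ∀ e k x, mFourier k (point e x) =
    Complex.exp (((2 * Real.pi * inner ℝ (freq e k) x : ℝ) : ℂ) * Complex.I)
  dir : (I → ℤ) → Space d
  dir_neg : ∀ k, dir (-k) = -dir k
  dir_ne_zero : ∀ k, k ≠ 0 → dir k ≠ 0
  scale : ι → (I → ℤ) → ℝ
  scale_tendsto : ∀ k, k ≠ 0 → Tendsto (fun e => scale e k) l (𝓝 0)
  scale_smul_freq : ∀ k, k ≠ 0 → Tendsto (fun e => scale e k • freq e k) l (𝓝 (dir k))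

/-- Pointwise limits of uniformly Lipschitz functions hold on a closed set. -/
theorem isClosed_setOf_tendsto {ι E G : Type*} [SeminormedAddCommGroup E] [SeminormedAddCommGroup G]
    {l : Filter ι} (Λ : ι → E → G) (Λ₀ : E → G) {C : ℝ} (hC : 0 ≤ C)
    (h : ∀ e f g, ‖Λ e f - Λ e g‖ ≤ C * ‖f - g‖) (h₀ : ∀ f g, ‖Λ₀ f - Λ₀ g‖ ≤ C * ‖f - g‖) :
    IsClosed {f | Tendsto (fun e => Λ e f) l (𝓝 (Λ₀ f))} := by
  refine isClosed_of_closure_subset fun f hf => ?_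
  rw [Set.mem_ofPred_eq, Metric.tendsto_nhds]
  intro ε hε
  rw [Metric.mem_closure_iff] at hf
  obtain ⟨g, hg, hfg⟩ := hf (ε / (3 * (C + 1))) (by positivity)
  have hg' := Metric.tendsto_nhds.1 hg (ε / 3) (by positivity)
  filter_upwards [hg'] with e he
  rw [dist_eq_norm] at he hfg ⊢
  have hb : C * ‖f - g‖ ≤ ε / 3 := by
    calc C * ‖f - g‖ ≤ (C + 1) * (ε / (3 * (C + 1))) := by gcongr; linarith
      _ = ε / 3 := by field_simp
  have e1 : Λ e f - Λ₀ f = (Λ e f - Λ e g) + (Λ e g - Λ₀ g) - (Λ₀ f - Λ₀ g) := by abel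
  rw [e1]
  have h1 := norm_sub_le ((Λ e f - Λ e g) + (Λ e g - Λ₀ g)) (Λ₀ f - Λ₀ g)
  have h2 := norm_add_le (Λ e f - Λ e g) (Λ e g - Λ₀ g)
  have h3 := h e f g
  have h4 := h₀ f g
  linarith

namespace Oscillation

variable {I : Type*} [Fintype I] {d : ℕ} {ι : Type*} {l : Filter ι} (o : Oscillation I d l)

theorem tendsto_norm_freq {k : I → ℤ} (hk : k ≠ 0) :
    Tendsto (fun e => ‖o.freq e k‖) l atTop := by
  have h1 : Tendsto (fun e => ‖o.scale e k • o.freq e k‖) l (𝓝 ‖o.dir k‖) :=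
    (o.scale_smul_freq k hk).norm
  have hpos : 0 < ‖o.dir k‖ := norm_pos_iff.2 (o.dir_ne_zero k hk)
  have hne : ∀ᶠ e in l, 0 < |o.scale e k| := by
    filter_upwards [h1.eventually (lt_mem_nhds hpos)] with e he
    rw [abs_pos]
    rintro h
    simp [h] at he
  have h2 : Tendsto (fun e => |o.scale e k|⁻¹) l atTop := by
    refine tendsto_inv_nhdsGT_zero.comp (tendsto_nhdsWithin_iff.2 ⟨?_, hne⟩)
    simpa using (o.scale_tendsto k hk).abs
  refine (h2.atTop_mul_pos hpos h1).congr' ?_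
  filter_upwards [hne] with e he
  rw [norm_smul, Real.norm_eq_abs, inv_mul_cancel_left₀ he.ne']

/-- The Riemann–Lebesgue lemma along an oscillation. -/
theorem tendsto_integral_mFourier {k : I → ℤ} (hk : k ≠ 0) (f : Space d → ℂ) :
    Tendsto (fun e => ∫ x, mFourier k (o.point e x) * f x) l (𝓝 0) := by
  have h1 : Tendsto (fun e => -o.freq e k) l (cocompact (Space d)) := by
    rw [← Metric.cobounded_eq_cocompact, ← tendsto_norm_atTop_iff_cobounded]
    simpa using o.tendsto_norm_freq hk
  refine ((tendsto_integral_exp_inner_smul_cocompact f).comp h1).congr fun e => ?_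
  refine integral_congr_ae (Eventually.of_forall fun x => ?_)
  simp only [Circle.smul_def, Real.fourierChar_apply, smul_eq_mul, o.mFourier_point]
  rw [inner_neg_right, neg_neg, real_inner_comm]

theorem aestronglyMeasurable_eval {F : Type*} [NormedAddCommGroup F] {μ : Measure (Space d)}
    {f : Space d → C(UnitAddTorus I, F)} (hf : AEStronglyMeasurable f μ) (e : ι) :
    AEStronglyMeasurable (fun x => f x (o.point e x)) μ :=
  (ContinuousEval.continuous_eval (F := C(UnitAddTorus I, F))).comp_aestronglyMeasurable
    (hf.prodMk (o.continuous_point e).aestronglyMeasurable)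

theorem integrable_eval {F : Type*} [NormedAddCommGroup F] {μ : Measure (Space d)}
    {f : Space d → C(UnitAddTorus I, F)} (hf : Integrable f μ) (e : ι) :
    Integrable (fun x => f x (o.point e x)) μ :=
  hf.norm.mono' (o.aestronglyMeasurable_eval hf.1 e)
    (Eventually.of_forall fun x => (f x).norm_coe_le_norm _)

/-- The mean of a continuous function on the torus. -/
def mean (I : Type*) [Fintype I] : C(UnitAddTorus I, ℂ) →L[ℂ] ℂ :=
  LinearMap.mkContinuous
    { toFun := fun f => ∫ t, f t ∂torusMeasure I
      map_add' := fun f g => integral_add (integrable_continuousMap f) (integrable_continuousMap g)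
      map_smul' := fun c f => integral_const_mul c f } 1 fun f => by
    rw [one_mul]
    refine (norm_integral_le_of_norm_le_const
      (Eventually.of_forall fun t => f.norm_coe_le_norm t)).trans ?_
    simp

theorem mean_apply (f : C(UnitAddTorus I, ℂ)) : mean I f = ∫ t, f t ∂torusMeasure I := rfl

theorem norm_mean_le (f : C(UnitAddTorus I, ℂ)) : ‖mean I f‖ ≤ ‖f‖ := by
  simpa using (mean I).le_of_opNorm_le (LinearMap.mkContinuous_norm_le _ zero_le_one _) f

theorem tendsto_setIntegral_eval_const {s : Set (Space d)} (hs : MeasurableSet s)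
    (hfin : volume s < ∞) (f : C(UnitAddTorus I, ℂ)) :
    Tendsto (fun e => ∫ x in s, f (o.point e x)) l (𝓝 (∫ _ in s, mean I f)) := by
  have hfm : IsFiniteMeasure (volume.restrict s) := ⟨by simpa using hfin⟩
  have hint : ∀ (g : C(UnitAddTorus I, ℂ)) e, IntegrableOn (fun x => g (o.point e x)) s :=
    fun g e => o.integrable_eval (integrable_const g) e
  have hcl := isClosed_setOf_tendsto (l := l)
    (fun e (f : C(UnitAddTorus I, ℂ)) => ∫ x in s, f (o.point e x))
    (fun f => ∫ _ in s, mean I f) (C := volume.real s) measureReal_nonneg ?_ ?_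
  · have hf : f ∈ (Submodule.span ℂ (Set.range (mFourier (d := I)))).topologicalClosure := by
      rw [span_mFourier_closure_eq_top]; trivial
    refine closure_minimal (fun g hg => ?_) hcl hf
    refine Submodule.span_induction ?_ ?_ ?_ ?_ hg
    · rintro _ ⟨k, rfl⟩
      by_cases hk : k = 0
      · subst hk
        simpa [mFourier_zero, mean_apply] using tendsto_const_nhds
      · rw [Set.mem_ofPred_eq, mean_apply, integral_mFourier hk, integral_zero]
        refine (o.tendsto_integral_mFourier hk (s.indicator 1)).congr fun e => ?_
        rw [← integral_indicator hs]
        refine integral_congr_ae (Eventually.of_forall fun x => ?_)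
        by_cases hx : x ∈ s <;> simp [hx]
    · simpa using tendsto_const_nhds
    · intro g h _ _ hg hh
      have : ∀ e, ∫ x in s, (g + h) (o.point e x) =
          (∫ x in s, g (o.point e x)) + ∫ x in s, h (o.point e x) :=
        fun e => integral_add (hint g e) (hint h e)
      simp only [Set.mem_ofPred_eq, this, map_add]
      rw [integral_add (integrable_const _) (integrable_const _)]
      exact Tendsto.add hg hh
    · intro c g _ hg
      have : ∀ e, ∫ x in s, (c • g) (o.point e x) = c * ∫ x in s, g (o.point e x) :=
        fun e => integral_const_mul c _
      simp only [Set.mem_ofPred_eq, this, map_smul, smul_eq_mul]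
      rw [integral_const_mul]
      exact Tendsto.const_mul c hg
  · intro e f g
    rw [← integral_sub (hint f e) (hint g e), mul_comm]
    refine norm_setIntegral_le_of_norm_le_const hfin fun x _ => ?_
    exact (f - g).norm_coe_le_norm _
  · intro f g
    rw [← integral_sub (integrable_const _) (integrable_const _), mul_comm]
    refine norm_setIntegral_le_of_norm_le_const hfin fun x _ => ?_
    rw [← map_sub]
    exact norm_mean_le _

/-- Oscillating integrals of functions in `L¹(μ; C(𝕋))` tend to the integral of the mean. -/
theorem tendsto_integral_eval {Ω : Set (Space d)} (hΩ : MeasurableSet Ω)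
    {f : Space d → C(UnitAddTorus I, ℂ)} (hf : IntegrableOn f Ω) :
    Tendsto (fun e => ∫ x in Ω, f x (o.point e x)) l (𝓝 (∫ x in Ω, mean I (f x))) := by
  refine Integrable.induction (μ := volume.restrict Ω)
    (fun f : Space d → C(UnitAddTorus I, ℂ) => Tendsto (fun e => ∫ x in Ω, f x (o.point e x)) l
      (𝓝 (∫ x in Ω, mean I (f x))))
    ?_ ?_ ?_ ?_ hf
  · intro c s hs hfin
    have e1 : ∀ e, ∫ x in Ω, (s.indicator (fun _ => c) x) (o.point e x) =
        ∫ x in s ∩ Ω, c (o.point e x) := by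
      intro e
      rw [← Measure.restrict_restrict hs, ← integral_indicator hs]
      refine integral_congr_ae (Eventually.of_forall fun x => ?_)
      by_cases hx : x ∈ s <;> simp [hx]
    have e2 : ∫ x in Ω, mean I (s.indicator (fun _ => c) x) = ∫ x in s ∩ Ω, mean I c := by
      rw [← Measure.restrict_restrict hs, ← integral_indicator hs]
      refine integral_congr_ae (Eventually.of_forall fun x => ?_)
      by_cases hx : x ∈ s <;> simp [hx]
    simp_rw [e1, e2]
    rw [Measure.restrict_apply hs] at hfin
    exact o.tendsto_setIntegral_eval_const (hs.inter hΩ) hfin c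
  · intro f g _ hf hg hf' hg'
    have e1 : ∀ e, ∫ x in Ω, (f + g) x (o.point e x) =
        (∫ x in Ω, f x (o.point e x)) + ∫ x in Ω, g x (o.point e x) :=
      fun e => integral_add (o.integrable_eval hf e) (o.integrable_eval hg e)
    have e2 : ∫ x in Ω, mean I ((f + g) x) = (∫ x in Ω, mean I (f x)) + ∫ x in Ω, mean I (g x) := by
      rw [← integral_add ((mean I).integrable_comp hf) ((mean I).integrable_comp hg)]
      simp
    simp_rw [e1, e2]
    exact hf'.add hg'
  · refine isClosed_setOf_tendsto (C := 1)
      (fun e (f : Space d →₁[volume.restrict Ω] C(UnitAddTorus I, ℂ)) =>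
        ∫ x in Ω, f x (o.point e x)) (fun f => ∫ x in Ω, mean I (f x)) zero_le_one ?_ ?_
    · intro e f g
      rw [← integral_sub (o.integrable_eval (L1.integrable_coeFn f) e)
        (o.integrable_eval (L1.integrable_coeFn g) e), one_mul, L1.norm_eq_integral_norm]
      refine norm_integral_le_of_norm_le (L1.integrable_coeFn (f - g)).norm ?_
      filter_upwards [Lp.coeFn_sub f g] with x hx
      rw [hx]
      exact (f x - g x).norm_coe_le_norm _
    · intro f g
      rw [← integral_sub ((mean I).integrable_comp (L1.integrable_coeFn f))
        ((mean I).integrable_comp (L1.integrable_coeFn g)), one_mul, L1.norm_eq_integral_norm]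
      refine norm_integral_le_of_norm_le (L1.integrable_coeFn (f - g)).norm ?_
      filter_upwards [Lp.coeFn_sub f g] with x hx
      rw [hx, ← map_sub]
      exact norm_mean_le _
  · intro f g hfg _ hf'
    have e1 : ∀ e, ∫ x in Ω, f x (o.point e x) = ∫ x in Ω, g x (o.point e x) := fun e =>
      integral_congr_ae (hfg.mono fun x hx => by simp only [hx])
    have e2 : ∫ x in Ω, mean I (f x) = ∫ x in Ω, mean I (g x) :=
      integral_congr_ae (hfg.mono fun x hx => by simp only [hx])
    simpa only [e1, e2] using hf'

/-- The complex-valued squared norm of a vector field on the torus. -/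
def normSqC {I : Type*} (f : C(UnitAddTorus I, Space d)) : C(UnitAddTorus I, ℂ) :=
  ⟨fun t => ((‖f t‖ ^ 2 : ℝ) : ℂ), by fun_prop⟩

theorem continuous_normSqC {I : Type*} : Continuous (normSqC : C(UnitAddTorus I, Space d) → _) :=
  ContinuousMap.continuous_postcomp
    (⟨fun v : Space d => ((‖v‖ ^ 2 : ℝ) : ℂ), by fun_prop⟩ : C(Space d, ℂ))

theorem norm_normSqC_le {I : Type*} (f : C(UnitAddTorus I, Space d)) : ‖normSqC f‖ ≤ ‖f‖ ^ 2 := by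
  rw [ContinuousMap.norm_le _ (by positivity)]
  intro t
  have : normSqC f t = ((‖f t‖ ^ 2 : ℝ) : ℂ) := rfl
  rw [this, Complex.norm_real, Real.norm_of_nonneg (by positivity)]
  exact pow_le_pow_left₀ (norm_nonneg _) (f.norm_coe_le_norm t) 2

/-- The `L²` norm of an oscillating vector field tends to its two-scale `L²` norm. -/
theorem tendsto_integral_norm_sq {Ω : Set (Space d)} (hΩ : MeasurableSet Ω)
    {f : Space d → C(UnitAddTorus I, Space d)} (hf : MemLp f 2 (volume.restrict Ω)) :
    Tendsto (fun e => ∫ x in Ω, ‖f x (o.point e x)‖ ^ 2) l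
      (𝓝 (∫ x in Ω, ‖toTorusL2 I d (f x)‖ ^ 2)) := by
  have hint : IntegrableOn (fun x => normSqC (f x)) Ω :=
    (hf.integrable_norm_pow two_ne_zero).mono' (continuous_normSqC.comp_aestronglyMeasurable hf.1)
      (Eventually.of_forall fun x => by simpa using norm_normSqC_le (f x))
  have h := o.tendsto_integral_eval hΩ hint
  have e1 : ∀ e, ∫ x in Ω, normSqC (f x) (o.point e x) =
      ((∫ x in Ω, ‖f x (o.point e x)‖ ^ 2 : ℝ) : ℂ) := fun e => integral_ofReal
  have e2 : ∀ x, mean I (normSqC (f x)) = ((‖toTorusL2 I d (f x)‖ ^ 2 : ℝ) : ℂ) := by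
    intro x
    rw [norm_toTorusL2_sq, mean_apply]
    exact integral_ofReal
  simp_rw [e1, e2] at h
  have e3 : ∫ x in Ω, ((‖toTorusL2 I d (f x)‖ ^ 2 : ℝ) : ℂ) =
      ((∫ x in Ω, ‖toTorusL2 I d (f x)‖ ^ 2 : ℝ) : ℂ) := integral_ofReal
  rw [e3] at h
  simpa [Function.comp_def] using (Complex.continuous_re.tendsto _).comp h

/-- A continuous function which is nonnegative along the windings is nonnegative. -/
theorem nonneg_of_forall_point [l.NeBot] {f : C(UnitAddTorus I, ℝ)}
    (hf : ∀ e x, 0 ≤ f (o.point e x)) (t : UnitAddTorus I) : 0 ≤ f t := by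
  set g : C(UnitAddTorus I, ℂ) := ⟨fun t => ((max (-f t) 0 : ℝ) : ℂ), by fun_prop⟩ with hg
  have hg0 : ∀ e x, g (o.point e x) = 0 := fun e x => by
    simp [hg, hf e x]
  have h1 := o.tendsto_setIntegral_eval_const (s := Metric.ball 0 1) measurableSet_ball
    measure_ball_lt_top g
  simp_rw [hg0, integral_zero] at h1
  have h2 := tendsto_nhds_unique h1 tendsto_const_nhds
  have hvol : (volume (Metric.ball (0 : Space d) 1)).toReal ≠ 0 :=
    (ENNReal.toReal_pos (Metric.measure_ball_pos _ _ one_pos).ne' measure_ball_lt_top.ne).ne'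
  have h3 : mean I g = 0 := by
    have h4 : ∫ _ in Metric.ball (0 : Space d) 1, mean I g = 0 := h2
    rw [setIntegral_const, smul_eq_zero] at h4
    exact h4.resolve_left hvol
  have h5 : ∫ t, max (-f t) 0 ∂torusMeasure I = 0 := by
    have : mean I g = ((∫ t, max (-f t) 0 ∂torusMeasure I : ℝ) : ℂ) := integral_ofReal
    rw [this] at h3
    exact_mod_cast h3
  have hc : Continuous fun t => max (-f t) 0 := by fun_prop
  have h6 := (Continuous.integral_pos_of_hasCompactSupport_nonneg_nonzero
    (μ := torusMeasure I) hc (HasCompactSupport.of_compactSpace _) (fun t => le_max_right _ _)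
    (x := t)).mt (by rw [h5]; exact lt_irrefl 0)
  rw [not_not] at h6
  have := le_max_left (-f t) 0
  rw [h6] at this
  linarith

end Oscillation

end Oscillation

/-! ### Approximation by sums of products -/

section Approximation

variable {d : ℕ}

open scoped Manifold ContDiff in
/-- A compactly supported continuous map with values in the closure of a subspace is uniformly
close to a finite sum of products of test functions with elements of the subspace. -/
theorem exists_smooth_approx {H : Type*} [NormedAddCommGroup H] [NormedSpace ℝ H]
    {Ω : Set (Space d)} (hΩ : IsOpen Ω) (S : Submodule ℝ H) {Ψ : Space d → H}
    (hc : Continuous Ψ) (hs : HasCompactSupport Ψ) (hsub : tsupport Ψ ⊆ Ω)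
    (hmem : ∀ x, Ψ x ∈ S.topologicalClosure) {η : ℝ} (hη : 0 < η) :
    ∃ (J : Finset (Space d)) (φ : J → Space d → ℝ) (D : J → H),
      (∀ i, IsTest Ω (φ i)) ∧ (∀ i, D i ∈ S) ∧ ∀ x, ‖Ψ x - ∑ i, φ i x • D i‖ ≤ η := by
  obtain ⟨R, hR⟩ := hs.isCompact.isBounded.subset_ball (0 : Space d)
  have h1 : ∀ x, ∃ D ∈ S, ‖Ψ x - D‖ < η := by
    intro x
    obtain ⟨D, hD, hlt⟩ := Metric.mem_closure_iff.1 (hmem x) η hη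
    exact ⟨D, hD, by rwa [← dist_eq_norm]⟩
  choose D hDS hD using h1
  let U : Space d → Set (Space d) := fun x =>
    {y | ‖Ψ y - D x‖ < η} ∩ (Ω ∩ Metric.ball 0 R)
  have hU : ∀ x, IsOpen (U x) := fun x =>
    (isOpen_lt (by fun_prop) continuous_const).inter (hΩ.inter Metric.isOpen_ball)
  obtain ⟨J, hJ⟩ := hs.isCompact.elim_finite_subcover U hU fun x hx =>
    Set.mem_iUnion.2 ⟨x, hD x, hsub hx, hR hx⟩
  obtain ⟨ρ, hρ⟩ := SmoothPartitionOfUnity.exists_isSubordinate 𝓘(ℝ, Space d)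
    (isClosed_tsupport Ψ) (fun i : J => U i) (fun i => hU i) (by
      intro x hx
      obtain ⟨i, hi, hxi⟩ := Set.mem_iUnion₂.1 (hJ hx)
      exact Set.mem_iUnion.2 ⟨⟨i, hi⟩, hxi⟩)
  refine ⟨J, fun i => ρ i, fun i => D i, fun i => ⟨(ρ i).contMDiff.contDiff, ?_, ?_⟩,
    fun i => hDS i, fun x => ?_⟩
  · exact (isCompact_closedBall (0 : Space d) R).of_isClosed_subset (isClosed_tsupport _)
      (fun x hx => Metric.ball_subset_closedBall (hρ i hx).2.2)
  · exact fun x hx => (hρ i hx).2.1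
  · have hle : ∑ i, ρ i x ≤ 1 := by
      have := ρ.sum_le_one x
      rwa [finsum_eq_sum_of_fintype] at this
    have hsum : Ψ x = ∑ i, ρ i x • Ψ x := by
      by_cases hx : x ∈ tsupport Ψ
      · have := ρ.sum_eq_one hx
        rw [finsum_eq_sum_of_fintype] at this
        rw [← Finset.sum_smul, this, one_smul]
      · simp [image_eq_zero_of_notMem_tsupport hx]
    have e1 : Ψ x - ∑ i, ρ i x • D i = ∑ i, ρ i x • (Ψ x - D i) := by
      simp_rw [smul_sub]
      rw [Finset.sum_sub_distrib, ← hsum]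
    rw [e1]
    calc ‖∑ i, ρ i x • (Ψ x - D i)‖ ≤ ∑ i, ρ i x * η := by
          refine norm_sum_le_of_le _ fun i _ => ?_
          rw [norm_smul, Real.norm_of_nonneg (ρ.nonneg i x)]
          by_cases hz : ρ i x = 0
          · simp [hz]
          · exact mul_le_mul_of_nonneg_left (hρ i (subset_tsupport _ hz)).1.le (ρ.nonneg i x)
      _ ≤ η := by
          rw [← Finset.sum_mul]
          nlinarith

theorem exists_integral_norm_le {X F : Type*} [MeasurableSpace X] [NormedAddCommGroup F]
    (μ : Measure X) [IsFiniteMeasure μ] :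
    ∃ C : ℝ, 0 ≤ C ∧ ∀ g : Lp F 2 μ, ∫ x, ‖g x‖ ∂μ ≤ C * ‖g‖ := by
  refine ⟨(μ Set.univ ^ (1 / (1 : ℝ≥0∞).toReal - 1 / (2 : ℝ≥0∞).toReal)).toReal,
    ENNReal.toReal_nonneg, fun g => ?_⟩
  have h := eLpNorm_le_eLpNorm_mul_rpow_measure_univ (μ := μ) (p := 1) (q := 2)
    (by norm_num) (Lp.aestronglyMeasurable g)
  rw [integral_norm_eq_lintegral_enorm (Lp.aestronglyMeasurable g), ← eLpNorm_one_eq_lintegral_enorm,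
    Lp.norm_def, mul_comm, ← ENNReal.toReal_mul]
  refine ENNReal.toReal_mono ?_ h
  exact ENNReal.mul_ne_top (Lp.eLpNorm_ne_top g)
    (ENNReal.rpow_ne_top_of_nonneg (by norm_num) (measure_ne_top _ _))

end Approximation

/-! ### Evaluation of two-scale fields -/

section Evaluation

variable {I : Type*} [Fintype I] {d : ℕ} {ι : Type*} {l : Filter ι} (o : Oscillation I d l)
  {Ω : Set (Space d)}

/-- Two-scale fields in `L²(Ω; C(𝕋; ℝ^d))`. -/
abbrev TwoScale (I : Type*) [Fintype I] {d : ℕ} (Ω : Set (Space d)) : Type _ :=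
  Lp C(UnitAddTorus I, Space d) 2 (volume.restrict Ω)

namespace Oscillation

theorem memLp_eval {f : Space d → C(UnitAddTorus I, Space d)} (hf : MemLp f 2 (volume.restrict Ω))
    (e : ι) : MemLp (fun x => f x (o.point e x)) 2 (volume.restrict Ω) :=
  hf.mono (o.aestronglyMeasurable_eval hf.1 e)
    (Eventually.of_forall fun x => (f x).norm_coe_le_norm _)

/-- The oscillating field `x ↦ F x (point e x)`. -/
def eval (Ω : Set (Space d)) (e : ι) :
    TwoScale I Ω →L[ℝ] Lp (Space d) 2 (volume.restrict Ω) :=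
  LinearMap.mkContinuous
    { toFun := fun F => (o.memLp_eval (Lp.memLp F) e).toLp
      map_add' := fun F G => by
        refine Lp.ext ?_
        filter_upwards [(o.memLp_eval (Lp.memLp (F + G)) e).coeFn_toLp,
          (o.memLp_eval (Lp.memLp F) e).coeFn_toLp, (o.memLp_eval (Lp.memLp G) e).coeFn_toLp,
          Lp.coeFn_add F G, Lp.coeFn_add (o.memLp_eval (Lp.memLp F) e).toLp
            (o.memLp_eval (Lp.memLp G) e).toLp] with x h1 h2 h3 h4 h5
        rw [h1, h5, Pi.add_apply, h2, h3, h4]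
        rfl
      map_smul' := fun c F => by
        refine Lp.ext ?_
        filter_upwards [(o.memLp_eval (Lp.memLp (c • F)) e).coeFn_toLp,
          (o.memLp_eval (Lp.memLp F) e).coeFn_toLp, Lp.coeFn_smul c F,
          Lp.coeFn_smul c (o.memLp_eval (Lp.memLp F) e).toLp] with x h1 h2 h3 h4
        rw [h1, RingHom.id_apply, h4, Pi.smul_apply, h2, h3]
        rfl } 1 fun F => by
    refine Lp.norm_le_mul_norm_of_ae_le_mul ?_
    filter_upwards [(o.memLp_eval (Lp.memLp F) e).coeFn_toLp] with x hx
    rw [one_mul]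
    refine (congrArg norm hx).le.trans ?_
    exact (F x).norm_coe_le_norm _

theorem coeFn_eval (e : ι) (F : TwoScale I Ω) :
    o.eval Ω e F =ᵐ[volume.restrict Ω] fun x => F x (o.point e x) :=
  (o.memLp_eval (Lp.memLp F) e).coeFn_toLp

theorem tendsto_norm_eval (hΩ : MeasurableSet Ω) (F : TwoScale I Ω) :
    Tendsto (fun e => ‖o.eval Ω e F‖ ^ 2) l (𝓝 (∫ x in Ω, ‖toTorusL2 I d (F x)‖ ^ 2)) := by
  refine (o.tendsto_integral_norm_sq hΩ (Lp.memLp F)).congr fun e => ?_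
  rw [norm_sq_eq_integral]
  refine integral_congr_ae ?_
  filter_upwards [o.coeFn_eval e F] with x hx
  rw [hx]

end Oscillation

/-- The average over the torus of a two-scale field. -/
def average (Ω : Set (Space d)) : TwoScale I Ω →L[ℝ] Lp (Space d) 2 (volume.restrict Ω) :=
  ((ContinuousLinearMap.adjoint (constTorusL2 I d)).comp (toTorusL2 I d)).compLpL 2
    (volume.restrict Ω)

theorem coeFn_average (F : TwoScale I Ω) :
    average Ω F =ᵐ[volume.restrict Ω] fun x =>
      ContinuousLinearMap.adjoint (constTorusL2 I d) (toTorusL2 I d (F x)) :=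
  ContinuousLinearMap.coeFn_compLpL _ _

theorem IsTest.memLp_smul_const {F : Type*} [NormedAddCommGroup F] [NormedSpace ℝ F]
    {φ : Space d → ℝ} (hφ : IsTest Ω φ) (v : F) :
    MemLp (fun x => φ x • v) 2 (volume.restrict Ω) :=
  (hφ.continuous.smul continuous_const).memLp_of_hasCompactSupport hφ.compact.smul_right

/-- The two-scale field `φ(x) v(w)`. -/
def IsTest.tensor {φ : Space d → ℝ} (hφ : IsTest Ω φ) :
    C(UnitAddTorus I, Space d) →ₗ[ℝ] TwoScale I Ω where
  toFun v := (hφ.memLp_smul_const v).toLp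
  map_add' v w := by
    rw [← MemLp.toLp_add]
    congr 1
    ext1 x
    exact smul_add _ _ _
  map_smul' c v := by
    rw [RingHom.id_apply, ← MemLp.toLp_const_smul]
    congr 1
    ext1 x
    exact smul_comm _ _ _

theorem IsTest.coeFn_tensor {φ : Space d → ℝ} (hφ : IsTest Ω φ) (v : C(UnitAddTorus I, Space d)) :
    hφ.tensor v =ᵐ[volume.restrict Ω] fun x => φ x • v :=
  (hφ.memLp_smul_const v).coeFn_toLp

end Evaluation

/-! ### Plane waves -/

section PlaneWave

variable {d : ℕ} {Ω : Set (Space d)}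

/-- The plane wave `x ↦ Re (b e^{2πi θ·x})`. -/
def planeWave (θ : Space d) (b : ℂ) (x : Space d) : ℝ :=
  (b * Complex.exp (((2 * Real.pi * inner ℝ θ x : ℝ) : ℂ) * Complex.I)).re

theorem planeWave_eq (θ : Space d) (b : ℂ) (x : Space d) :
    planeWave θ b x = b.re * Real.cos (2 * Real.pi * inner ℝ θ x) -
      b.im * Real.sin (2 * Real.pi * inner ℝ θ x) := by
  rw [planeWave, Complex.mul_re, Complex.exp_ofReal_mul_I_re, Complex.exp_ofReal_mul_I_im]

theorem abs_planeWave_le (θ : Space d) (b : ℂ) (x : Space d) : |planeWave θ b x| ≤ ‖b‖ := by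
  refine (Complex.abs_re_le_norm _).trans ?_
  rw [norm_mul, Complex.norm_exp_ofReal_mul_I, mul_one]

theorem contDiff_planeWave (θ : Space d) (b : ℂ) :
    ContDiff ℝ ((⊤ : ℕ∞) : WithTop ℕ∞) (planeWave θ b) := by
  have : planeWave θ b = fun x => b.re * Real.cos (2 * Real.pi * inner ℝ θ x) -
      b.im * Real.sin (2 * Real.pi * inner ℝ θ x) := funext (planeWave_eq θ b)
  rw [this]
  have hi : ContDiff ℝ ((⊤ : ℕ∞) : WithTop ℕ∞) fun x : Space d => 2 * Real.pi * inner ℝ θ x :=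
    contDiff_const.mul (contDiff_const.inner ℝ contDiff_id)
  exact (contDiff_const.mul hi.cos).sub (contDiff_const.mul hi.sin)

theorem fderiv_planeWave (θ : Space d) (b : ℂ) (x v : Space d) :
    fderiv ℝ (planeWave θ b) x v =
      2 * Real.pi * inner ℝ θ v * planeWave θ (Complex.I * b) x := by
  have hi : HasFDerivAt (fun x : Space d => 2 * Real.pi * inner ℝ θ x)
      ((2 * Real.pi) • innerSL ℝ θ) x := (innerSL ℝ θ).hasFDerivAt.const_mul _
  have h : HasFDerivAt (planeWave θ b) _ x :=
    ((hi.cos.const_mul b.re).sub (hi.sin.const_mul b.im)).congr_of_eventuallyEq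
      (Eventually.of_forall (planeWave_eq θ b))
  rw [h.fderiv, planeWave_eq]
  simp
  ring

theorem planeWave_smul (θ : Space d) (b : ℂ) (t : ℝ) (x : Space d) :
    planeWave θ ((t : ℂ) * b) x = t * planeWave θ b x := by
  rw [planeWave, planeWave, mul_assoc, Complex.re_ofReal_mul]

/-- Every plane wave is, up to a factor, a derivative of a plane wave. -/
theorem fderiv_planeWave_antideriv (θ : Space d) (b : ℂ) (x v : Space d) :
    fderiv ℝ (planeWave θ (b / (2 * Real.pi * Complex.I))) x v =
      inner ℝ θ v * planeWave θ b x := by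
  rw [fderiv_planeWave]
  have : Complex.I * (b / (2 * Real.pi * Complex.I)) = (((2 * Real.pi)⁻¹ : ℝ) : ℂ) * b := by
    have := Real.pi_ne_zero
    push_cast
    field_simp
  rw [this, planeWave_smul]
  have := Real.pi_ne_zero
  field_simp

/-- Integration by parts against a test function. -/
theorem IsTest.integral_mul_fderiv {ψ f : Space d → ℝ} (hψ : IsTest Ω ψ)
    (hf : ContDiff ℝ ((⊤ : ℕ∞) : WithTop ℕ∞) f) (v : Space d) :
    ∫ x, f x * fderiv ℝ ψ x v = -∫ x, fderiv ℝ f x v * ψ x := by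
  have hfc : Continuous (fun x => fderiv ℝ f x v) :=
    (hf.continuous_fderiv (by simp)).clm_apply continuous_const
  have hψc : Continuous (fun x => fderiv ℝ ψ x v) :=
    hψ.continuous_fderiv.clm_apply continuous_const
  have hs : HasCompactSupport (fun x => fderiv ℝ ψ x v) :=
    (hψ.compact.fderiv ℝ).comp_left (g := fun L : Space d →L[ℝ] ℝ => L v) rfl
  exact integral_mul_fderiv_eq_neg_fderiv_mul_of_integrable
    ((hfc.mul hψ.continuous).integrable_of_hasCompactSupport hψ.compact.mul_left)
    ((hf.continuous.mul hψc).integrable_of_hasCompactSupport hs.mul_left)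
    ((hf.continuous.mul hψ.continuous).integrable_of_hasCompactSupport hψ.compact.mul_left)
    (fun x _ => hf.differentiable (by simp) x) (fun x _ => hψ.differentiable x)

theorem IsTest.contDiff_fderiv_apply {φ : Space d → ℝ} (hφ : IsTest Ω φ) (v : Space d) :
    ContDiff ℝ ((⊤ : ℕ∞) : WithTop ℕ∞) (fun x => fderiv ℝ φ x v) :=
  (hφ.smooth.fderiv_right (m := ((⊤ : ℕ∞) : WithTop ℕ∞)) (by simp)).clm_apply contDiff_const

theorem exists_bound_of_hasCompactSupport {X F : Type*} [TopologicalSpace X]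
    [SeminormedAddCommGroup F] {f : X → F} (h : HasCompactSupport f) (hc : Continuous f) :
    ∃ C : ℝ, 0 ≤ C ∧ ∀ x, ‖f x‖ ≤ C := by
  obtain ⟨C, hC⟩ := h.exists_bound_of_continuous hc
  exact ⟨max C 0, le_max_right _ _, fun x => (hC x).trans (le_max_left _ _)⟩

theorem exists_bound_fderiv {E : Type*} [NormedAddCommGroup E] [NormedSpace ℝ E] {φ : E → ℝ}
    (hφ : ContDiff ℝ ((⊤ : ℕ∞) : WithTop ℕ∞) φ) (hc : HasCompactSupport φ) :
    ∃ C : ℝ, 0 ≤ C ∧ ∀ x, ‖fderiv ℝ φ x‖ ≤ C :=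
  exists_bound_of_hasCompactSupport (X := E) (F := E →L[ℝ] ℝ) (f := fderiv ℝ φ)
    (hc.fderiv ℝ) (hφ.continuous_fderiv (by simp))

theorem exists_bound_fderiv_fderiv {E : Type*} [NormedAddCommGroup E] [NormedSpace ℝ E]
    {φ : E → ℝ} (hφ : ContDiff ℝ ((⊤ : ℕ∞) : WithTop ℕ∞) φ) (hc : HasCompactSupport φ) :
    ∃ C : ℝ, 0 ≤ C ∧ ∀ x, ‖fderiv ℝ (fderiv ℝ φ) x‖ ≤ C := by
  have hs : ContDiff ℝ ((⊤ : ℕ∞) : WithTop ℕ∞) (fderiv ℝ φ) :=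
    hφ.fderiv_right (m := ((⊤ : ℕ∞) : WithTop ℕ∞)) (by simp)
  exact exists_bound_of_hasCompactSupport (X := E) (F := E →L[ℝ] E →L[ℝ] ℝ)
    (f := fderiv ℝ (fderiv ℝ φ)) ((hc.fderiv ℝ).fderiv ℝ) (hs.continuous_fderiv (by simp))

theorem IsTest.exists_bound {φ : Space d → ℝ} (hφ : IsTest Ω φ) :
    ∃ C : ℝ, 0 ≤ C ∧ (∀ x, |φ x| ≤ C) ∧ (∀ x, ‖fderiv ℝ φ x‖ ≤ C) ∧
      ∀ x v w, |fderiv ℝ (fun y => fderiv ℝ φ y v) x w| ≤ C * ‖v‖ * ‖w‖ := by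
  obtain ⟨C₀, p₀, h₀⟩ := exists_bound_of_hasCompactSupport hφ.compact hφ.continuous
  obtain ⟨C₁, p₁, h₁⟩ := exists_bound_fderiv hφ.smooth hφ.compact
  obtain ⟨C₂, p₂, h₂⟩ := exists_bound_fderiv_fderiv hφ.smooth hφ.compact
  have hs : ContDiff ℝ ((⊤ : ℕ∞) : WithTop ℕ∞) (fderiv ℝ φ) :=
    hφ.smooth.fderiv_right (m := ((⊤ : ℕ∞) : WithTop ℕ∞)) (by simp)
  refine ⟨C₀ + C₁ + C₂, by positivity, fun x => ?_, fun x => ?_, fun x v w => ?_⟩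
  · have := h₀ x
    rw [Real.norm_eq_abs] at this
    linarith
  · linarith [h₁ x]
  · have hd : DifferentiableAt ℝ (fderiv ℝ φ) x := hs.differentiable (by simp) x
    have e1 : fderiv ℝ (fun y => fderiv ℝ φ y v) x w = fderiv ℝ (fderiv ℝ φ) x w v := by
      rw [fderiv_clm_apply hd (differentiableAt_const v)]
      simp
    rw [e1]
    have h3 := (fderiv ℝ (fderiv ℝ φ) x w).le_opNorm v
    have h4 := (fderiv ℝ (fderiv ℝ φ) x).le_opNorm w
    rw [Real.norm_eq_abs] at h3
    calc _ ≤ ‖fderiv ℝ (fderiv ℝ φ) x w‖ * ‖v‖ := h3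
      _ ≤ (C₂ * ‖w‖) * ‖v‖ := by
          gcongr
          exact h4.trans (by gcongr; exact h₂ x)
      _ = C₂ * ‖v‖ * ‖w‖ := by ring
      _ ≤ _ := by gcongr; linarith

/-- The basic oscillatory identity: two integrations by parts. -/
theorem IsTest.integral_planeWave_eq {φ ψ : Space d → ℝ} (hφ : IsTest Ω φ) (hψ : IsTest Ω ψ)
    {θ c : Space d} (hθ : θ ≠ 0) (hc : inner ℝ θ c = 0) (b : ℂ) :
    ∫ x, φ x * planeWave θ b x * fderiv ℝ ψ x c =
      ∫ x, (‖θ‖ ^ 2)⁻¹ * planeWave θ (b / (2 * Real.pi * Complex.I)) x *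
        fderiv ℝ (ψ * fun y => fderiv ℝ φ y c) x θ := by
  set h : Space d → ℝ := fun y => fderiv ℝ φ y c with hh
  have hsm : ContDiff ℝ ((⊤ : ℕ∞) : WithTop ℕ∞) h := hφ.contDiff_fderiv_apply c
  have h1 := hψ.integral_mul_fderiv (hφ.smooth.mul (contDiff_planeWave θ b)) c
  have e1 : ∀ x, fderiv ℝ (fun x => φ x * planeWave θ b x) x c = h x * planeWave θ b x := by
    intro x
    rw [fderiv_fun_mul (hφ.differentiable x)
      ((contDiff_planeWave θ b).differentiable (by simp) x)]
    simp [fderiv_planeWave, hc, hh, mul_comm]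
  have h2 := (hψ.mul_smooth hsm).integral_mul_fderiv
    (contDiff_planeWave θ (b / (2 * Real.pi * Complex.I))) θ
  simp_rw [fderiv_planeWave_antideriv, real_inner_self_eq_norm_sq] at h2
  simp_rw [e1] at h1
  have hn : ‖θ‖ ^ 2 ≠ 0 := pow_ne_zero 2 (norm_ne_zero_iff.2 hθ)
  have e2 : ∀ x, (‖θ‖ ^ 2)⁻¹ * planeWave θ (b / (2 * Real.pi * Complex.I)) x *
      fderiv ℝ (ψ * h) x θ = (‖θ‖ ^ 2)⁻¹ *
        (planeWave θ (b / (2 * Real.pi * Complex.I)) x * fderiv ℝ (ψ * h) x θ) :=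
    fun x => mul_assoc _ _ _
  rw [h1]
  simp_rw [e2]
  rw [integral_const_mul, h2, ← integral_neg, ← integral_neg, ← integral_const_mul]
  refine integral_congr_ae (Eventually.of_forall fun x => ?_)
  simp only [Pi.mul_apply]
  field_simp

theorem IsTest.abs_integral_le {ψ : Space d → ℝ} (hψ : IsTest Ω ψ) {f : Space d → ℝ} {C : ℝ}
    (hf : ∀ x, |f x| ≤ C * (|ψ x| + ‖fderiv ℝ ψ x‖)) {K : ℝ} (hC : 0 ≤ C)
    (hK₁ : ∀ g : Lp ℝ 2 (volume.restrict Ω), ∫ x in Ω, ‖g x‖ ≤ K * ‖g‖)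
    (hK₂ : ∀ g : Lp (Space d) 2 (volume.restrict Ω), ∫ x in Ω, ‖g x‖ ≤ K * ‖g‖) (hK : 0 ≤ K) :
    |∫ x, f x| ≤ 2 * K * C * ‖hψ.toH10‖ := by
  have hz : ∀ x, x ∉ Ω → f x = 0 := fun x hx => by
    have h1 : fderiv ℝ ψ x = 0 := image_eq_zero_of_notMem_tsupport fun h =>
      hx (hψ.subset (tsupport_fderiv_subset ℝ h))
    have h2 := hf x
    rw [hψ.eq_zero_of_notMem hx, h1] at h2
    simpa using h2
  rw [← setIntegral_eq_integral_of_forall_compl_eq_zero hz]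
  have i1 : Integrable ψ (volume.restrict Ω) :=
    (hψ.continuous.integrable_of_hasCompactSupport hψ.compact).integrableOn
  have i2 : Integrable (gradient ψ) (volume.restrict Ω) :=
    (hψ.continuous_gradient.integrable_of_hasCompactSupport
      hψ.hasCompactSupport_gradient).integrableOn
  have hn : ∀ x, ‖gradient ψ x‖ = ‖fderiv ℝ ψ x‖ := fun x => by simp [gradient]
  have h1 : |∫ x in Ω, f x| ≤ ∫ x in Ω, C * (‖ψ x‖ + ‖gradient ψ x‖) := by
    have i3 : Integrable (fun x => C * (‖ψ x‖ + ‖gradient ψ x‖)) (volume.restrict Ω) :=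
      (i1.norm.add i2.norm).const_mul C
    rw [← Real.norm_eq_abs]
    refine norm_integral_le_of_norm_le i3 (Eventually.of_forall fun x => ?_)
    simpa only [hn, Real.norm_eq_abs] using hf x
  rw [integral_const_mul, integral_add i1.norm i2.norm] at h1
  have h2 : ∫ x in Ω, ‖ψ x‖ ≤ K * ‖hψ.toH10‖ := by
    have h3 : ‖(hψ.toH10 : L2Pair Ω).fst‖ ≤ ‖hψ.toH10‖ := by
      refine le_of_sq_le_sq ?_ (norm_nonneg _)
      rw [Submodule.coe_norm, WithLp.prod_norm_sq_eq_of_L2]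
      exact le_add_of_nonneg_right (sq_nonneg _)
    refine le_trans ?_ ((hK₁ _).trans (mul_le_mul_of_nonneg_left h3 hK))
    refine (integral_congr_ae ?_).le
    filter_upwards [hψ.memLp.coeFn_toLp] with x hx
    rw [hψ.fst_toH10, hx]
  have h3 : ∫ x in Ω, ‖gradient ψ x‖ ≤ K * ‖hψ.toH10‖ := by
    refine le_trans ?_ ((hK₂ _).trans (mul_le_mul_of_nonneg_left (norm_grad_le hψ.toH10) hK))
    refine (integral_congr_ae ?_).le
    filter_upwards [hψ.memLp_gradient.coeFn_toLp] with x hx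
    rw [hψ.grad_toH10, hx]
  calc |∫ x in Ω, f x| ≤ C * (K * ‖hψ.toH10‖ + K * ‖hψ.toH10‖) :=
        h1.trans (mul_le_mul_of_nonneg_left (add_le_add h2 h3) hC)
    _ = _ := by ring

/-- Pairing of a plane wave with a gradient: small if the frequency is large and almost orthogonal
to the polarization. -/
theorem IsTest.exists_planeWave_bound {φ : Space d → ℝ} (hφ : IsTest Ω φ)
    [IsFiniteMeasure (volume.restrict Ω)] (c : Space d) (b : ℂ) :
    ∃ C : ℝ, 0 ≤ C ∧ ∀ θ : Space d, θ ≠ 0 → ∀ ψ (hψ : IsTest Ω ψ),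
      |∫ x, φ x * planeWave θ b x * fderiv ℝ ψ x c| ≤
        C * (|inner ℝ θ c| / ‖θ‖ + 1 / ‖θ‖) * ‖hψ.toH10‖ := by
  obtain ⟨M, hM, hM0, hM1, hM2⟩ := hφ.exists_bound
  obtain ⟨K₁, hK₁, hK₁'⟩ := exists_integral_norm_le (F := ℝ) (volume.restrict Ω)
  obtain ⟨K₂, hK₂, hK₂'⟩ := exists_integral_norm_le (F := Space d) (volume.restrict Ω)
  set K := K₁ + K₂
  have hK : 0 ≤ K := by positivity
  have hKa : ∀ g : Lp ℝ 2 (volume.restrict Ω), ∫ x in Ω, ‖g x‖ ≤ K * ‖g‖ := fun g =>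
    (hK₁' g).trans (by gcongr; exact le_add_of_nonneg_right hK₂)
  have hKb : ∀ g : Lp (Space d) 2 (volume.restrict Ω), ∫ x in Ω, ‖g x‖ ≤ K * ‖g‖ := fun g =>
    (hK₂' g).trans (by gcongr; exact le_add_of_nonneg_left hK₁)
  set b' : ℂ := b / (2 * Real.pi * Complex.I)
  refine ⟨2 * K * (M * ‖b‖) + 2 * K * (M * ‖b'‖ * ‖c‖), by positivity, fun θ hθ ψ hψ => ?_⟩
  have hθn : 0 < ‖θ‖ := norm_pos_iff.2 hθ
  set t : ℝ := inner ℝ θ c / ‖θ‖ ^ 2 with ht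
  set c' : Space d := c - t • θ with hc'
  have horth : inner ℝ θ c' = 0 := by
    rw [hc', inner_sub_right, real_inner_smul_right, real_inner_self_eq_norm_sq, ht]
    field_simp
    ring
  have hc'n : ‖c'‖ ≤ ‖c‖ := by
    have e1 : c = c' + t • θ := by rw [hc']; abel
    have e2 : ‖c‖ ^ 2 = ‖c'‖ ^ 2 + ‖t • θ‖ ^ 2 := by
      conv_lhs => rw [e1]
      rw [norm_add_sq_real, real_inner_smul_right, real_inner_comm, horth]
      ring
    refine le_of_sq_le_sq ?_ (norm_nonneg _)
    rw [e2]
    exact le_add_of_nonneg_right (sq_nonneg _)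
  have hint : ∀ v, Integrable (fun x => φ x * planeWave θ b x * fderiv ℝ ψ x v) := fun v =>
    ((hφ.continuous.mul (contDiff_planeWave θ b).continuous).mul
      (hψ.continuous_fderiv.clm_apply continuous_const)).integrable_of_hasCompactSupport
      (hφ.compact.mul_right).mul_right
  have hsplit : ∫ x, φ x * planeWave θ b x * fderiv ℝ ψ x c =
      (∫ x, φ x * planeWave θ b x * fderiv ℝ ψ x c') +
        t * ∫ x, φ x * planeWave θ b x * fderiv ℝ ψ x θ := by
    rw [← integral_const_mul, ← integral_add (hint _) ((hint _).const_mul _)]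
    refine integral_congr_ae (Eventually.of_forall fun x => ?_)
    simp only [hc', map_sub, map_smul, smul_eq_mul]
    ring
  have hb1 : |∫ x, φ x * planeWave θ b x * fderiv ℝ ψ x θ| ≤
      2 * K * (M * ‖b‖ * ‖θ‖) * ‖hψ.toH10‖ := by
    refine hψ.abs_integral_le (fun x => ?_) (by positivity) hKa hKb hK
    rw [abs_mul, abs_mul]
    calc |φ x| * |planeWave θ b x| * |fderiv ℝ ψ x θ| ≤ M * ‖b‖ * (‖fderiv ℝ ψ x‖ * ‖θ‖) := by
          gcongr
          · exact hM0 x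
          · exact abs_planeWave_le θ b x
          · exact (fderiv ℝ ψ x).le_opNorm θ
      _ = M * ‖b‖ * ‖θ‖ * ‖fderiv ℝ ψ x‖ := by ring
      _ ≤ _ := by gcongr; exact le_add_of_nonneg_left (abs_nonneg _)
  have hb2 : |∫ x, φ x * planeWave θ b x * fderiv ℝ ψ x c'| ≤
      2 * K * (M * ‖b'‖ * ‖c‖ / ‖θ‖) * ‖hψ.toH10‖ := by
    rw [hφ.integral_planeWave_eq hψ hθ horth b]
    refine hψ.abs_integral_le (fun x => ?_) (by positivity) hKa hKb hK
    have hsm := hφ.contDiff_fderiv_apply c'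
    have e1 : fderiv ℝ (ψ * fun y => fderiv ℝ φ y c') x θ =
        ψ x * fderiv ℝ (fun y => fderiv ℝ φ y c') x θ + fderiv ℝ φ x c' * fderiv ℝ ψ x θ := by
      rw [fderiv_mul (hψ.differentiable x) (hsm.differentiable (by simp) x)]
      simp
    have e2 : |fderiv ℝ (ψ * fun y => fderiv ℝ φ y c') x θ| ≤
        M * ‖c‖ * ‖θ‖ * (|ψ x| + ‖fderiv ℝ ψ x‖) := by
      rw [e1]
      refine (abs_add_le _ _).trans ?_
      rw [abs_mul, abs_mul]
      calc _ ≤ |ψ x| * (M * ‖c‖ * ‖θ‖) + (M * ‖c‖) * (‖fderiv ℝ ψ x‖ * ‖θ‖) := by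
            gcongr
            · exact (hM2 x c' θ).trans (by gcongr)
            · exact ((fderiv ℝ φ x).le_opNorm c').trans (mul_le_mul (hM1 x) hc'n
                (norm_nonneg _) hM)
            · exact (fderiv ℝ ψ x).le_opNorm θ
        _ = _ := by ring
    rw [abs_mul, abs_mul, abs_of_nonneg (by positivity : (0 : ℝ) ≤ (‖θ‖ ^ 2)⁻¹)]
    calc _ ≤ (‖θ‖ ^ 2)⁻¹ * ‖b'‖ * (M * ‖c‖ * ‖θ‖ * (|ψ x| + ‖fderiv ℝ ψ x‖)) := by
          gcongr
          exact abs_planeWave_le θ b' x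
      _ = _ := by field_simp
  rw [hsplit]
  refine (abs_add_le _ _).trans ?_
  rw [abs_mul t, ht, abs_div, abs_of_nonneg (by positivity : (0 : ℝ) ≤ ‖θ‖ ^ 2)]
  have hb3 := mul_le_mul_of_nonneg_left hb1
    (by positivity : (0 : ℝ) ≤ |inner ℝ θ c| / ‖θ‖ ^ 2)
  refine (add_le_add hb2 hb3).trans ?_
  have e3 : |inner ℝ θ c| / ‖θ‖ ^ 2 * (2 * K * (M * ‖b‖ * ‖θ‖) * ‖hψ.toH10‖) =
      2 * K * (M * ‖b‖) * (|inner ℝ θ c| / ‖θ‖) * ‖hψ.toH10‖ := by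
    field_simp
  have e4 : 2 * K * (M * ‖b'‖ * ‖c‖ / ‖θ‖) * ‖hψ.toH10‖ =
      2 * K * (M * ‖b'‖ * ‖c‖) * (1 / ‖θ‖) * ‖hψ.toH10‖ := by
    field_simp
  rw [e3, e4, ← add_mul]
  refine mul_le_mul_of_nonneg_right ?_ (norm_nonneg _)
  have p1 : 0 ≤ 2 * K * (M * ‖b‖) := by positivity
  have p2 : 0 ≤ 2 * K * (M * ‖b'‖ * ‖c‖) := by positivity
  have p3 : 0 ≤ |inner ℝ θ c| / ‖θ‖ := by positivity
  have p4 : 0 ≤ 1 / ‖θ‖ := by positivity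
  nlinarith [mul_nonneg p1 p4, mul_nonneg p2 p3]

end PlaneWave

/-! ### Oscillating waves and gradients -/

section Grad

variable {d : ℕ} {Ω : Set (Space d)}

theorem grad_zero : grad (0 : H10 Ω) = 0 := (gradL Ω).map_zero

theorem grad_add (u v : H10 Ω) : grad (u + v) = grad u + grad v := (gradL Ω).map_add u v

theorem grad_smul (a : ℝ) (u : H10 Ω) : grad (a • u) = a • grad u := (gradL Ω).map_smul a u

end Grad

namespace Oscillation

open UnitAddTorus

variable {I : Type*} [Fintype I] {d : ℕ} {ι : Type*} {l : Filter ι} (o : Oscillation I d l)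
  {Ω : Set (Space d)} {φ : Space d → ℝ}

theorem wave_point (k : I → ℤ) (b : ℂ) (c : Space d) (e : ι) (x : Space d) :
    wave k b c (o.point e x) = planeWave (o.freq e k) b x • c := by
  rw [wave_apply, o.mFourier_point]
  rfl

theorem dir_zero : o.dir 0 = 0 := by
  have h := o.dir_neg 0
  rw [neg_zero] at h
  have h2 : (2 : ℝ) • o.dir 0 = 0 := by
    rw [two_smul]; nth_rewrite 1 [h]; exact neg_add_cancel _
  simpa using h2

theorem coeFn_eval_tensor (hφ : IsTest Ω φ) (v : C(UnitAddTorus I, Space d)) (e : ι) :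
    o.eval Ω e (hφ.tensor v) =ᵐ[volume.restrict Ω] fun x => φ x • v (o.point e x) := by
  filter_upwards [o.coeFn_eval e (hφ.tensor v), hφ.coeFn_tensor v] with x h1 h2
  rw [h1, h2]
  rfl

theorem coeFn_average_tensor (hφ : IsTest Ω φ) (v : C(UnitAddTorus I, Space d)) :
    average Ω (hφ.tensor v) =ᵐ[volume.restrict Ω] fun x => φ x • ∫ t, v t ∂torusMeasure I := by
  filter_upwards [coeFn_average (hφ.tensor v), hφ.coeFn_tensor v] with x h1 h2
  rw [h1, h2, map_smul, map_smul, adjoint_constTorusL2]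

theorem integral_wave {k : I → ℤ} (hk : k ≠ 0) (b : ℂ) (c : Space d) :
    ∫ t, wave k b c t ∂torusMeasure I = 0 := by
  simp_rw [wave_apply]
  rw [integral_smul_const, integral_re_mul_mFourier hk, zero_smul]

theorem eventually_scale_ne_zero {k : I → ℤ} (hk : k ≠ 0) : ∀ᶠ e in l, o.scale e k ≠ 0 := by
  have hpos : 0 < ‖o.dir k‖ := norm_pos_iff.2 (o.dir_ne_zero k hk)
  filter_upwards [(o.scale_smul_freq k hk).norm.eventually (lt_mem_nhds hpos)] with e he h
  simp [h] at he

theorem tendsto_polarization {k : I → ℤ} (hk : k ≠ 0) {c : Space d}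
    (hc : inner ℝ c (o.dir k) = 0) :
    Tendsto (fun e => |inner ℝ (o.freq e k) c| / ‖o.freq e k‖ + 1 / ‖o.freq e k‖) l (𝓝 0) := by
  have h1 : Tendsto (fun e => 1 / ‖o.freq e k‖) l (𝓝 0) := by
    simpa [Function.comp_def] using tendsto_inv_atTop_zero.comp (o.tendsto_norm_freq hk)
  have hne : ‖o.dir k‖ ≠ 0 := norm_ne_zero_iff.2 (o.dir_ne_zero k hk)
  have hs := o.scale_smul_freq k hk
  have h2 : Tendsto (fun e => |inner ℝ (o.scale e k • o.freq e k) c| /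
      ‖o.scale e k • o.freq e k‖) l (𝓝 0) := by
    have h3 := ((hs.inner (tendsto_const_nhds (x := c))).abs).div hs.norm hne
    rwa [real_inner_comm, hc, abs_zero, zero_div] at h3
  have h4 : Tendsto (fun e => |inner ℝ (o.freq e k) c| / ‖o.freq e k‖) l (𝓝 0) := by
    refine h2.congr' ?_
    filter_upwards [o.eventually_scale_ne_zero hk] with e he
    rw [real_inner_smul_left, abs_mul, norm_smul, Real.norm_eq_abs,
      mul_div_mul_left _ _ (abs_pos.2 he).ne']
  simpa using h4.add h1

/-- Solenoidal waves see only their mean when paired with gradients. -/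
theorem tendsto_inner_solenoidal [IsFiniteMeasure (volume.restrict Ω)] (hφ : IsTest Ω φ)
    {u : ι → H10 Ω} {R : ℝ} (hu : ∀ e, ‖u e‖ ≤ R) {D : C(UnitAddTorus I, Space d)}
    (hD : D ∈ solenoidalWaves o.dir) :
    Tendsto (fun e => inner ℝ (o.eval Ω e (hφ.tensor D) - average Ω (hφ.tensor D)) (grad (u e)))
      l (𝓝 0) := by
  refine Submodule.span_induction ?_ ?_ ?_ ?_ hD
  · rintro _ ⟨k, b, c, hc, rfl⟩
    by_cases hk : k = 0
    · subst hk
      have hw : (wave 0 b c : C(UnitAddTorus I, Space d)) = ContinuousMap.const _ (b.re • c) := by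
        ext1 t
        simp [wave_apply, mFourier_zero]
      have h0 : ∀ e, o.eval Ω e (hφ.tensor (wave 0 b c)) -
          average Ω (hφ.tensor (wave 0 b c : C(UnitAddTorus I, Space d))) = 0 := by
        intro e
        rw [sub_eq_zero]
        refine Lp.ext ?_
        filter_upwards [o.coeFn_eval_tensor hφ (wave 0 b c) e,
          coeFn_average_tensor hφ (wave 0 b c : C(UnitAddTorus I, Space d))] with x h1 h2
        rw [h1, h2, hw]
        simp
      simp_rw [h0, inner_zero_left]
      exact tendsto_const_nhds
    · have h0 : average Ω (hφ.tensor (wave k b c : C(UnitAddTorus I, Space d))) = 0 := by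
        refine Lp.ext ?_
        filter_upwards [coeFn_average_tensor hφ (wave k b c : C(UnitAddTorus I, Space d)),
          Lp.coeFn_zero (Space d) 2 (volume.restrict Ω)] with x h1 h2
        rw [h1, h2, integral_wave hk, smul_zero]
        rfl
      simp_rw [h0, sub_zero]
      obtain ⟨C, hC0, hC⟩ := hφ.exists_planeWave_bound c b
      have hR : 0 ≤ max R 0 := le_max_right _ _
      have hlim := ((o.tendsto_polarization hk hc).const_mul C).mul_const (max R 0)
      rw [mul_zero, zero_mul] at hlim
      refine squeeze_zero_norm' ?_ hlim
      filter_upwards [(o.tendsto_norm_freq hk).eventually_gt_atTop 0] with e he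
      have hθ : o.freq e k ≠ 0 := norm_pos_iff.1 he
      set κ := C * (|inner ℝ (o.freq e k) c| / ‖o.freq e k‖ + 1 / ‖o.freq e k‖) with hκ
      have hκ0 : 0 ≤ κ := by positivity
      have key : ∀ w : H10 Ω, |inner ℝ (o.eval Ω e (hφ.tensor (wave k b c))) (grad w)| ≤ κ * ‖w‖ := by
        intro w
        refine H10_induction (P := fun w : L2Pair Ω =>
          |inner ℝ (o.eval Ω e (hφ.tensor (wave k b c))) w.snd| ≤ κ * ‖w‖)
          (isClosed_le ?_ (by fun_prop)) (fun ψ hψ => ?_) w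
        · exact (continuous_const.inner (WithLp.sndL 2 ℝ _ _).continuous).abs
        · refine le_trans (le_of_eq ?_) (hC _ hθ ψ hψ)
          congr 1
          have hz : ∀ x, x ∉ Ω → φ x * planeWave (o.freq e k) b x * fderiv ℝ ψ x c = 0 :=
            fun x hx => by rw [hφ.eq_zero_of_notMem hx, zero_mul, zero_mul]
          rw [← setIntegral_eq_integral_of_forall_compl_eq_zero hz, L2.inner_def]
          refine integral_congr_ae ?_
          filter_upwards [o.coeFn_eval_tensor hφ (wave k b c) e,
            hψ.memLp_gradient.coeFn_toLp] with x h1 h2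
          have h3 : (hψ.toH10 : L2Pair Ω).snd x = gradient ψ x := h2
          rw [h1, h3, o.wave_point, real_inner_smul_left, real_inner_smul_left, real_inner_comm,
            IsTest.inner_gradient, mul_assoc]
      rw [Real.norm_eq_abs]
      exact (key (u e)).trans (mul_le_mul_of_nonneg_left ((hu e).trans (le_max_left _ _)) hκ0)
  · simp only [map_zero, sub_zero, inner_zero_left]
    exact tendsto_const_nhds
  · intro v w _ _ hv hw
    have : ∀ e, inner ℝ (o.eval Ω e (hφ.tensor (v + w)) - average Ω (hφ.tensor (v + w))) (grad (u e)) =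
        inner ℝ (o.eval Ω e (hφ.tensor v) - average Ω (hφ.tensor v)) (grad (u e)) +
        inner ℝ (o.eval Ω e (hφ.tensor w) - average Ω (hφ.tensor w)) (grad (u e)) := by
      intro e
      rw [← inner_add_left]
      congr 1
      simp only [map_add]
      abel
    simp_rw [this]
    simpa using hv.add hw
  · intro a v _ hv
    have : ∀ e, inner ℝ (o.eval Ω e (hφ.tensor (a • v)) - average Ω (hφ.tensor (a • v))) (grad (u e)) =
        a * inner ℝ (o.eval Ω e (hφ.tensor v) - average Ω (hφ.tensor v)) (grad (u e)) := by
      intro e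
      rw [← real_inner_smul_left]
      congr 1
      simp only [map_smul, smul_sub]
    simp_rw [this]
    simpa using hv.const_mul a

theorem gradient_mul_planeWave (hφ : IsTest Ω φ) (θ : Space d) (b : ℂ) (x : Space d) :
    gradient (φ * planeWave θ (b / (2 * Real.pi * Complex.I))) x =
      planeWave θ (b / (2 * Real.pi * Complex.I)) x • gradient φ x +
        (φ x * planeWave θ b x) • θ := by
  refine ext_inner_right ℝ fun v => ?_
  rw [IsTest.inner_gradient, inner_add_left, real_inner_smul_left, real_inner_smul_left,
    IsTest.inner_gradient, fderiv_mul (hφ.differentiable x)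
      ((contDiff_planeWave _ _).differentiable (by simp) x)]
  simp only [add_apply, smul_apply, smul_eq_mul, fderiv_planeWave_antideriv]
  ring

theorem tendsto_inner_eval_wave (hΩ : MeasurableSet Ω) (hφ : IsTest Ω φ) {k : I → ℤ} (hk : k ≠ 0)
    (b : ℂ) (c : Space d) (g : Lp (Space d) 2 (volume.restrict Ω)) :
    Tendsto (fun e => inner ℝ g (o.eval Ω e (hφ.tensor (wave k b c)))) l (𝓝 0) := by
  have hint : Integrable (fun x => φ x * inner ℝ (g x) c) (volume.restrict Ω) := by
    have h := L2.integrable_inner (𝕜 := ℝ) g (hφ.memLp_smul_const c).toLp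
    refine h.congr ?_
    filter_upwards [(hφ.memLp_smul_const c).coeFn_toLp] with x hx
    rw [hx, real_inner_smul_right]
  have h := o.tendsto_integral_mFourier hk
    (Ω.indicator fun x => b * ((φ x * inner ℝ (g x) c : ℝ) : ℂ))
  have h2 := (Complex.continuous_re.tendsto _).comp h
  rw [Complex.zero_re] at h2
  refine h2.congr fun e => ?_
  have e1 : ∫ x, mFourier k (o.point e x) *
      (Ω.indicator fun x => b * ((φ x * inner ℝ (g x) c : ℝ) : ℂ)) x =
      ∫ x in Ω, mFourier k (o.point e x) * (b * ((φ x * inner ℝ (g x) c : ℝ) : ℂ)) := by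
    rw [← integral_indicator hΩ]
    refine integral_congr_ae (Eventually.of_forall fun x => ?_)
    by_cases hx : x ∈ Ω <;> simp [hx]
  have i1 : Integrable (fun x => mFourier k (o.point e x) *
      (b * ((φ x * inner ℝ (g x) c : ℝ) : ℂ))) (volume.restrict Ω) := by
    refine (hint.ofReal.const_mul b).bdd_mul (c := 1)
      ((mFourier k).continuous.comp (o.continuous_point e)).aestronglyMeasurable
      (Eventually.of_forall fun x => ?_)
    exact ((mFourier k).norm_coe_le_norm _).trans mFourier_norm.le
  rw [Function.comp_apply, e1, L2.inner_def]
  have e2 := integral_re i1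
  simp only [RCLike.re_to_complex] at e2
  rw [← e2]
  refine integral_congr_ae ?_
  filter_upwards [o.coeFn_eval_tensor hφ (wave k b c) e] with x hx
  rw [hx, wave_apply, real_inner_smul_right, real_inner_smul_right, ← mul_assoc (mFourier k _),
    Complex.re_mul_ofReal, mul_comm (mFourier k _)]
  ring

theorem norm_grad_sub_eval_le [IsFiniteMeasure (volume.restrict Ω)] (hφ : IsTest Ω φ) {M : ℝ}
    (hM : 0 ≤ M) (hM0 : ∀ x, |φ x| ≤ M) (hM1 : ∀ x, ‖fderiv ℝ φ x‖ ≤ M) (k : I → ℤ) (b : ℂ) (e : ι)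
    (ht : IsTest Ω (φ * planeWave (o.freq e k) (b / (2 * Real.pi * Complex.I)))) :
    ‖grad (o.scale e k • ht.toH10) - o.eval Ω e (hφ.tensor (wave k b (o.dir k)))‖ ≤
      measureUnivNNReal (volume.restrict Ω) ^ ((2 : ℝ≥0∞).toReal⁻¹) *
      (|o.scale e k| * (‖b / (2 * Real.pi * Complex.I)‖ * M) +
        M * (‖b‖ * ‖o.scale e k • o.freq e k - o.dir k‖)) := by
  refine Lp.norm_le_of_ae_bound (by positivity) ?_
  rw [grad_smul, ht.grad_toH10]
  filter_upwards [Lp.coeFn_sub (o.scale e k • ht.memLp_gradient.toLp)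
    (o.eval Ω e (hφ.tensor (wave k b (o.dir k)))),
    Lp.coeFn_smul (o.scale e k) ht.memLp_gradient.toLp, ht.memLp_gradient.coeFn_toLp,
    o.coeFn_eval_tensor hφ (wave k b (o.dir k)) e] with x h1 h2 h3 h4
  rw [h1, Pi.sub_apply, h2, Pi.smul_apply, h3, h4, gradient_mul_planeWave hφ, o.wave_point]
  generalize b / (2 * Real.pi * Complex.I) = b'
  have e1 : o.scale e k • (planeWave (o.freq e k) b' x • gradient φ x +
      (φ x * planeWave (o.freq e k) b x) • o.freq e k) -
      φ x • planeWave (o.freq e k) b x • o.dir k =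
      (o.scale e k * planeWave (o.freq e k) b' x) • gradient φ x +
      (φ x * planeWave (o.freq e k) b x) • (o.scale e k • o.freq e k - o.dir k) := by
    module
  rw [e1]
  refine (norm_add_le _ _).trans ?_
  rw [norm_smul, norm_smul, norm_mul, norm_mul]
  simp only [Real.norm_eq_abs, mul_assoc]
  have hn : ‖gradient φ x‖ ≤ M := by
    have : ‖gradient φ x‖ = ‖fderiv ℝ φ x‖ := by simp [gradient]
    rw [this]; exact hM1 x
  have hw := abs_planeWave_le (o.freq e k) b x
  have hw' := abs_planeWave_le (o.freq e k) b' x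
  refine add_le_add ?_ ?_
  · refine mul_le_mul_of_nonneg_left ?_ (abs_nonneg _)
    exact mul_le_mul hw' hn (norm_nonneg _) (norm_nonneg _)
  · refine mul_le_mul (hM0 x) ?_ (by positivity) hM
    exact mul_le_mul_of_nonneg_right hw (norm_nonneg _)

theorem norm_fst_toH10_le [IsFiniteMeasure (volume.restrict Ω)] {M : ℝ}
    (hM : 0 ≤ M) (hM0 : ∀ x, |φ x| ≤ M) (s : ℝ) {b : ℂ} {θ : Space d}
    (ht : IsTest Ω (φ * planeWave θ b)) :
    ‖((s • ht.toH10 : H10 Ω) : L2Pair Ω).fst‖ ≤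
      |s| * (measureUnivNNReal (volume.restrict Ω) ^ ((2 : ℝ≥0∞).toReal⁻¹) * (M * ‖b‖)) := by
  have h0 : ((s • ht.toH10 : H10 Ω) : L2Pair Ω).fst = s • ht.memLp.toLp := rfl
  rw [h0, norm_smul, Real.norm_eq_abs]
  refine mul_le_mul_of_nonneg_left (Lp.norm_le_of_ae_bound (by positivity) ?_) (abs_nonneg _)
  filter_upwards [ht.memLp.coeFn_toLp] with x hx
  rw [hx, Pi.mul_apply, norm_mul]
  exact mul_le_mul (hM0 x) (abs_planeWave_le _ _ _) (norm_nonneg _) hM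

/-- Weak convergence to zero in `H¹₀`, checked on the two components. -/
theorem tendsto_dual_zero {r : ι → H10 Ω} {w : ι → Lp (Space d) 2 (volume.restrict Ω)}
    (h₁ : Tendsto (fun e => (r e : L2Pair Ω).fst) l (𝓝 0))
    (h₂ : Tendsto (fun e => grad (r e) - w e) l (𝓝 0))
    (h₃ : ∀ g, Tendsto (fun e => inner ℝ g (w e)) l (𝓝 0)) (f : HNegOne Ω) :
    Tendsto (fun e => f (r e)) l (𝓝 0) := by
  obtain ⟨p, hp⟩ : ∃ p : H10 Ω, ∀ v, inner ℝ p v = f v :=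
    ⟨(InnerProductSpace.toDual ℝ (H10 Ω)).symm f, fun v => InnerProductSpace.toDual_symm_apply⟩
  have hsplit : ∀ e, inner ℝ (p : L2Pair Ω).fst (r e : L2Pair Ω).fst +
      (inner ℝ (grad p) (grad (r e) - w e) + inner ℝ (grad p) (w e)) = f (r e) := by
    intro e
    rw [← hp, Submodule.coe_inner, WithLp.prod_inner_apply, ← inner_add_right, sub_add_cancel]
    rfl
  have t2 := (tendsto_const_nhds (x := (p : L2Pair Ω).fst)).inner (𝕜 := ℝ) h₁
  have t3 := (tendsto_const_nhds (x := grad p)).inner (𝕜 := ℝ) h₂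
  rw [inner_zero_right] at t2 t3
  have t5 := t2.add (t3.add (h₃ (grad p)))
  rw [add_zero, add_zero] at t5
  exact t5.congr hsplit

theorem exists_potential_wave [IsFiniteMeasure (volume.restrict Ω)] (hΩ : MeasurableSet Ω)
    (hφ : IsTest Ω φ) {k : I → ℤ} (hk : k ≠ 0) (b : ℂ) :
    ∃ r : ι → H10 Ω, (∀ f : HNegOne Ω, Tendsto (fun e => f (r e)) l (𝓝 0)) ∧
      Tendsto (fun e => grad (r e) - o.eval Ω e (hφ.tensor (wave k b (o.dir k)))) l (𝓝 0) := by
  have ht : ∀ e, IsTest Ω (φ * planeWave (o.freq e k) (b / (2 * Real.pi * Complex.I))) := fun e =>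
    hφ.mul_smooth (contDiff_planeWave _ _)
  obtain ⟨M, hM, hM0, hM1, -⟩ := hφ.exists_bound
  have hsc : Tendsto (fun e => |o.scale e k|) l (𝓝 0) := by
    simpa using (o.scale_tendsto k hk).abs
  have hd : Tendsto (fun e => ‖o.scale e k • o.freq e k - o.dir k‖) l (𝓝 0) := by
    simpa using ((o.scale_smul_freq k hk).sub_const (o.dir k)).norm
  have hgr : Tendsto (fun e => grad (o.scale e k • (ht e).toH10) -
      o.eval Ω e (hφ.tensor (wave k b (o.dir k)))) l (𝓝 0) := by
    refine squeeze_zero_norm (fun e => o.norm_grad_sub_eval_le hφ hM hM0 hM1 k b e (ht e)) ?_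
    have h := ((hsc.mul_const (‖b / (2 * Real.pi * Complex.I)‖ * M)).add
      ((hd.const_mul ‖b‖).const_mul M)).const_mul
      (measureUnivNNReal (volume.restrict Ω) ^ ((2 : ℝ≥0∞).toReal⁻¹) : ℝ)
    simpa only [zero_mul, mul_zero, add_zero] using h
  have hf : Tendsto (fun e => ((o.scale e k • (ht e).toH10 : H10 Ω) : L2Pair Ω).fst) l (𝓝 0) := by
    refine squeeze_zero_norm (fun e => norm_fst_toH10_le hM hM0 _ (ht e)) ?_
    simpa only [zero_mul] using hsc.mul_const _
  exact ⟨fun e => o.scale e k • (ht e).toH10, fun f => tendsto_dual_zero hf hgr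
    (fun g => o.tendsto_inner_eval_wave hΩ hφ hk b (o.dir k) g) f, hgr⟩

/-- Potential waves are, up to a strongly vanishing error, gradients of functions that vanish
weakly in `H¹₀`. -/
theorem exists_potential [IsFiniteMeasure (volume.restrict Ω)] (hΩ : MeasurableSet Ω)
    (hφ : IsTest Ω φ) {v : C(UnitAddTorus I, Space d)} (hv : v ∈ potentialWaves o.dir) :
    ∃ r : ι → H10 Ω, (∀ f : HNegOne Ω, Tendsto (fun e => f (r e)) l (𝓝 0)) ∧
      Tendsto (fun e => grad (r e) - o.eval Ω e (hφ.tensor v)) l (𝓝 0) := by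
  have hzero : ∃ r : ι → H10 Ω, (∀ f : HNegOne Ω, Tendsto (fun e => f (r e)) l (𝓝 0)) ∧
      Tendsto (fun e => grad (r e) -
        o.eval Ω e (hφ.tensor (0 : C(UnitAddTorus I, Space d)))) l (𝓝 0) := by
    refine ⟨fun _ => 0, fun f => ?_, ?_⟩
    · simp only [map_zero]
      exact tendsto_const_nhds
    · simp only [grad_zero, map_zero, sub_zero]
      exact tendsto_const_nhds
  refine Submodule.span_induction ?_ hzero ?_ ?_ hv
  · rintro _ ⟨k, b, rfl⟩
    by_cases hk : k = 0
    · have hw : (wave k b (o.dir k) : C(UnitAddTorus I, Space d)) = 0 := by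
        ext1 t
        simp [wave_apply, hk, o.dir_zero]
      rw [hw]
      exact hzero
    · exact o.exists_potential_wave hΩ hφ hk b
  · rintro v w _ _ ⟨r, hr, hr'⟩ ⟨q, hq, hq'⟩
    refine ⟨fun e => r e + q e, fun f => ?_, ?_⟩
    · simp only [map_add]
      simpa only [add_zero] using (hr f).add (hq f)
    · have h := hr'.add hq'
      rw [add_zero] at h
      refine h.congr fun e => ?_
      rw [grad_add, map_add, map_add]
      abel
  · rintro a v _ ⟨r, hr, hr'⟩
    refine ⟨fun e => a • r e, fun f => ?_, ?_⟩
    · simp only [map_smul, smul_eq_mul]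
      simpa only [mul_zero] using (hr f).const_mul a
    · have h := hr'.const_smul a
      rw [smul_zero] at h
      refine h.congr fun e => ?_
      rw [grad_smul, map_smul, map_smul, smul_sub]

end Oscillation

/-! ### Approximation of two-scale fields -/

section TwoScaleApprox

variable {I : Type*} [Fintype I] {d : ℕ} {ι : Type*} {l : Filter ι} (o : Oscillation I d l)
  {Ω : Set (Space d)}

theorem ae_toTorusL2_sum_tensor {J : Type*} [Fintype J] {φ : J → Space d → ℝ}
    (hφ : ∀ j, IsTest Ω (φ j)) (v : J → C(UnitAddTorus I, Space d)) :
    ∀ᵐ x ∂(volume.restrict Ω), toTorusL2 I d ((∑ j, (hφ j).tensor (v j) : TwoScale I Ω) x) =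
      ∑ j, φ j x • toTorusL2 I d (v j) := by
  have h1 : ∀ᵐ x ∂(volume.restrict Ω), ∀ j, (hφ j).tensor (v j) x = φ j x • v j :=
    ae_all_iff.2 fun j => (hφ j).coeFn_tensor (v j)
  filter_upwards [h1, Lp.coeFn_finsetSum Finset.univ fun j => (hφ j).tensor (v j)] with x h1 h2
  rw [h2, Finset.sum_apply, map_sum]
  exact Finset.sum_congr rfl fun j _ => by rw [h1 j, map_smul]

namespace Oscillation

/-- Approximation of a potential field by oscillating gradients. -/
theorem exists_potential_approx [IsFiniteMeasure (volume.restrict Ω)] (hΩ : IsOpen Ω)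
    {Ψ : Space d → TorusL2 I d} (hc : Continuous Ψ) (hs : HasCompactSupport Ψ)
    (hsub : tsupport Ψ ⊆ Ω) (hmem : ∀ x, Ψ x ∈ potentialL2 o.dir) {η : ℝ} (hη : 0 < η) :
    ∃ V : TwoScale I Ω, (∀ᵐ x ∂(volume.restrict Ω), ‖Ψ x - toTorusL2 I d (V x)‖ ≤ η) ∧
      ∃ r : ι → H10 Ω, (∀ f : HNegOne Ω, Tendsto (fun e => f (r e)) l (𝓝 0)) ∧
        Tendsto (fun e => grad (r e) - o.eval Ω e V) l (𝓝 0) := by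
  obtain ⟨J, φ, D, hφ, hD, happ⟩ := exists_smooth_approx hΩ _ hc hs hsub hmem hη
  choose v hv hvD using hD
  choose r hr hr' using fun j => o.exists_potential hΩ.measurableSet (hφ j) (hv j)
  refine ⟨∑ j, (hφ j).tensor (v j), ?_, fun e => ∑ j, r j e, fun f => ?_, ?_⟩
  · filter_upwards [ae_toTorusL2_sum_tensor hφ v] with x hx
    rw [hx]
    refine le_trans (le_of_eq ?_) (happ x)
    congr 2
    exact Finset.sum_congr rfl fun j _ => by rw [← hvD j]; rfl
  · simp only [map_sum]
    simpa using tendsto_finsetSum Finset.univ fun j _ => hr j f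
  · have h := tendsto_finsetSum Finset.univ fun j (_ : j ∈ Finset.univ) => hr' j
    rw [Finset.sum_const_zero] at h
    refine h.congr fun e => ?_
    have h0 : grad (∑ j, r j e) = ∑ j, grad (r j e) := map_sum (gradL Ω) _ _
    rw [h0, map_sum, Finset.sum_sub_distrib]

/-- Approximation of a solenoidal field by oscillating fields that act on gradients by
their mean. -/
theorem exists_solenoidal_approx [IsFiniteMeasure (volume.restrict Ω)] (hΩ : IsOpen Ω)
    {Ψ : Space d → TorusL2 I d} (hc : Continuous Ψ) (hs : HasCompactSupport Ψ)
    (hsub : tsupport Ψ ⊆ Ω) (hmem : ∀ x, Ψ x ∈ solenoidalL2 o.dir) {η : ℝ} (hη : 0 < η) :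
    ∃ G : TwoScale I Ω, (∀ᵐ x ∂(volume.restrict Ω), ‖Ψ x - toTorusL2 I d (G x)‖ ≤ η) ∧
      ∀ (u : ι → H10 Ω) (R : ℝ), (∀ e, ‖u e‖ ≤ R) →
        Tendsto (fun e => inner ℝ (o.eval Ω e G - average Ω G) (grad (u e))) l (𝓝 0) := by
  obtain ⟨J, φ, D, hφ, hD, happ⟩ := exists_smooth_approx hΩ _ hc hs hsub hmem hη
  choose v hv hvD using hD
  refine ⟨∑ j, (hφ j).tensor (v j), ?_, fun u R hu => ?_⟩
  · filter_upwards [ae_toTorusL2_sum_tensor hφ v] with x hx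
    rw [hx]
    refine le_trans (le_of_eq ?_) (happ x)
    congr 2
    exact Finset.sum_congr rfl fun j _ => by rw [← hvD j]; rfl
  · have h := tendsto_finsetSum Finset.univ fun j (_ : j ∈ Finset.univ) =>
      o.tendsto_inner_solenoidal (hφ j) hu (hv j)
    rw [Finset.sum_const_zero] at h
    refine h.congr fun e => ?_
    rw [← sum_inner, Finset.sum_sub_distrib, map_sum, map_sum]

end Oscillation

end TwoScaleApprox

/-! ### Matrix fields on the torus -/

section TorusOp

variable {I : Type*} [Fintype I] {d : ℕ}

theorem memLp_top_torus (b : C(UnitAddTorus I, Space d →L[ℝ] Space d)) :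
    MemLp b ∞ (torusMeasure I) :=
  memLp_top_of_bound b.continuous.aestronglyMeasurable ‖b‖
    (Eventually.of_forall fun t => b.norm_coe_le_norm t)

/-- Multiplication by a continuous matrix field on the torus. -/
def torusOp (b : C(UnitAddTorus I, Space d →L[ℝ] Space d)) : TorusL2 I d →L[ℝ] TorusL2 I d :=
  mulOp b (memLp_top_torus b)

theorem elliptic_torusOp {α β : ℝ} {b : C(UnitAddTorus I, Space d →L[ℝ] Space d)}
    (hb : ∀ t, Elliptic α β (b t)) : Elliptic α β (torusOp b) :=
  elliptic_mulOp _ (Eventually.of_forall hb)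

theorem norm_torusOp_sub_le (b b' : C(UnitAddTorus I, Space d →L[ℝ] Space d)) :
    ‖torusOp b - torusOp b'‖ ≤ ‖b - b'‖ :=
  norm_mulOp_sub_le _ _ (norm_nonneg (b - b'))
    (Eventually.of_forall fun t => (b - b').norm_coe_le_norm t)

/-- The pointwise product of a matrix field and a vector field. -/
def applyC {I : Type*} (b : C(UnitAddTorus I, Space d →L[ℝ] Space d))
    (f : C(UnitAddTorus I, Space d)) : C(UnitAddTorus I, Space d) :=
  ⟨fun t => b t (f t), b.continuous.clm_apply f.continuous⟩

theorem torusOp_toTorusL2 (b : C(UnitAddTorus I, Space d →L[ℝ] Space d))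
    (f : C(UnitAddTorus I, Space d)) :
    torusOp b (toTorusL2 I d f) = toTorusL2 I d (applyC b f) := by
  refine Lp.ext ?_
  filter_upwards [coeFn_mulOp (memLp_top_torus b) (toTorusL2 I d f), coeFn_toTorusL2 f,
    coeFn_toTorusL2 (applyC b f)] with t h1 h2 h3
  rw [h3]
  refine h1.trans ?_
  rw [h2]
  rfl

theorem norm_applyC_le {I : Type*} (b : C(UnitAddTorus I, Space d →L[ℝ] Space d))
    (f : C(UnitAddTorus I, Space d)) : ‖applyC b f‖ ≤ ‖b‖ * ‖f‖ := by
  rw [ContinuousMap.norm_le _ (by positivity)]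
  intro t
  refine ((b t).le_opNorm (f t)).trans ?_
  gcongr
  · exact b.norm_coe_le_norm t
  · exact f.norm_coe_le_norm t

theorem continuous_applyC {I : Type*} :
    Continuous fun p : C(UnitAddTorus I, Space d →L[ℝ] Space d) × C(UnitAddTorus I, Space d) =>
      applyC p.1 p.2 := by
  refine ContinuousMap.continuous_of_continuous_uncurry _ ?_
  change Continuous fun q : (C(UnitAddTorus I, Space d →L[ℝ] Space d) ×
    C(UnitAddTorus I, Space d)) × UnitAddTorus I => (q.1.1 q.2) (q.1.2 q.2)
  fun_prop

variable {Ω : Set (Space d)}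

theorem memLp_applyC {b : Space d → C(UnitAddTorus I, Space d →L[ℝ] Space d)}
    (hbm : AEStronglyMeasurable b (volume.restrict Ω)) {C : ℝ} (hb : ∀ x, ‖b x‖ ≤ C)
    (F : TwoScale I Ω) : MemLp (fun x => applyC (b x) (F x)) 2 (volume.restrict Ω) := by
  refine (Lp.memLp F).of_le_mul (c := C) (continuous_applyC.comp_aestronglyMeasurable
    (hbm.prodMk (Lp.aestronglyMeasurable F))) (Eventually.of_forall fun x => ?_)
  exact (norm_applyC_le _ _).trans (mul_le_mul_of_nonneg_right (hb x) (norm_nonneg _))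

end TorusOp

/-! ### The effective matrix field -/

section EffectiveField

variable {I : Type*} [Fintype I] {d : ℕ} {α β : ℝ}
  {b : Space d → C(UnitAddTorus I, Space d →L[ℝ] Space d)}

/-- The corrector of the constant field `ξ` at `x`. -/
def correctorField (hb : ∀ x t, Elliptic α β (b x t)) (hα : 0 < α) (ζ : (I → ℤ) → Space d)
    (ξ : Space d) (x : Space d) : TorusL2 I d :=
  (elliptic_torusOp (hb x)).corrector hα (potentialL2 ζ) (constTorusL2 I d ξ)

/-- The effective matrix at `x`. -/
def effectiveField (hb : ∀ x t, Elliptic α β (b x t)) (hα : 0 < α) (ζ : (I → ℤ) → Space d)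
    (x : Space d) : Space d →L[ℝ] Space d :=
  (elliptic_torusOp (hb x)).effective hα (potentialL2 ζ) (constTorusL2 I d)

/-- The corrected flux of the constant field `ξ` at `x`. -/
def fluxField (hb : ∀ x t, Elliptic α β (b x t)) (hα : 0 < α) (ζ : (I → ℤ) → Space d)
    (ξ : Space d) (x : Space d) : TorusL2 I d :=
  torusOp (b x) (constTorusL2 I d ξ + correctorField hb hα ζ ξ x)

theorem continuousOn_of_norm_sub_le {X E F : Type*} [TopologicalSpace X]
    [SeminormedAddCommGroup E] [SeminormedAddCommGroup F] {f : X → E} {g : X → F} {C : ℝ}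
    (h : ∀ x y, ‖f x - f y‖ ≤ C * ‖g x - g y‖) {s : Set X} (hg : ContinuousOn g s) :
    ContinuousOn f s := by
  intro x hx
  refine tendsto_iff_norm_sub_tendsto_zero.2 (squeeze_zero (fun _ => norm_nonneg _)
    (fun y => h y x) ?_)
  simpa using (tendsto_iff_norm_sub_tendsto_zero.1 (hg x hx)).const_mul C

variable (hb : ∀ x t, Elliptic α β (b x t)) (hα : 0 < α) (ζ : (I → ℤ) → Space d)
  {Ω : Set (Space d)}

theorem norm_effectiveField_sub_le (hβ : 0 < β) (x y : Space d) :
    ‖effectiveField hb hα ζ x - effectiveField hb hα ζ y‖ ≤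
      (1 + β / α) * (1 + β / α) * ‖b x - b y‖ := by
  refine (Elliptic.norm_effective_sub_le _ _ hα hβ _ norm_constTorusL2).trans ?_
  exact mul_le_mul_of_nonneg_left (norm_torusOp_sub_le _ _) (by positivity)

theorem elliptic_effectiveField (hζ : ∀ k, ζ (-k) = -ζ k) (x : Space d) :
    Elliptic α β (effectiveField hb hα ζ x) :=
  Elliptic.elliptic_effective _ hα _ norm_constTorusL2 (inner_constTorusL2_potential ζ hζ)

theorem continuousOn_correctorField (hβ : 0 < β) (hbc : ContinuousOn b Ω) (ξ : Space d) :
    ContinuousOn (correctorField hb hα ζ ξ) Ω := by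
  refine continuousOn_of_norm_sub_le (F := C(UnitAddTorus I, Space d →L[ℝ] Space d)) (g := b)
    (C := (1 + β / α) / α * ‖ξ‖) (fun x y => ?_) hbc
  refine (Elliptic.norm_corrector_sub_le (elliptic_torusOp (hb x)) (elliptic_torusOp (hb y))
    hα hβ _).trans ?_
  rw [norm_constTorusL2]
  have h := norm_torusOp_sub_le (b x) (b y)
  calc (1 + β / α) / α * ‖torusOp (b x) - torusOp (b y)‖ * ‖ξ‖
      ≤ (1 + β / α) / α * ‖b x - b y‖ * ‖ξ‖ := by gcongr
    _ = _ := by ring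

theorem continuousOn_fluxField (hβ : 0 < β) (hbc : ContinuousOn b Ω) (ξ : Space d) :
    ContinuousOn (fluxField hb hα ζ ξ) Ω := by
  have h1 : ContinuousOn (fun x => torusOp (b x)) Ω :=
    continuousOn_of_norm_sub_le (F := C(UnitAddTorus I, Space d →L[ℝ] Space d)) (g := b) (C := 1)
      (fun x y => by simpa using norm_torusOp_sub_le (b x) (b y)) hbc
  exact h1.clm_apply (continuousOn_const.add (continuousOn_correctorField hb hα ζ hβ hbc ξ))

theorem correctorField_mem (ξ x : Space d) : correctorField hb hα ζ ξ x ∈ potentialL2 ζ :=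
  Elliptic.corrector_mem _ hα _

theorem fluxField_mem (hζ : ∀ k, ζ (-k) = -ζ k) (ξ x : Space d) :
    fluxField hb hα ζ ξ x ∈ solenoidalL2 ζ :=
  mem_solenoidalL2 ζ hζ fun _ hv => Elliptic.inner_corrector _ hα _ hv

theorem adjoint_fluxField (ξ x : Space d) :
    ContinuousLinearMap.adjoint (constTorusL2 I d) (fluxField hb hα ζ ξ x) =
      effectiveField hb hα ζ x ξ := rfl

theorem norm_field_le {I : Type*} {b : Space d → C(UnitAddTorus I, Space d →L[ℝ] Space d)}
    (hb : ∀ x t, Elliptic α β (b x t)) (hβ : 0 < β) (x : Space d) : ‖b x‖ ≤ β := by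
  rw [ContinuousMap.norm_le _ hβ.le]
  exact fun t => (hb x t).norm_le hβ

end EffectiveField

/-! ### Convergence of fluxes against test fields -/

section Key

variable {I : Type*} [Fintype I] {d : ℕ} {ι : Type*} {l : Filter ι} (o : Oscillation I d l)
  {Ω : Set (Space d)} {α β : ℝ} {b : Space d → C(UnitAddTorus I, Space d →L[ℝ] Space d)}

theorem tendsto_zero_of_forall_eventually_le {D : ι → ℝ} (K : ℝ)
    (h : ∀ η : ℝ, 0 < η → ∀ᶠ e in l, |D e| ≤ K * η) : Tendsto D l (𝓝 0) := by
  rw [Metric.tendsto_nhds]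
  intro ε hε
  filter_upwards [h (ε / (2 * (|K| + 1))) (by positivity)] with e he
  rw [Real.dist_eq, sub_zero]
  refine he.trans_lt ?_
  calc K * (ε / (2 * (|K| + 1))) ≤ (|K| + 1) * (ε / (2 * (|K| + 1))) := by
        gcongr; linarith [le_abs_self K]
    _ = ε / 2 := by field_simp
    _ < ε := by linarith

theorem continuous_smul_of_isTest {H : Type*} [NormedAddCommGroup H] [NormedSpace ℝ H]
    (hΩ : IsOpen Ω) {φ : Space d → ℝ} (hφ : IsTest Ω φ) {g : Space d → H}
    (hg : ContinuousOn g Ω) :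
    Continuous (fun x => φ x • g x) ∧ HasCompactSupport (fun x => φ x • g x) ∧
      tsupport (fun x => φ x • g x) ⊆ Ω := by
  have hsub : tsupport (fun x => φ x • g x) ⊆ tsupport φ :=
    closure_mono fun x hx => by
      contrapose! hx
      simp only [Function.mem_support, not_not] at hx ⊢
      rw [hx, zero_smul]
  refine ⟨continuous_of_tsupport fun x hx => ?_, hφ.compact.smul_right, hsub.trans hφ.subset⟩
  exact hφ.continuous.continuousAt.smul (hg.continuousAt (hΩ.mem_nhds (hφ.subset (hsub hx))))

/-- The oscillating matrix field `x ↦ b x (point e x)`. -/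
def Oscillation.field (b : Space d → C(UnitAddTorus I, Space d →L[ℝ] Space d)) (e : ι)
    (x : Space d) : Space d →L[ℝ] Space d :=
  b x (o.point e x)

theorem Oscillation.memLp_field (hb : ∀ x t, Elliptic α β (b x t)) (hβ : 0 < β)
    (hbm : AEStronglyMeasurable b (volume.restrict Ω)) (e : ι) :
    MemLp (o.field b e) ∞ (volume.restrict Ω) :=
  memLp_top_of_bound (o.aestronglyMeasurable_eval hbm e) β
    (Eventually.of_forall fun x => (hb x _).norm_le hβ)

theorem Oscillation.mulOp_field_eval (hb : ∀ x t, Elliptic α β (b x t)) (hβ : 0 < β)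
    (hbm : AEStronglyMeasurable b (volume.restrict Ω)) (e : ι) (F : TwoScale I Ω) :
    mulOp (o.field b e) (o.memLp_field hb hβ hbm e) (o.eval Ω e F) =
      o.eval Ω e (memLp_applyC hbm (norm_field_le hb hβ) F).toLp := by
  refine Lp.ext ?_
  filter_upwards [coeFn_mulOp (o.memLp_field hb hβ hbm e) (o.eval Ω e F), o.coeFn_eval e F,
    o.coeFn_eval e (memLp_applyC hbm (norm_field_le hb hβ) F).toLp,
    (memLp_applyC hbm (norm_field_le hb hβ) F).coeFn_toLp] with x h1 h2 h3 h4
  rw [h1, h2, h3, h4]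
  rfl

theorem Oscillation.eval_tensor_const {φ : Space d → ℝ} (hφ : IsTest Ω φ) (ξ : Space d) (e : ι) :
    o.eval Ω e (hφ.tensor (ContinuousMap.const _ ξ)) = (hφ.memLp_smul_const ξ).toLp := by
  refine Lp.ext ?_
  filter_upwards [o.coeFn_eval_tensor hφ (ContinuousMap.const _ ξ) e,
    (hφ.memLp_smul_const ξ).coeFn_toLp] with x h1 h2
  rw [h1, h2]
  rfl

theorem Oscillation.eventually_norm_eval_le [IsFiniteMeasure (volume.restrict Ω)]
    (hΩ : MeasurableSet Ω) {F : TwoScale I Ω} {κ η : ℝ} (hη : 0 < η)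
    (hF : ∀ᵐ x ∂(volume.restrict Ω), ‖toTorusL2 I d (F x)‖ ≤ κ * η) :
    ∀ᶠ e in l, ‖o.eval Ω e F‖ ≤ Real.sqrt (κ ^ 2 * volume.real Ω + 1) * η := by
  have h1 := o.tendsto_norm_eval hΩ F
  have h2 : ∫ x in Ω, ‖toTorusL2 I d (F x)‖ ^ 2 ≤ κ ^ 2 * volume.real Ω * η ^ 2 := by
    have h3 : ∫ x in Ω, ‖toTorusL2 I d (F x)‖ ^ 2 ≤ ∫ _ in Ω, (κ * η) ^ 2 := by
      refine integral_mono_of_nonneg (Eventually.of_forall fun x => by positivity)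
        (integrable_const _) ?_
      filter_upwards [hF] with x hx
      exact pow_le_pow_left₀ (norm_nonneg _) hx 2
    refine h3.trans (le_of_eq ?_)
    rw [setIntegral_const, smul_eq_mul]
    ring
  have h4 : ∫ x in Ω, ‖toTorusL2 I d (F x)‖ ^ 2 < (κ ^ 2 * volume.real Ω + 1) * η ^ 2 := by
    have : 0 < η ^ 2 := by positivity
    linarith
  filter_upwards [h1.eventually (gt_mem_nhds h4)] with e he
  have h5 := Real.sqrt_le_sqrt he.le
  rwa [Real.sqrt_sq (norm_nonneg _), Real.sqrt_mul (by positivity), Real.sqrt_sq hη.le] at h5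

theorem ae_norm_flux_sub_le (hb : ∀ x t, Elliptic α β (b x t)) (hα : 0 < α) (hβ : 0 < β)
    (hbm : AEStronglyMeasurable b (volume.restrict Ω)) (ζ : (I → ℤ) → Space d)
    {φ : Space d → ℝ} (hφ : IsTest Ω φ) (ξ : Space d) {η : ℝ} {V G : TwoScale I Ω}
    (hV : ∀ᵐ x ∂(volume.restrict Ω),
      ‖φ x • correctorField hb hα ζ ξ x - toTorusL2 I d (V x)‖ ≤ η)
    (hG : ∀ᵐ x ∂(volume.restrict Ω), ‖φ x • fluxField hb hα ζ ξ x - toTorusL2 I d (G x)‖ ≤ η) :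
    ∀ᵐ x ∂(volume.restrict Ω), ‖toTorusL2 I d (((memLp_applyC hbm (norm_field_le hb hβ)
      (hφ.tensor (ContinuousMap.const _ ξ) + V)).toLp - G : TwoScale I Ω) x)‖ ≤ (β + 1) * η := by
  filter_upwards [hV, hG, (memLp_applyC hbm (norm_field_le hb hβ)
      (hφ.tensor (ContinuousMap.const _ ξ) + V)).coeFn_toLp,
    Lp.coeFn_add (hφ.tensor (ContinuousMap.const _ ξ)) V,
    hφ.coeFn_tensor (ContinuousMap.const (UnitAddTorus I) ξ),
    Lp.coeFn_sub (memLp_applyC hbm (norm_field_le hb hβ)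
      (hφ.tensor (ContinuousMap.const _ ξ) + V)).toLp G] with x h1 h2 h3 h4 h5 h6
  have e2 : toTorusL2 I d (((memLp_applyC hbm (norm_field_le hb hβ)
      (hφ.tensor (ContinuousMap.const _ ξ) + V)).toLp - G : TwoScale I Ω) x) =
      (φ x • fluxField hb hα ζ ξ x - toTorusL2 I d (G x)) -
      torusOp (b x) (φ x • correctorField hb hα ζ ξ x - toTorusL2 I d (V x)) := by
    rw [h6, Pi.sub_apply, map_sub, h3, ← torusOp_toTorusL2, h4, Pi.add_apply, h5, map_add,
      map_smul, ← constTorusL2_eq, fluxField, map_add, map_sub, map_add, map_smul, map_smul,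
      smul_add]
    abel
  rw [e2]
  refine (norm_sub_le _ _).trans ?_
  have h7 := (elliptic_torusOp (hb x)).norm_apply_le hβ
    (φ x • correctorField hb hα ζ ξ x - toTorusL2 I d (V x))
  have h8 := mul_le_mul_of_nonneg_left h1 hβ.le
  linarith

theorem norm_average_sub_le [IsFiniteMeasure (volume.restrict Ω)]
    (hb : ∀ x t, Elliptic α β (b x t)) (hα : 0 < α) (ζ : (I → ℤ) → Space d)
    (hH : MemLp (effectiveField hb hα ζ) ∞ (volume.restrict Ω))
    {φ : Space d → ℝ} (hφ : IsTest Ω φ) (ξ : Space d) {η : ℝ} (hη : 0 < η) {G : TwoScale I Ω}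
    (hG : ∀ᵐ x ∂(volume.restrict Ω), ‖φ x • fluxField hb hα ζ ξ x - toTorusL2 I d (G x)‖ ≤ η) :
    ‖average Ω G - mulOp (effectiveField hb hα ζ) hH (hφ.memLp_smul_const ξ).toLp‖ ≤
      measureUnivNNReal (volume.restrict Ω) ^ ((2 : ℝ≥0∞).toReal⁻¹) * η := by
  refine Lp.norm_le_of_ae_bound hη.le ?_
  filter_upwards [hG, coeFn_average G, Lp.coeFn_sub (average Ω G)
    (mulOp (effectiveField hb hα ζ) hH (hφ.memLp_smul_const ξ).toLp),
    coeFn_mulOp hH (hφ.memLp_smul_const ξ).toLp,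
    (hφ.memLp_smul_const ξ).coeFn_toLp] with x h1 h2 h3 h4 h5
  have hn : ‖ContinuousLinearMap.adjoint (constTorusL2 I d)‖ ≤ 1 := by
    rw [LinearIsometryEquiv.norm_map]
    exact ContinuousLinearMap.opNorm_le_bound _ zero_le_one fun x => by
      rw [norm_constTorusL2, one_mul]
  rw [h3, Pi.sub_apply, h2, h4, h5, map_smul, ← adjoint_fluxField, ← map_smul, ← map_sub]
  refine (ContinuousLinearMap.le_of_opNorm_le _ hn _).trans ?_
  rw [one_mul, norm_sub_rev]
  exact h1

theorem eventually_abs_inner_le {X T : Type*} [NormedAddCommGroup X] [InnerProductSpace ℝ X]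
    [NormedAddCommGroup T] [NormedSpace ℝ T] {a q : ι → X} {A : ι → X →L[ℝ] X}
    {S : ι → T →L[ℝ] X} {F G V : T} {g h m : X} {s : ι → ℝ} {R β K W η : ℝ} (hη : 0 < η)
    (hR : 0 ≤ R) (ha : ∀ e, ‖a e‖ ≤ R) (hA : ∀ e, ‖A e‖ ≤ β)
    (hF : ∀ e, A e (g + S e V) = S e F) (hq : ∀ e, inner ℝ (a e) (A e (q e)) = s e)
    (hs : Tendsto s l (𝓝 0)) (hqV : Tendsto (fun e => q e - S e V) l (𝓝 0))
    (hG : Tendsto (fun e => inner ℝ (S e G - m) (a e)) l (𝓝 0))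
    (hFG : ∀ᶠ e in l, ‖S e (F - G)‖ ≤ K * η) (hm : ‖m - h‖ ≤ W * η) :
    ∀ᶠ e in l, |inner ℝ (a e) (A e g - h)| ≤ (R * K + R * W + 3) * η := by
  have t1 : ∀ᶠ e in l, |inner ℝ (a e) (A e (q e - S e V))| ≤ η := by
    have h1 : Tendsto (fun e => R * (β * ‖q e - S e V‖)) l (𝓝 0) := by
      simpa using (hqV.norm.const_mul β).const_mul R
    filter_upwards [h1.eventually (gt_mem_nhds hη)] with e he
    refine (abs_real_inner_le_norm _ _).trans (le_trans ?_ he.le)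
    exact mul_le_mul (ha e) (ContinuousLinearMap.le_of_opNorm_le _ (hA e) _) (norm_nonneg _) hR
  have t2 : ∀ᶠ e in l, |s e| ≤ η := by
    have h1 := hs.abs
    rw [abs_zero] at h1
    filter_upwards [h1.eventually (gt_mem_nhds hη)] with e he using he.le
  have t3 : ∀ᶠ e in l, |inner ℝ (S e G - m) (a e)| ≤ η := by
    have h1 := hG.abs
    rw [abs_zero] at h1
    filter_upwards [h1.eventually (gt_mem_nhds hη)] with e he using he.le
  filter_upwards [t1, t2, t3, hFG] with e h1 h2 h3 h4
  have hsplit : inner ℝ (a e) (A e g - h) =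
      inner ℝ (a e) (S e (F - G)) + inner ℝ (S e G - m) (a e) + inner ℝ (a e) (m - h) +
      inner ℝ (a e) (A e (q e - S e V)) - s e := by
    have h0 : A e g = S e F - A e (S e V) := by rw [← hF e, map_add, add_sub_cancel_right]
    rw [← hq e, h0, real_inner_comm (a e) (S e G - m)]
    simp only [map_sub, inner_sub_right]
    ring
  rw [hsplit]
  have h5 : |inner ℝ (a e) (S e (F - G))| ≤ R * (K * η) :=
    (abs_real_inner_le_norm _ _).trans (mul_le_mul (ha e) h4 (norm_nonneg _) hR)
  have h6 : |inner ℝ (a e) (m - h)| ≤ R * (W * η) :=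
    (abs_real_inner_le_norm _ _).trans (mul_le_mul (ha e) hm (norm_nonneg _) hR)
  have e1 : (R * K + R * W + 3) * η = R * (K * η) + η + R * (W * η) + η + η := by ring
  rw [e1]
  refine (abs_sub _ _).trans (add_le_add ?_ h2)
  refine (abs_add_le _ _).trans (add_le_add ?_ h1)
  refine (abs_add_le _ _).trans (add_le_add ?_ h6)
  exact (abs_add_le _ _).trans (add_le_add h5 h3)

theorem Oscillation.exists_corrector_approx [IsFiniteMeasure (volume.restrict Ω)] (hΩ : IsOpen Ω)
    (hb : ∀ x t, Elliptic α β (b x t)) (hα : 0 < α) (hβ : 0 < β) (hbc : ContinuousOn b Ω)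
    {φ : Space d → ℝ} (hφ : IsTest Ω φ) (ξ : Space d) {η : ℝ} (hη : 0 < η) :
    ∃ V : TwoScale I Ω, (∀ᵐ x ∂(volume.restrict Ω),
        ‖φ x • correctorField hb hα o.dir ξ x - toTorusL2 I d (V x)‖ ≤ η) ∧
      ∃ r : ι → H10 Ω, (∀ f : HNegOne Ω, Tendsto (fun e => f (r e)) l (𝓝 0)) ∧
        Tendsto (fun e => grad (r e) - o.eval Ω e V) l (𝓝 0) := by
  have h := continuous_smul_of_isTest (H := TorusL2 I d) hΩ hφ
    (continuousOn_correctorField hb hα o.dir hβ hbc ξ)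
  exact o.exists_potential_approx (Ψ := fun x => φ x • correctorField hb hα o.dir ξ x) hΩ
    h.1 h.2.1 h.2.2 (fun x => Submodule.smul_mem _ _ (correctorField_mem hb hα o.dir ξ x)) hη

theorem Oscillation.exists_flux_approx [IsFiniteMeasure (volume.restrict Ω)] (hΩ : IsOpen Ω)
    (hb : ∀ x t, Elliptic α β (b x t)) (hα : 0 < α) (hβ : 0 < β) (hbc : ContinuousOn b Ω)
    {φ : Space d → ℝ} (hφ : IsTest Ω φ) (ξ : Space d) {η : ℝ} (hη : 0 < η) :
    ∃ G : TwoScale I Ω, (∀ᵐ x ∂(volume.restrict Ω),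
        ‖φ x • fluxField hb hα o.dir ξ x - toTorusL2 I d (G x)‖ ≤ η) ∧
      ∀ (u : ι → H10 Ω) (R : ℝ), (∀ e, ‖u e‖ ≤ R) →
        Tendsto (fun e => inner ℝ (o.eval Ω e G - average Ω G) (grad (u e))) l (𝓝 0) := by
  have h := continuous_smul_of_isTest (H := TorusL2 I d) hΩ hφ
    (continuousOn_fluxField hb hα o.dir hβ hbc ξ)
  exact o.exists_solenoidal_approx (Ψ := fun x => φ x • fluxField hb hα o.dir ξ x) hΩ
    h.1 h.2.1 h.2.2
    (fun x => Submodule.smul_mem _ _ (fluxField_mem hb hα o.dir o.dir_neg ξ x)) hη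

/-- For solutions, the oscillating flux and the effective flux agree in the limit on test fields.
The matrix field acts through its transpose `b`. -/
theorem Oscillation.tendsto_flux [IsFiniteMeasure (volume.restrict Ω)] (hΩ : IsOpen Ω)
    (hb : ∀ x t, Elliptic α β (b x t)) (hα : 0 < α) (hβ : 0 < β) (hbc : ContinuousOn b Ω)
    (hbm : AEStronglyMeasurable b (volume.restrict Ω))
    (hH : MemLp (effectiveField hb hα o.dir) ∞ (volume.restrict Ω))
    {f : HNegOne Ω} {u : ι → H10 Ω} {R : ℝ} (hR : 0 ≤ R) (hu : ∀ e, ‖u e‖ ≤ R)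
    (hsol : ∀ e v, inner ℝ (grad (u e))
      (mulOp (o.field b e) (o.memLp_field hb hβ hbm e) (grad v)) = f v)
    {φ : Space d → ℝ} (hφ : IsTest Ω φ) (ξ : Space d) :
    Tendsto (fun e => inner ℝ (grad (u e)) (mulOp (o.field b e) (o.memLp_field hb hβ hbm e)
        (hφ.memLp_smul_const ξ).toLp -
      mulOp (effectiveField hb hα o.dir) hH (hφ.memLp_smul_const ξ).toLp)) l (𝓝 0) := by
  refine tendsto_zero_of_forall_eventually_le
    (R * Real.sqrt ((β + 1) ^ 2 * volume.real Ω + 1) +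
      R * (measureUnivNNReal (volume.restrict Ω) ^ ((2 : ℝ≥0∞).toReal⁻¹) : ℝ) + 3)
    fun η hη => ?_
  obtain ⟨V, hV, r, hr, hr'⟩ := o.exists_corrector_approx hΩ hb hα hβ hbc hφ ξ hη
  obtain ⟨G, hG, hG'⟩ := o.exists_flux_approx hΩ hb hα hβ hbc hφ ξ hη
  refine eventually_abs_inner_le (V := V) (G := G) hη hR (fun e => (norm_grad_le _).trans (hu e))
    (fun e => (elliptic_mulOp _ (Eventually.of_forall fun x => hb x _)).norm_le hβ)
    (fun e => ?_) (fun e => hsol e (r e)) (hr f) hr' (hG' u R hu)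
    (o.eventually_norm_eval_le hΩ.measurableSet hη
      (ae_norm_flux_sub_le hb hα hβ hbm o.dir hφ ξ hV hG))
    (norm_average_sub_le hb hα o.dir hH hφ ξ hη hG)
  rw [← o.mulOp_field_eval hb hβ hbm e, map_add (o.eval Ω e), o.eval_tensor_const hφ ξ]

end Key

/-! ### Convergence of solutions and fluxes -/

section Convergence

variable {d : ℕ} {Ω : Set (Space d)}

/-- The fields `φ ξ` with `φ` a test function and `ξ` a constant vector. -/
def testFields (Ω : Set (Space d)) : Set (Lp (Space d) 2 (volume.restrict Ω)) :=
  {g | ∃ (φ : Space d → ℝ) (hφ : IsTest Ω φ) (ξ : Space d), g = (hφ.memLp_smul_const ξ).toLp}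

theorem eq_zero_of_inner_testFields [IsFiniteMeasure (volume.restrict Ω)] (hΩ : IsOpen Ω)
    {g : Lp (Space d) 2 (volume.restrict Ω)}
    (hg : ∀ h ∈ testFields Ω, inner ℝ h g = 0) : g = 0 := by
  have hi : Integrable g (volume.restrict Ω) :=
    (Lp.memLp g).integrable (by norm_num)
  have h0 : ∀ᵐ x, x ∈ Ω → g x = 0 := by
    refine hΩ.ae_eq_zero_of_integral_contDiff_smul_eq_zero
      (IntegrableOn.locallyIntegrableOn hi) fun φ h1 h2 h3 => ?_
    have hφ : IsTest Ω φ := ⟨h1, h2, h3⟩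
    have hint : Integrable (fun x => φ x • g x) (volume.restrict Ω) := by
      obtain ⟨C, hC⟩ := hφ.continuous.bounded_above_of_compact_support hφ.compact
      exact hi.bdd_smul C hφ.continuous.aestronglyMeasurable (Eventually.of_forall hC)
    have e1 : ∫ x, φ x • g x = ∫ x in Ω, φ x • g x := by
      refine (setIntegral_eq_integral_of_forall_compl_eq_zero fun x hx => ?_).symm
      rw [hφ.eq_zero_of_notMem hx, zero_smul]
    rw [e1]
    refine ext_inner_left ℝ fun ξ => ?_
    rw [← integral_inner hint, inner_zero_right, ← hg _ ⟨φ, hφ, ξ, rfl⟩, L2.inner_def]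
    refine integral_congr_ae ?_
    filter_upwards [(hφ.memLp_smul_const (Ω := Ω) ξ).coeFn_toLp] with x hx
    rw [hx, inner_smul_left, inner_smul_right]
    simp
  refine Lp.ext ?_
  filter_upwards [(ae_restrict_iff' hΩ.measurableSet).2 h0, Lp.coeFn_zero (Space d) 2
    (volume.restrict Ω)] with x h1 h2
  rw [h1, h2, Pi.zero_apply]

theorem dense_span_testFields [IsFiniteMeasure (volume.restrict Ω)] (hΩ : IsOpen Ω) :
    (Submodule.span ℝ (testFields Ω)).topologicalClosure = ⊤ := by
  rw [Submodule.topologicalClosure_eq_top_iff, Submodule.eq_bot_iff]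
  intro g hg
  exact eq_zero_of_inner_testFields hΩ fun h hh =>
    (Submodule.mem_orthogonal _ _).1 hg h (Submodule.subset_span hh)

/-- A uniformly bounded family of functionals that tends to `0` on a set of dense span tends to
`0` everywhere. -/
theorem tendsto_inner_of_span {ι H : Type*} {l : Filter ι} [NormedAddCommGroup H]
    [InnerProductSpace ℝ H] {S : Set H} (hS : (Submodule.span ℝ S).topologicalClosure = ⊤)
    {w : ι → H} {T : ι → H →L[ℝ] H} {R C : ℝ} (hR : 0 ≤ R) (hC : 0 ≤ C) (hw : ∀ e, ‖w e‖ ≤ R)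
    (hT : ∀ e, ‖T e‖ ≤ C) (h : ∀ g ∈ S, Tendsto (fun e => inner ℝ (w e) (T e g)) l (𝓝 0)) (g : H) :
    Tendsto (fun e => inner ℝ (w e) (T e g)) l (𝓝 0) := by
  have hcl := isClosed_setOf_tendsto (l := l) (fun e g => inner ℝ (w e) (T e g))
    (fun _ => (0 : ℝ)) (C := R * C) (by positivity) (fun e f g => ?_) (fun f g => ?_)
  · have hg : g ∈ (Submodule.span ℝ S).topologicalClosure := by rw [hS]; trivial
    refine closure_minimal (fun f hf => ?_) hcl hg
    refine Submodule.span_induction (fun f hf => h f hf) ?_ (fun x y _ _ hx hy => ?_)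
      (fun c x _ hx => ?_) hf
    · simpa using tendsto_const_nhds
    · simpa [inner_add_right] using Tendsto.add hx hy
    · simpa [inner_smul_right] using Tendsto.const_mul c hx
  · rw [← inner_sub_right, ← map_sub, mul_assoc]
    refine (norm_inner_le_norm _ _).trans (mul_le_mul (hw e) ?_ (norm_nonneg _) hR)
    exact ((T e).le_opNorm _).trans (mul_le_mul_of_nonneg_right (hT e) (norm_nonneg _))
  · rw [sub_self, norm_zero]
    positivity

/-- Convergence of solutions and fluxes, given that the oscillating and the effective fluxes agree
in the limit on test fields. The operators `T e` and `H` are the transposed ones. -/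
theorem exists_tendsto_of_tendsto_flux [IsFiniteMeasure (volume.restrict Ω)] (hΩ : IsOpen Ω)
    {ι : Type*} {l : Filter ι} {α β C : ℝ} (hα : 0 < α) (hβ : 0 < β) (hC : 0 < C)
    (hP : ∀ u : H10 Ω, ‖u‖ ^ 2 ≤ C * ‖grad u‖ ^ 2)
    {T : ι → Lp (Space d) 2 (volume.restrict Ω) →L[ℝ] Lp (Space d) 2 (volume.restrict Ω)}
    {H : Lp (Space d) 2 (volume.restrict Ω) →L[ℝ] Lp (Space d) 2 (volume.restrict Ω)}
    (hT : ∀ e, Elliptic α β (T e)) (hH : Elliptic α β H) (f : HNegOne Ω)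
    (hflux : ∀ (u : ι → H10 Ω) (R : ℝ), 0 ≤ R → (∀ e, ‖u e‖ ≤ R) →
      (∀ e v, inner ℝ (grad (u e)) (T e (grad v)) = f v) →
      ∀ g ∈ testFields Ω, Tendsto (fun e => inner ℝ (grad (u e)) (T e g - H g)) l (𝓝 0)) :
    ∃ (u : ι → H10 Ω) (ubar : H10 Ω),
      (∀ e w, (∀ v, inner ℝ (grad w) (T e (grad v)) = f v) ↔ w = u e) ∧
      (∀ w, (∀ v, inner ℝ (grad w) (H (grad v)) = f v) ↔ w = ubar) ∧
      (∀ g : HNegOne Ω, Tendsto (fun e => g (u e)) l (𝓝 (g ubar))) ∧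
      (∀ g, Tendsto (fun e => inner ℝ (grad (u e)) (T e g)) l (𝓝 (inner ℝ (grad ubar) (H g)))) := by
  choose u hu hub using fun e => exists_solution hα hC hP ((hT e).adjoint hβ) f
  obtain ⟨ubar, hubar, -⟩ := exists_solution hα hC hP (hH.adjoint hβ) f
  simp only [ContinuousLinearMap.adjoint_inner_left] at hu hubar
  have hR : 0 ≤ C / α * ‖f‖ := by positivity
  have hsol : ∀ e v, inner ℝ (grad (u e)) (T e (grad v)) = f v := fun e => (hu e (u e)).2 rfl
  have hsolbar : ∀ v, inner ℝ (grad ubar) (H (grad v)) = f v := (hubar ubar).2 rfl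
  have key : ∀ g, Tendsto (fun e => inner ℝ (grad (u e)) ((T e - H) g)) l (𝓝 0) :=
    tendsto_inner_of_span (T := fun e => T e - H) (dense_span_testFields hΩ) hR
      (add_nonneg hβ.le hβ.le)
      (fun e => (norm_grad_le _).trans (hub e))
      (fun e => (norm_sub_le _ _).trans (add_le_add ((hT e).norm_le hβ) (hH.norm_le hβ)))
      (hflux u _ hR hub hsol)
  have hweak : ∀ g : HNegOne Ω, Tendsto (fun e => g (u e)) l (𝓝 (g ubar)) := by
    intro g
    obtain ⟨v, hv, -⟩ := exists_solution hα hC hP hH g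
    have hv' : ∀ w, inner ℝ (H (grad v)) (grad w) = g w := (hv v).2 rfl
    have e1 : ∀ e, g (u e) = f v - inner ℝ (grad (u e)) ((T e - H) (grad v)) := by
      intro e
      rw [← hv', sub_apply, inner_sub_right, hsol, real_inner_comm]
      ring
    have e2 : g ubar = f v - 0 := by
      rw [← hv', real_inner_comm, hsolbar, sub_zero]
    simp_rw [e1]
    rw [e2]
    exact tendsto_const_nhds.sub (key (grad v))
  refine ⟨u, ubar, hu, hubar, hweak, fun g => ?_⟩
  have h1 := (hweak ((innerSL ℝ (H g)).comp (gradL Ω))).add (key g)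
  have h2 : ∀ w : H10 Ω, ((innerSL ℝ (H g)).comp (gradL Ω)) w = inner ℝ (grad w) (H g) := by
    intro w
    rw [real_inner_comm]
    rfl
  simp only [h2, sub_apply, inner_sub_right, add_sub_cancel, add_zero] at h1
  exact h1

/-- Convergence of solutions and fluxes for oscillating coefficients. -/
theorem Oscillation.exists_tendsto {I : Type*} [Fintype I] {ι : Type*} {l : Filter ι}
    (o : Oscillation I d l) {α β : ℝ}
    {b : Space d → C(UnitAddTorus I, Space d →L[ℝ] Space d)}
    (hd : 0 < d) (hΩ : IsOpen Ω) (hΩb : Bornology.IsBounded Ω)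
    (hb : ∀ x t, Elliptic α β (b x t)) (hα : 0 < α) (hβ : 0 < β) (hbc : ContinuousOn b Ω)
    (hF : ∀ e, MemLp (o.field b e) ∞ (volume.restrict Ω))
    (hH : MemLp (effectiveField hb hα o.dir) ∞ (volume.restrict Ω)) (f : HNegOne Ω) :
    ∃ (u : ι → H10 Ω) (ubar : H10 Ω),
      (∀ e w, (∀ v, inner ℝ (grad w) (mulOp (o.field b e) (hF e) (grad v)) = f v) ↔ w = u e) ∧
      (∀ w, (∀ v, inner ℝ (grad w) (mulOp (effectiveField hb hα o.dir) hH (grad v)) = f v) ↔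
        w = ubar) ∧
      (∀ g : HNegOne Ω, Tendsto (fun e => g (u e)) l (𝓝 (g ubar))) ∧
      (∀ g, Tendsto (fun e => inner ℝ (grad (u e)) (mulOp (o.field b e) (hF e) g)) l
        (𝓝 (inner ℝ (grad ubar) (mulOp (effectiveField hb hα o.dir) hH g)))) := by
  have : IsFiniteMeasure (volume.restrict Ω) :=
    isFiniteMeasure_restrict.2 hΩb.measure_lt_top.ne
  obtain ⟨C, hC, hP⟩ := exists_norm_le_grad hd hΩb
  refine exists_tendsto_of_tendsto_flux hΩ hα hβ hC hP
    (fun e => elliptic_mulOp _ (Eventually.of_forall fun x => hb x _))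
    (elliptic_mulOp _ (Eventually.of_forall fun x => elliptic_effectiveField hb hα _ o.dir_neg x))
    f fun u R hR hu hsol g hg => ?_
  obtain ⟨φ, hφ, ξ, rfl⟩ := hg
  exact o.tendsto_flux hΩ hb hα hβ hbc (hbc.aestronglyMeasurable hΩ.measurableSet) hH hR hu
    hsol hφ ξ

end Convergence

/-! ### Matrix fields as operator fields -/

section MatrixField

variable {d : ℕ}

/-- The operator on `ℝ^d` of a matrix. -/
abbrev matrixOp (d : ℕ) : Matrix (Fin d) (Fin d) ℝ ≃⋆ₐ[ℝ] (Space d →L[ℝ] Space d) :=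
  Matrix.toEuclideanCLM (𝕜 := ℝ) (n := Fin d)

theorem toEuclideanLin_eq_matrixOp (M : Matrix (Fin d) (Fin d) ℝ) (ξ : Space d) :
    Matrix.toEuclideanLin M ξ = matrixOp d M ξ := rfl

theorem continuous_matrixOp : Continuous (matrixOp d) :=
  LinearMap.continuous_of_finiteDimensional (matrixOp d).toAlgEquiv.toLinearMap

theorem abs_entry_le (M : Matrix (Fin d) (Fin d) ℝ) (i j : Fin d) :
    |M i j| ≤ ‖matrixOp d M‖ := by
  have h1 : matrixOp d M (EuclideanSpace.single j 1) i = M i j := by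
    have h := congrFun (Matrix.ofLp_toEuclideanCLM M (EuclideanSpace.single j (1 : ℝ))) i
    rw [h]
    simp
  rw [← h1, ← Real.norm_eq_abs]
  refine (PiLp.norm_apply_le _ i).trans (((matrixOp d M).le_opNorm _).trans ?_)
  simp

theorem exists_norm_matrixOp_le (d : ℕ) : ∃ K : ℝ, 0 < K ∧
    ∀ (M : Matrix (Fin d) (Fin d) ℝ) (C : ℝ), (∀ i j, |M i j| ≤ C) → 0 ≤ C →
      ‖matrixOp d M‖ ≤ K * C := by
  refine ⟨1 + ∑ i, ∑ j, ‖matrixOp d (Matrix.single i j 1)‖, by positivity, fun M C hM hC => ?_⟩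
  have h1 : matrixOp d M = ∑ i, ∑ j, M i j • matrixOp d (Matrix.single i j 1) := by
    conv_lhs => rw [Matrix.matrix_eq_sum_single M]
    simp_rw [map_sum]
    refine Finset.sum_congr rfl fun i _ => Finset.sum_congr rfl fun j _ => ?_
    rw [← map_smul, Matrix.smul_single, smul_eq_mul, mul_one]
  rw [h1, add_mul, one_mul, Finset.sum_mul]
  refine le_add_of_nonneg_of_le hC ?_
  refine (norm_sum_le _ _).trans (Finset.sum_le_sum fun i _ => ?_)
  rw [Finset.sum_mul]
  refine (norm_sum_le _ _).trans (Finset.sum_le_sum fun j _ => ?_)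
  rw [norm_smul, mul_comm, Real.norm_eq_abs]
  exact mul_le_mul_of_nonneg_left (hM i j) (norm_nonneg _)

theorem isUnit_det_of_coercive {α : ℝ} (hα : 0 < α) {M : Matrix (Fin d) (Fin d) ℝ}
    (h : ∀ ξ : Space d, α * ‖ξ‖ ^ 2 ≤ inner ℝ (matrixOp d M ξ) ξ) : IsUnit M.det := by
  rw [← Matrix.isUnit_iff_isUnit_det, ← Matrix.mulVec_injective_iff_isUnit]
  refine (injective_iff_map_eq_zero (Matrix.mulVecLin M)).2 fun v hv => ?_
  have h1 := h (WithLp.toLp 2 v)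
  have h2 : M.mulVec v = 0 := hv
  rw [matrixOp, Matrix.toEuclideanCLM_toLp, h2] at h1
  have h3 : ‖(WithLp.toLp 2 v : Space d)‖ ^ 2 ≤ 0 := by
    have h4 : α * ‖(WithLp.toLp 2 v : Space d)‖ ^ 2 ≤ 0 := by simpa using h1
    exact nonpos_of_mul_nonpos_right h4 hα
  have h5 : (WithLp.toLp 2 v : Space d) = 0 :=
    norm_eq_zero.1 (pow_eq_zero_iff two_ne_zero |>.1 (le_antisymm h3 (sq_nonneg _)))
  exact congrArg WithLp.ofLp h5

/-- Ellipticity in terms of a matrix and its inverse. -/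
theorem elliptic_matrixOp_iff {α β : ℝ} (hα : 0 < α) (hβ : 0 < β)
    {M : Matrix (Fin d) (Fin d) ℝ} :
    Elliptic α β (matrixOp d M) ↔
      (∀ ξ : Space d, β⁻¹ * ‖ξ‖ ^ 2 ≤ inner ℝ (Matrix.toEuclideanLin M⁻¹ ξ) ξ) ∧
      ∀ ξ : Space d, α * ‖ξ‖ ^ 2 ≤ inner ℝ (Matrix.toEuclideanLin M ξ) ξ := by
  simp only [toEuclideanLin_eq_matrixOp]
  have key : (∀ ξ : Space d, α * ‖ξ‖ ^ 2 ≤ inner ℝ (matrixOp d M ξ) ξ) →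
      (∀ ξ, matrixOp d M⁻¹ (matrixOp d M ξ) = ξ) ∧ ∀ ξ, matrixOp d M (matrixOp d M⁻¹ ξ) = ξ := by
    intro h
    have hu := isUnit_det_of_coercive hα h
    refine ⟨fun ξ => ?_, fun ξ => ?_⟩
    · rw [← mul_apply_eq_comp, ← map_mul, Matrix.nonsing_inv_mul _ hu, map_one]
      rfl
    · rw [← mul_apply_eq_comp, ← map_mul, Matrix.mul_nonsing_inv _ hu, map_one]
      rfl
  constructor
  · intro h
    refine ⟨fun ξ => ?_, h.coercive⟩
    have h1 := h.sq_le (matrixOp d M⁻¹ ξ)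
    rw [(key h.coercive).2, real_inner_comm] at h1
    rwa [inv_mul_le_iff₀ hβ]
  · rintro ⟨h1, h2⟩
    refine ⟨h2, fun ξ => ?_⟩
    have h3 := h1 (matrixOp d M ξ)
    rwa [(key h2).1, real_inner_comm, inv_mul_le_iff₀ hβ] at h3

theorem isClosed_setOf_elliptic (α β : ℝ) :
    IsClosed {T : Space d →L[ℝ] Space d | Elliptic α β T} := by
  have h : {T : Space d →L[ℝ] Space d | Elliptic α β T} =
      (⋂ ξ : Space d, {T | α * ‖ξ‖ ^ 2 ≤ inner ℝ (T ξ) ξ}) ∩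
        ⋂ ξ : Space d, {T | ‖T ξ‖ ^ 2 ≤ β * inner ℝ (T ξ) ξ} := by
    ext T
    simp only [Set.mem_inter_iff, Set.mem_iInter, Set.mem_ofPred_eq]
    exact ⟨fun h => ⟨h.1, h.2⟩, fun h => ⟨h.1, h.2⟩⟩
  rw [h]
  refine (isClosed_iInter fun ξ => isClosed_le (by fun_prop) (by fun_prop)).inter
    (isClosed_iInter fun ξ => isClosed_le (by fun_prop) (by fun_prop))

/-- A closed property which holds almost everywhere for a continuous function on an open set holds
everywhere. -/
theorem forall_mem_of_ae_restrict {Z : Type*} [TopologicalSpace Z] {Ω : Set (Space d)}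
    (hΩ : IsOpen Ω) {f : Space d → Z} (hf : ContinuousOn f Ω) {s : Set Z} (hs : IsClosed s)
    (h : ∀ᵐ x ∂(volume.restrict Ω), f x ∈ s) : ∀ x ∈ Ω, f x ∈ s := by
  by_contra! hne
  obtain ⟨x, hx, hxs⟩ := hne
  have ho := hf.isOpen_inter_preimage hΩ hs.isOpen_compl
  have hpos := ho.measure_pos volume ⟨x, hx, hxs⟩
  rw [ae_restrict_iff' hΩ.measurableSet, ae_iff] at h
  refine hpos.ne' (measure_mono_null (fun y hy => ?_) h)
  simpa using hy

theorem MemM.elliptic {α β : ℝ} (hα : 0 < α) (hβ : 0 < β) {Ω : Set (Space d)} (hΩ : IsOpen Ω)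
    {A : Space d → Matrix (Fin d) (Fin d) ℝ} (h : MemM α β Ω A) (hA : ContinuousOn A Ω)
    {x : Space d} (hx : x ∈ Ω) : Elliptic α β (matrixOp d (A x)) := by
  refine forall_mem_of_ae_restrict hΩ (continuous_matrixOp.comp_continuousOn hA)
    (isClosed_setOf_elliptic α β) ?_ x hx
  filter_upwards [h.inv_coercive, h.coercive] with x h1 h2
  exact (elliptic_matrixOp_iff hα hβ).2 ⟨h1, h2⟩

theorem memM_of_elliptic {α β : ℝ} (hα : 0 < α) (hβ : 0 < β) {Ω : Set (Space d)} (hΩ : IsOpen Ω)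
    {A : Space d → Matrix (Fin d) (Fin d) ℝ} (hA : ContinuousOn A Ω)
    (h : ∀ x ∈ Ω, Elliptic α β (matrixOp d (A x))) : MemM α β Ω A := by
  refine ⟨fun i j => ?_, ?_, ?_⟩
  · refine memLp_top_of_bound (C := β) ?_ ?_
    · exact ((continuous_apply_apply i j).comp_continuousOn hA).aestronglyMeasurable
        hΩ.measurableSet
    · filter_upwards [ae_restrict_mem hΩ.measurableSet] with x hx
      exact (abs_entry_le _ i j).trans ((h x hx).norm_le hβ)
  all_goals
    filter_upwards [ae_restrict_mem hΩ.measurableSet] with x hx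
  · exact ((elliptic_matrixOp_iff hα hβ).1 (h x hx)).1
  · exact ((elliptic_matrixOp_iff hα hβ).1 (h x hx)).2

theorem setIntegral_inner_eq {Ω : Set (Space d)} (hΩ : MeasurableSet Ω)
    {A : Space d → Matrix (Fin d) (Fin d) ℝ} {a : Space d → Space d →L[ℝ] Space d}
    (ha : MemLp a ∞ (volume.restrict Ω))
    (h : ∀ x ∈ Ω, matrixOp d (A x) = ContinuousLinearMap.adjoint (a x))
    (g k : Lp (Space d) 2 (volume.restrict Ω)) :
    ∫ x in Ω, inner ℝ (Matrix.toEuclideanLin (A x) (g x)) (k x) = inner ℝ g (mulOp a ha k) := by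
  rw [real_inner_comm, inner_mulOp]
  refine setIntegral_congr_fun hΩ fun x hx => ?_
  simp only [toEuclideanLin_eq_matrixOp]
  rw [h x hx, ContinuousLinearMap.adjoint_inner_left, real_inner_comm]

end MatrixField

/-! ### Separated scales -/

section Scales

theorem ScalesSeparate.tendsto_div {n : ℕ} {ι : Type*} {l : Filter ι} {ε : ι → Fin n → ℝ}
    (h : ScalesSeparate l ε) (hε : ∀ k i, 0 < ε k i) {i j : Fin n} (hij : j < i) :
    Tendsto (fun k => ε k i / ε k j) l (𝓝 0) := by
  obtain ⟨i, hi⟩ := i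
  induction i with
  | zero => exact absurd hij (by simp [Fin.lt_def])
  | succ i ih =>
    have hi' : i < n := Nat.lt_of_succ_lt hi
    have h1 : Tendsto (fun k => ε k ⟨i + 1, hi⟩ / ε k ⟨i, hi'⟩) l (𝓝 0) := h.2 _ _ rfl
    rcases (Nat.lt_succ_iff.1 hij).eq_or_lt with hj | hj
    · have : j = ⟨i, hi'⟩ := Fin.ext hj
      rwa [this]
    · have h2 := h1.mul (ih hi' hj)
      rw [mul_zero] at h2
      refine h2.congr fun k => ?_
      have := (hε k ⟨i, hi'⟩).ne'
      have := (hε k j).ne'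
      field_simp

theorem ScalesSeparate.tendsto_zero {n : ℕ} {ι : Type*} {l : Filter ι} {ε : ι → Fin n → ℝ}
    (h : ScalesSeparate l ε) (hε : ∀ k i, 0 < ε k i) (i : Fin n) :
    Tendsto (fun k => ε k i) l (𝓝 0) := by
  have hn : 0 < n := i.pos
  have h0 : Tendsto (fun k => ε k ⟨0, hn⟩) l (𝓝 0) := h.1 _ rfl
  rcases (Nat.zero_le (i : ℕ)).eq_or_lt with hi | hi
  · have : i = ⟨0, hn⟩ := Fin.ext hi.symm
    rwa [this]
  · have h1 := (h.tendsto_div hε (j := ⟨0, hn⟩) hi).mul h0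
    rw [mul_zero] at h1
    refine h1.congr fun k => ?_
    have := (hε k ⟨0, hn⟩).ne'
    field_simp

theorem scalesSeparate_geometric (n : ℕ) :
    ScalesSeparate (n := n) atTop fun (k : ℕ) i => (1 / ((k : ℝ) + 1)) ^ ((i : ℕ) + 1) := by
  refine ⟨fun i hi => ?_, fun i j hij => ?_⟩
  · simpa [hi] using tendsto_one_div_add_atTop_nhds_zero_nat (𝕜 := ℝ)
  · refine tendsto_one_div_add_atTop_nhds_zero_nat.congr fun k => ?_
    have : (1 / ((k : ℝ) + 1)) ^ ((i : ℕ) + 1) ≠ 0 := by positivity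
    simp only [hij]
    rw [pow_succ _ ((i : ℕ) + 1), mul_div_cancel_left₀ _ this]

/-- `v i` is the last nonzero entry of `v`. -/
def IsLastNonzero {n : ℕ} {E : Type*} [Zero E] (v : Fin n → E) (i : Fin n) : Prop :=
  v i ≠ 0 ∧ ∀ j, i < j → v j = 0

theorem exists_isLastNonzero {n : ℕ} {E : Type*} [Zero E] {v : Fin n → E} (hv : v ≠ 0) :
    ∃ i, IsLastNonzero v i := by
  classical
  obtain ⟨i₀, hi₀⟩ := Function.ne_iff.1 hv
  obtain ⟨i, hi⟩ := (Finset.univ.filter fun i => v i ≠ 0).exists_maximal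
    ⟨i₀, by simpa using hi₀⟩
  refine ⟨i, by simpa using hi.1, fun j hij => ?_⟩
  by_contra hj
  exact absurd (hi.2 (by simpa using hj) hij.le) (not_le.2 hij)

theorem IsLastNonzero.unique {n : ℕ} {E : Type*} [Zero E] {v : Fin n → E} {i j : Fin n}
    (hi : IsLastNonzero v i) (hj : IsLastNonzero v j) : j = i := by
  rcases lt_trichotomy i j with h | h | h
  · exact absurd (hi.2 j h) hj.1
  · exact h.symm
  · exact absurd (hj.2 i h) hi.1

open Classical in
/-- The sum of `w i` over the (at most one) index `i` of the last nonzero entry of `v`. -/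
def lastSum {n : ℕ} {E F : Type*} [Zero E] [AddCommMonoid F] (v : Fin n → E) (w : Fin n → F) : F :=
  ∑ i, if IsLastNonzero v i then w i else 0

theorem IsLastNonzero.lastSum_eq {n : ℕ} {E F : Type*} [Zero E] [AddCommMonoid F]
    {v : Fin n → E} {i : Fin n} (hi : IsLastNonzero v i) (w : Fin n → F) :
    lastSum v w = w i := by
  classical
  rw [lastSum, Finset.sum_eq_single i, if_pos hi]
  · exact fun j _ hj => if_neg fun h => hj (hi.unique h)
  · simp

theorem lastSum_neg {n : ℕ} {E : Type*} [AddCommGroup E] (v : Fin n → E) :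
    lastSum (-v) (-v) = -lastSum v v := by
  classical
  have h : ∀ i, IsLastNonzero (-v) i ↔ IsLastNonzero v i := by
    intro i
    simp [IsLastNonzero]
  simp only [lastSum, h, ← Finset.sum_neg_distrib]
  refine Finset.sum_congr rfl fun i _ => ?_
  split_ifs <;> simp

end Scales

/-! ### Windings with separated scales -/

section Winding

variable {d n : ℕ} {m : Fin n → ℕ} (M : ∀ i, Matrix (Fin (m i)) (Fin d) ℝ)

/-- The class of `(M₁ y₁, …, M_n y_n)` in the torus. -/
def winding (y : Fin n → Space d) : UnitAddTorus ((i : Fin n) × Fin (m i)) :=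
  fun p => (((M p.1).mulVec (y p.1).ofLp p.2 : ℝ) : UnitAddCircle)

theorem continuous_winding : Continuous (winding M) := by
  refine continuous_pi fun p => (AddCircle.continuous_mk' 1).comp ?_
  have h : Continuous fun y : Fin n → Space d => (M p.1).mulVec (y p.1).ofLp :=
    ((Matrix.mulVecLin (M p.1)).continuous_of_finiteDimensional).comp
      ((PiLp.continuous_ofLp 2 _).comp (continuous_apply p.1))
  exact (continuous_apply p.2).comp h

/-- The blocks `M_iᵀ k_i` of the frequency of the `k`-th character. -/
def freqBlock (k : (i : Fin n) × Fin (m i) → ℤ) (i : Fin n) : Space d :=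
  WithLp.toLp 2 ((M i).transpose.mulVec fun j => (k ⟨i, j⟩ : ℝ))

theorem freqBlock_neg (k : (i : Fin n) × Fin (m i) → ℤ) : freqBlock M (-k) = -freqBlock M k := by
  ext i j
  simp [freqBlock, Matrix.mulVec, dotProduct]

theorem freqBlock_ne_zero
    (hM : ∀ i, ∀ z : Fin (m i) → ℤ, z ≠ 0 → (M i).transpose.mulVec (fun j => (z j : ℝ)) ≠ 0)
    {k : (i : Fin n) × Fin (m i) → ℤ} (hk : k ≠ 0) : freqBlock M k ≠ 0 := by
  obtain ⟨⟨i, j⟩, hij⟩ := Function.ne_iff.1 hk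
  intro h
  refine hM i (fun j => k ⟨i, j⟩) (fun h0 => hij (congrFun h0 j)) ?_
  exact congrArg WithLp.ofLp (congrFun h i)

theorem inner_freqBlock (k : (i : Fin n) × Fin (m i) → ℤ) (i : Fin n) (x : Space d) :
    inner ℝ (freqBlock M k i) x = ∑ j, (k ⟨i, j⟩ : ℝ) * (M i).mulVec x.ofLp j := by
  rw [PiLp.inner_apply]
  simp only [freqBlock, Matrix.mulVec, dotProduct, Matrix.transpose_apply, Finset.mul_sum]
  simp only [RCLike.inner_apply, conj_trivial, Finset.mul_sum]
  rw [Finset.sum_comm]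
  exact Finset.sum_congr rfl fun i _ => Finset.sum_congr rfl fun j _ => by ring

theorem mFourier_winding (k : (i : Fin n) × Fin (m i) → ℤ) (y : Fin n → Space d) :
    UnitAddTorus.mFourier k (winding M y) =
      Complex.exp (((2 * Real.pi * ∑ i, inner ℝ (freqBlock M k i) (y i) : ℝ) : ℂ) *
        Complex.I) := by
  have h1 : UnitAddTorus.mFourier k (winding M y) =
      ∏ p, fourier (T := (1 : ℝ)) (k p) (winding M y p) := rfl
  rw [h1]
  simp only [winding, fourier_coe_apply]
  rw [← Complex.exp_sum]
  congr 1
  simp only [inner_freqBlock]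
  rw [← Finset.univ_sigma_univ, Finset.sum_sigma]
  push_cast
  rw [Finset.mul_sum, Finset.sum_mul]
  refine Finset.sum_congr rfl fun i _ => ?_
  rw [Finset.mul_sum, Finset.sum_mul]
  refine Finset.sum_congr rfl fun j _ => ?_
  ring

variable {M}

/-- The windings `x ↦ (M₁ x / ε₁, …, M_n x / ε_n)` along separated scales. -/
def ScalesSeparate.oscillation {ι : Type*} {l : Filter ι} {ε : ι → Fin n → ℝ}
    (h : ScalesSeparate l ε) (hε : ∀ k i, 0 < ε k i)
    (hM : ∀ i, ∀ z : Fin (m i) → ℤ, z ≠ 0 → (M i).transpose.mulVec (fun j => (z j : ℝ)) ≠ 0) :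
    Oscillation ((i : Fin n) × Fin (m i)) d l where
  point e x := winding M fun i => (ε e i)⁻¹ • x
  continuous_point e := (continuous_winding M).comp (by fun_prop)
  freq e k := ∑ i, (ε e i)⁻¹ • freqBlock M k i
  mFourier_point e k x := by
    simp only [mFourier_winding, sum_inner, inner_smul_left, inner_smul_right, conj_trivial]
  dir k := lastSum (freqBlock M k) (freqBlock M k)
  dir_neg k := by rw [freqBlock_neg, lastSum_neg]
  dir_ne_zero k hk := by
    obtain ⟨i, hi⟩ := exists_isLastNonzero (freqBlock_ne_zero M hM hk)
    rw [hi.lastSum_eq]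
    exact hi.1
  scale e k := lastSum (freqBlock M k) (ε e)
  scale_tendsto k hk := by
    obtain ⟨i, hi⟩ := exists_isLastNonzero (freqBlock_ne_zero M hM hk)
    simp only [hi.lastSum_eq]
    exact h.tendsto_zero hε i
  scale_smul_freq k hk := by
    obtain ⟨i, hi⟩ := exists_isLastNonzero (freqBlock_ne_zero M hM hk)
    simp only [hi.lastSum_eq, Finset.smul_sum, smul_smul]
    have h1 : freqBlock M k i = ∑ j, if j = i then freqBlock M k j else 0 := by simp
    rw [h1]
    refine tendsto_finsetSum _ fun j _ => ?_
    rcases lt_trichotomy j i with hj | hj | hj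
    · have h2 := (h.tendsto_div hε hj).smul_const (freqBlock M k j)
      rw [zero_smul] at h2
      simpa [hj.ne, div_eq_mul_inv] using h2
    · subst hj
      simpa [(hε _ j).ne'] using tendsto_const_nhds
    · simpa [hi.2 j hj] using tendsto_const_nhds

end Winding

/-! ### Periodic functions as functions on the torus -/

/-- A continuous function of `x` and `w`, periodic in `w`, as a continuous family of functions on
the torus. -/
theorem exists_continuousMap_torus {I X Z : Type*} [Fintype I] [TopologicalSpace X]
    [TopologicalSpace Z] {F : X × (I → ℝ) → Z} (hF : Continuous F)
    (hper : ∀ x w (z : I → ℤ), F (x, fun i => w i + z i) = F (x, w)) :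
    ∃ b : C(X, C(UnitAddTorus I, Z)), ∀ x w, b x (fun i => (w i : UnitAddCircle)) = F (x, w) := by
  have hq : IsOpenQuotientMap (Pi.map fun (_ : I) (t : ℝ) => (t : UnitAddCircle)) :=
    IsOpenQuotientMap.piMap fun _ => QuotientAddGroup.isOpenQuotientMap_mk
  have hq' := (IsOpenQuotientMap.id (X := X)).prodMap hq
  have hfac : Function.FactorsThrough F
      (Prod.map id (Pi.map fun (_ : I) (t : ℝ) => (t : UnitAddCircle))) := by
    rintro ⟨x, w⟩ ⟨x', w'⟩ h
    obtain ⟨rfl, h2⟩ := Prod.mk.inj h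
    have h3 : ∀ i, ∃ z : ℤ, w i = w' i + z := by
      intro i
      have h4 : (w i : UnitAddCircle) = w' i := congrFun h2 i
      rw [← sub_eq_zero, ← AddCircle.coe_sub, AddCircle.coe_eq_zero_iff] at h4
      obtain ⟨z, hz⟩ := h4
      refine ⟨z, ?_⟩
      rw [zsmul_one] at hz
      linarith
    choose z hz using h3
    have h5 : w = fun i => w' i + z i := funext hz
    rw [h5]
    exact hper _ _ _
  let G : C(X × UnitAddTorus I, Z) :=
    Topology.IsQuotientMap.lift (f := ⟨_, hq'.continuous⟩) hq'.isQuotientMap ⟨F, hF⟩ hfac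
  refine ⟨G.curry, fun x w => ?_⟩
  exact congrArg (fun f : C(X × (I → ℝ), Z) => f (x, w))
    (Topology.IsQuotientMap.lift_comp (f := ⟨_, hq'.continuous⟩) hq'.isQuotientMap ⟨F, hF⟩ hfac)

/-! ### Quasi-periodic coefficients -/

section QuasiPeriodic

theorem elliptic_smul_id {H : Type*} [NormedAddCommGroup H] [InnerProductSpace ℝ H] {α β : ℝ}
    (hα : 0 < α) (hαβ : α ≤ β) : Elliptic α β (α • ContinuousLinearMap.id ℝ H) := by
  refine ⟨fun x => ?_, fun x => ?_⟩
  · simp [inner_smul_left]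
  · simp only [smul_apply, ContinuousLinearMap.id_apply, norm_smul, inner_smul_left,
      real_inner_self_eq_norm_sq, conj_trivial, Real.norm_eq_abs, abs_of_pos hα, mul_pow]
    have : 0 ≤ (β - α) * (α * ‖x‖ ^ 2) := mul_nonneg (sub_nonneg.2 hαβ) (by positivity)
    nlinarith

variable {d n : ℕ} {Ω : Set (Space d)} {α β γ : ℝ}
  {A : Space d → (Fin n → Space d) → Matrix (Fin d) (Fin d) ℝ}
  {m : Fin n → ℕ} {M : ∀ i, Matrix (Fin (m i)) (Fin d) ℝ}
  {B : Space d → (∀ i, Fin (m i) → ℝ) → Matrix (Fin d) (Fin d) ℝ}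

theorem continuousOn_comp_of_eq
    (hBc : ContinuousOn (fun p : Space d × (∀ i, Fin (m i) → ℝ) => B p.1 p.2) (Ω ×ˢ Set.univ))
    (hAB : ∀ x ∈ Ω, ∀ y : Fin n → Space d, A x y = B x (fun i => (M i).mulVec (y i).ofLp))
    {y : Space d → Fin n → Space d} (hy : Continuous y) :
    ContinuousOn (fun x => A x (y x)) Ω := by
  have h1 : Continuous fun x => (x, fun i => (M i).mulVec (y x i).ofLp) := by
    refine continuous_id.prodMk (continuous_pi fun i => ?_)
    exact ((Matrix.mulVecLin (M i)).continuous_of_finiteDimensional).comp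
      ((PiLp.continuous_ofLp 2 _).comp ((continuous_apply i).comp hy))
  have h2 := hBc.comp h1.continuousOn (s := Ω) (fun x hx => ⟨hx, trivial⟩)
  exact h2.congr fun x hx => hAB x hx (y x)

/-- The transposed coefficients as a family of functions on the torus. -/
theorem exists_torus_coefficients
    (hBc : ContinuousOn (fun p : Space d × (∀ i, Fin (m i) → ℝ) => B p.1 p.2) (Ω ×ˢ Set.univ))
    (hBp : ∀ x ∈ Ω, ∀ (w : ∀ i, Fin (m i) → ℝ) (z : ∀ i, Fin (m i) → ℤ),
      B x (fun i j => w i j + (z i j : ℝ)) = B x w)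
    (hAB : ∀ x ∈ Ω, ∀ y : Fin n → Space d, A x y = B x (fun i => (M i).mulVec (y i).ofLp)) :
    ∃ b : C(Ω, C(UnitAddTorus ((i : Fin n) × Fin (m i)), Space d →L[ℝ] Space d)),
      ∀ (x : Ω) y, b x (winding M y) = ContinuousLinearMap.adjoint (matrixOp d (A x y)) := by
  have h1 : Continuous fun p : Ω × ((i : Fin n) × Fin (m i) → ℝ) =>
      ((p.1 : Space d), fun (i : Fin n) (j : Fin (m i)) => p.2 ⟨i, j⟩) := by
    fun_prop
  have h2 : Continuous fun p : Ω × ((i : Fin n) × Fin (m i) → ℝ) =>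
      B p.1 (fun i j => p.2 ⟨i, j⟩) :=
    hBc.comp_continuous h1 fun p => ⟨p.1.2, trivial⟩
  have h3 : Continuous fun p : Ω × ((i : Fin n) × Fin (m i) → ℝ) =>
      ContinuousLinearMap.adjoint (matrixOp d (B p.1 (fun i j => p.2 ⟨i, j⟩))) :=
    ContinuousLinearMap.adjoint.continuous.comp (continuous_matrixOp.comp h2)
  obtain ⟨b, hb⟩ := exists_continuousMap_torus h3 fun x w z => by
    simp only
    rw [hBp x x.2 (fun i j => w ⟨i, j⟩) (fun i j => z ⟨i, j⟩)]
  refine ⟨b, fun x y => ?_⟩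
  rw [hAB x x.2]
  exact hb x fun p => (M p.1).mulVec (y p.1).ofLp p.2

/-- The windings with all scales are dense in the torus. -/
theorem nonneg_of_forall_winding
    (hM : ∀ i, ∀ z : Fin (m i) → ℤ, z ≠ 0 → (M i).transpose.mulVec (fun j => (z j : ℝ)) ≠ 0)
    {f : UnitAddTorus ((i : Fin n) × Fin (m i)) → ℝ} (hc : Continuous f)
    (hf : ∀ y, 0 ≤ f (winding M y)) (t : UnitAddTorus ((i : Fin n) × Fin (m i))) : 0 ≤ f t :=
  ((scalesSeparate_geometric n).oscillation (fun _ _ => by positivity) hM).nonneg_of_forall_point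
    (f := ⟨f, hc⟩) (fun k x => hf fun i => ((1 / ((k : ℝ) + 1)) ^ ((i : ℕ) + 1))⁻¹ • x) t

theorem exists_elliptic_torus_coefficients (hΩ : IsOpen Ω) (hα : 0 < α) (hαβ : α ≤ β)
    (hAM : ∀ y, MemM α β Ω (fun x => A x y)) (hAH : IsHolder γ Ω A)
    (hM : ∀ i, ∀ z : Fin (m i) → ℤ, z ≠ 0 → (M i).transpose.mulVec (fun j => (z j : ℝ)) ≠ 0)
    (hBc : ContinuousOn (fun p : Space d × (∀ i, Fin (m i) → ℝ) => B p.1 p.2) (Ω ×ˢ Set.univ))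
    (hBp : ∀ x ∈ Ω, ∀ (w : ∀ i, Fin (m i) → ℝ) (z : ∀ i, Fin (m i) → ℤ),
      B x (fun i j => w i j + (z i j : ℝ)) = B x w)
    (hAB : ∀ x ∈ Ω, ∀ y : Fin n → Space d, A x y = B x (fun i => (M i).mulVec (y i).ofLp)) :
    ∃ b : Space d → C(UnitAddTorus ((i : Fin n) × Fin (m i)), Space d →L[ℝ] Space d),
      (∀ x t, Elliptic α β (b x t)) ∧ ContinuousOn b Ω ∧
      (∃ L : ℝ, 0 < L ∧ ∀ x ∈ Ω, ∀ x' ∈ Ω, ‖b x - b x'‖ ≤ L * ‖x - x'‖ ^ γ) ∧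
      ∀ x ∈ Ω, ∀ y, b x (winding M y) = ContinuousLinearMap.adjoint (matrixOp d (A x y)) := by
  classical
  have hβ : 0 < β := hα.trans_le hαβ
  obtain ⟨b, hb⟩ := exists_torus_coefficients hBc hBp hAB
  have hell : ∀ (x : Ω) y, Elliptic α β (b x (winding M y)) := by
    intro x y
    rw [hb]
    exact ((hAM y).elliptic hα hβ hΩ (continuousOn_comp_of_eq hBc hAB continuous_const)
      x.2).adjoint hβ
  have hell' : ∀ (x : Ω) t, Elliptic α β (b x t) := by
    intro x t
    refine ⟨fun ξ => sub_nonneg.1 ?_, fun ξ => sub_nonneg.1 ?_⟩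
    · exact nonneg_of_forall_winding hM (f := fun t => inner ℝ (b x t ξ) ξ - α * ‖ξ‖ ^ 2)
        (by fun_prop) (fun y => sub_nonneg.2 ((hell x y).coercive ξ)) t
    · exact nonneg_of_forall_winding hM
        (f := fun t => β * inner ℝ (b x t ξ) ξ - ‖b x t ξ‖ ^ 2)
        (by fun_prop) (fun y => sub_nonneg.2 ((hell x y).sq_le ξ)) t
  refine ⟨fun x => if h : x ∈ Ω then b ⟨x, h⟩ else
    ContinuousMap.const _ (α • ContinuousLinearMap.id ℝ (Space d)), ?_, ?_, ?_, ?_⟩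
  · intro x t
    by_cases hx : x ∈ Ω
    · simpa only [dif_pos hx] using hell' ⟨x, hx⟩ t
    · simpa only [dif_neg hx, ContinuousMap.const_apply] using elliptic_smul_id hα hαβ
  · rw [continuousOn_iff_continuous_domRestrict]
    refine b.continuous.congr fun x => ?_
    simp
  · obtain ⟨L, hL, hA⟩ := hAH
    obtain ⟨K, hK, hKM⟩ := exists_norm_matrixOp_le d
    refine ⟨K * L, by positivity, fun x hx x' hx' => ?_⟩
    simp only [dif_pos hx, dif_pos hx']
    have h0 : 0 ≤ L * ‖x - x'‖ ^ γ := by positivity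
    refine (ContinuousMap.norm_le _ (by positivity)).2 fun t => sub_nonneg.1 ?_
    refine nonneg_of_forall_winding hM
      (f := fun t => K * L * ‖x - x'‖ ^ γ - ‖(b ⟨x, hx⟩ - b ⟨x', hx'⟩) t‖)
      (by fun_prop) (fun y => sub_nonneg.2 ?_) t
    rw [ContinuousMap.sub_apply, hb, hb, ← map_sub, LinearIsometryEquiv.norm_map, ← map_sub,
      mul_assoc]
    refine hKM _ _ (fun i j => ?_) h0
    simpa using hA x hx x' hx' y y i j
  · intro x hx y
    simp only [dif_pos hx]
    exact hb ⟨x, hx⟩ y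

end QuasiPeriodic

end

end Homogenization

open Homogenization MeasureTheory Filter Topology in
theorem theorem2 {d n : ℕ} (hd : 2 ≤ d) (hn : 1 ≤ n)
    (Ω : Set (Homogenization.Space d)) (hΩo : IsOpen Ω) (hΩc : IsConnected Ω)
    (hΩb : Bornology.IsBounded Ω)
    (α β γ : ℝ) (hα : 0 < α) (hαβ : α ≤ β) (hγ : 0 < γ) (hγ1 : γ ≤ 1)
    (A : Homogenization.Space d → (Fin n → Homogenization.Space d) →
      Matrix (Fin d) (Fin d) ℝ)
    (hAM : ∀ y, Homogenization.MemM α β Ω (fun x => A x y))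
    (hAH : Homogenization.IsHolder γ Ω A)
    (hAQ : Homogenization.IsQuasiPeriodic Ω A)
    {ι : Type*} (l : Filter ι) [l.IsCountablyGenerated]
    (ε : ι → Fin n → ℝ) (hε : ∀ k i, 0 < ε k i)
    (hsep : Homogenization.ScalesSeparate l ε) :
    ∃ Abar : Homogenization.Space d → Matrix (Fin d) (Fin d) ℝ,
      (∃ L : ℝ, 0 < L ∧ ∀ x ∈ Ω, ∀ x' ∈ Ω, ∀ i j,
        |Abar x i j - Abar x' i j| ≤ L * ‖x - x'‖ ^ γ) ∧
      Homogenization.MemM α β Ω Abar ∧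
      Homogenization.HConverges α β Ω l
        (fun k x => A x (fun i => (ε k i)⁻¹ • x)) Abar := by
  obtain ⟨m, M, B, -, hM, hBc, hBp, hAB⟩ := hAQ
  have hβ : 0 < β := hα.trans_le hαβ
  obtain ⟨b, hb, hbc, ⟨L, hL, hbL⟩, hbA⟩ :=
    exists_elliptic_torus_coefficients hΩo hα hαβ hAM hAH hM hBc hBp hAB
  let o := hsep.oscillation hε hM
  let H := effectiveField hb hα o.dir
  have hHell : ∀ x, Elliptic α β (H x) := elliptic_effectiveField hb hα _ o.dir_neg
  have hHsub : ∀ x y, ‖H x - H y‖ ≤ (1 + β / α) * (1 + β / α) * ‖b x - b y‖ :=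
    norm_effectiveField_sub_le hb hα o.dir hβ
  have hHc : ContinuousOn H Ω := continuousOn_of_norm_sub_le
    (F := C(UnitAddTorus ((i : Fin n) × Fin (m i)), Space d →L[ℝ] Space d)) hHsub hbc
  have hHm : MemLp H ⊤ (volume.restrict Ω) :=
    memLp_top_of_bound (hHc.aestronglyMeasurable hΩo.measurableSet) β
      (Eventually.of_forall fun x => (hHell x).norm_le hβ)
  have hF : ∀ e, MemLp (o.field b e) ⊤ (volume.restrict Ω) :=
    o.memLp_field hb hβ (hbc.aestronglyMeasurable hΩo.measurableSet)
  let Abar : Space d → Matrix (Fin d) (Fin d) ℝ := fun x =>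
    (matrixOp d).symm (ContinuousLinearMap.adjoint (H x))
  have hAbar : ∀ x, matrixOp d (Abar x) = ContinuousLinearMap.adjoint (H x) := fun x =>
    (matrixOp d).apply_symm_apply _
  have hAbarL : ∀ x ∈ Ω, ∀ x' ∈ Ω, ∀ i j, |Abar x i j - Abar x' i j| ≤
      (1 + β / α) * (1 + β / α) * L * ‖x - x'‖ ^ γ := by
    intro x hx x' hx' i j
    have h1 := abs_entry_le (Abar x - Abar x') i j
    have h3 : ‖matrixOp d (Abar x - Abar x')‖ = ‖H x - H x'‖ := by
      rw [map_sub, hAbar, hAbar, ← LinearIsometryEquiv.norm_map ContinuousLinearMap.adjoint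
        (H x - H x'), map_sub]
    rw [h3] at h1
    have h2 := mul_le_mul_of_nonneg_left (hbL x hx x' hx')
      (show 0 ≤ (1 + β / α) * (1 + β / α) by positivity)
    rw [← mul_assoc] at h2
    exact h1.trans ((hHsub x x').trans h2)
  have hAbarc : ContinuousOn Abar Ω := by
    have h1 : Continuous ((matrixOp d).symm.toAlgEquiv.toLinearMap) :=
      LinearMap.continuous_of_finiteDimensional _
    exact h1.comp_continuousOn (ContinuousLinearMap.adjoint.continuous.comp_continuousOn hHc)
  have hmem : MemM α β Ω Abar := by
    refine memM_of_elliptic hα hβ hΩo hAbarc fun x _ => ?_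
    rw [hAbar]
    exact (hHell x).adjoint hβ
  have hop : ∀ k, ∀ x ∈ Ω, matrixOp d (A x fun i => (ε k i)⁻¹ • x) =
      ContinuousLinearMap.adjoint (o.field b k x) := by
    intro k x hx
    have h1 : o.field b k x = _ := hbA x hx fun i => (ε k i)⁻¹ • x
    rw [h1, ContinuousLinearMap.adjoint_adjoint]
  refine ⟨Abar, ⟨_, by positivity, hAbarL⟩, hmem, ⟨fun k => ?_, ⟨α, β, hα, hαβ, hmem⟩, fun f => ?_⟩⟩
  · refine memM_of_elliptic hα hβ hΩo
      (continuousOn_comp_of_eq hBc hAB (y := fun x i => (ε k i)⁻¹ • x) (by fun_prop))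
      fun x hx => ?_
    rw [hop k x hx]
    exact (hb x _).adjoint hβ
  · obtain ⟨u, ubar, h1, h2, h3, h4⟩ :=
      o.exists_tendsto (by omega) hΩo hΩb hb hα hβ hbc hF hHm f
    refine ⟨u, ubar, fun k v => ?_, fun v => ?_, h3, fun g => ?_⟩
    · rw [← h1 k v]
      simp only [IsWeakSolution, setIntegral_inner_eq hΩo.measurableSet (hF k) (hop k)]
    · rw [← h2 v]
      simp only [IsWeakSolution, setIntegral_inner_eq hΩo.measurableSet hHm fun x _ => hAbar x]
      rfl
    · simp only [setIntegral_inner_eq hΩo.measurableSet hHm fun x _ => hAbar x]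
      refine (h4 g).congr fun k => ?_
      exact (setIntegral_inner_eq hΩo.measurableSet (hF k) (hop k) _ _).symm
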